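/- **Setting.** Let $S$ be a finite set and let $(\mu_t)_{t\ge 0}$ be probability measures on $S$ with strictly positive weights of the form $\mu_t(x)=Z_t^{-1}\exp(-\mathcal U_t(x))\,\mu_0(x)$, where $t\mapsto\mathcal U_t(x)$ is continuously differentiable on $[0,\infty)$ for each $x$ and $Z_t$ is the normalizing constant. Put $H_t(x)=-\frac{\partial}{\partial t}\log\mu_t(x)$. Let $\mathcal L_t$, $t\ge0$, be $Q$-matrices on $S$, with entries continuous in $t$, satisfying $\mu_t(x)\mathcal L_t(x,y)=\mu_t(y)\mathcal L_t(y,x)$, and let $t\mapsto\lambda_t\ge 0$ be continuous. Write $\langle f,\nu\rangle=\sum_x f(x)\nu(x)$. *Particle system.* For $N\in\mathbb N$ let $(X^N_t)_{t\ge 0}$ be a right-continuous time-inhomogeneous Markov process on $S^N$ with initial law $\mu_0^{\otimes N}$ and generator at time $t$ $$\mathcal L^N_t\varphi(x)=\lambda_t\sum_{i=1}^N\mathcal L_t^{(i)}\varphi(x)+\frac1N\sum_{i,j=1}^N\big(H_t(x_i)-H_t(x_j)\big)^+\big(\varphi(x^{i\to j})-\varphi(x)\big),$$ where $\mathcal L_t^{(i)}$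 is $\mathcal L_t$ acting on the $i$-th component and $x^{i\to j}$ is $x$ with $x_i$ replaced by $x_j$. Let $\eta^N_t=\frac1N\sum_{i}\delta_{X^N_{t,i}}$ and $\nu^N_t=\exp\big(-\int_0^t\langle H_s,\eta^N_s\rangle ds\big)\,\eta^N_t$. *Constants.* For $0\le s\le t$ let $q_{s,t}f$ be the unique solution on $[0,t]$ of $-\frac{\partial}{\partial s}q_{s,t}f=\lambda_s\mathcal L_sq_{s,t}f-H_sq_{s,t}f$ with $q_{t,t}f=f$. For $2\le p\le q\le\infty$ and $r$ with $\frac1p=\frac1q+\frac1r$, set $$C_{s,t}(p,q)=\sup_{f\ne0}\frac{\|q_{s,t}f\|_{L^{2r}(\mu_s)}}{\|f\|_{L^p(\mu_t)}}\ \vee\ \sup_{f\ne0}\frac{\|q_{s,t}f\|_{L^{p}(\mu_s)}}{\|f\|_{L^{p/2}(\mu_t)}}\ \vee\ 1,$$ $$\bar C_t(p,q,\delta)=\sup_{\tau\in[0,t]}\int_0^{(\tau-\delta)^+}\|H_s\|_{L^q(\mu_s)}\,C_{s,\tau}(p,q)^2\,ds .$$ Further set $$\varepsilon^{N,p}_t=\sup\big\{\mathbb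 E\big[|\langle f,\nu^N_s\rangle-\langle f,\mu_s\rangle|^2\big]\ :\ s\in[0,t],\ f:S\to\mathbb R,\ \|f\|_{L^p(\mu_s)}\le1\big\},$$ $$V_{s,t}(f)=-\langle H_s(q_{s,t}f)^2,\mu_s\rangle+\iint|H_s(x)|\,\big(q_{s,t}f(y)-q_{s,t}f(x)\big)^2\,\mu_s(dx)\,\mu_s(dy),$$ $$v_t(p)=\sup_{\tau\in[0,t]}\ \sup_{f\neq0}\ \frac{\int_0^\tau V_{s,\tau}(f)\,ds}{\|f\|^2_{L^p(\mu_\tau)}},\qquad \operatorname{Var}_{\mu}(f)=\langle f^2,\mu\rangle-\langle f,\mu\rangle^2 .$$ **Theorem.** Fix $t_0>0$, let $\omega=\sup_{s\in[0,t_0]}(\max H_s-\min H_s)$ and $\delta=(17\omega)^{-1}$ (if $\omega=0$, then $H_s=0$ for $s\in[0,t_0]$, and the value of $\delta$ is immaterial). Let $q\in(6,\infty]$ and $p\in\big(\tfrac{4q}{q-2},q\big)$ (with $\tfrac{4q}{q-2}:=4$ if $q=\infty$), and define $\tilde p$ by $\frac1{\tilde p}=\frac1q+\frac2p$. Let $N\in\mathbb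 N$ satisfy $$N\ \ge\ 25\,\max\big(2,\ \bar C_{t_0}(p,q,\delta),\ \bar C_{t_0}(\tilde p,q,\delta)\big).$$ Then for every $t\in[0,t_0]$ and every $f:S\to\mathbb R$, $$N\,\mathbb E\big[|\langle f,\nu^N_t\rangle-\langle f,\mu_t\rangle|^2\big]\ \le\ \operatorname{Var}_{\mu_t}(f)+\int_0^tV_{s,t}(f)\,ds+\big[1+7\,\bar C_t(p,q,\delta)\,\varepsilon^{N,p}_t\big]\,\|f\|^2_{L^p(\mu_t)},$$ and $$\varepsilon^{N,p}_t\ \le\ (2+v_t(p))\,N^{-1}\,\big(1+10\,\bar C_t(p,q,\delta)\,N^{-1}\big).$$ -/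

import Mathlib

open MeasureTheory Set
open scoped ENNReal Topology

namespace SeqMC

noncomputable section

/-! ### Evolving probability measures on a finite set -/

/-- The integral `⟨f, m⟩ = ∑ₓ f(x) m(x)` of a function against a (signed) weight on a finite set. -/
def pairing {S : Type*} [Fintype S] (f m : S → ℝ) : ℝ := ∑ x, f x * m x

/-- A family `μ` of mutually absolutely continuous probability measures on a finite set `S`
(given by their strictly positive weights), represented as `μ t x = exp (-U t x) * μ 0 x / Z t`
with `U` continuously differentiable in time, together with Q-matrices `L t` on `S` satisfying the
detailed balance condition with respect to `μ t`, and intensities `lam t ≥ 0`. Times range over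
`[0, ∞)`; values at negative times are irrelevant. -/
structure EvolvingModel (S : Type*) [Fintype S] where
  μ : ℝ → S → ℝ
  U : ℝ → S → ℝ
  L : ℝ → S → S → ℝ
  lam : ℝ → ℝ
  μ_zero_pos : ∀ x, 0 < μ 0 x
  μ_zero_sum : ∑ x, μ 0 x = 1
  U_contDiff : ∀ x, ContDiffOn ℝ 1 (fun t => U t x) (Ici 0)
  μ_eq : ∀ t, 0 ≤ t → ∀ x,
    μ t x = (1 / ∑ y, Real.exp (-U t y) * μ 0 y) * Real.exp (-U t x) * μ 0 x
  L_continuous : ∀ x y, ContinuousOn (fun t => L t x y) (Ici 0)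
  L_nonneg : ∀ t, 0 ≤ t → ∀ x y, x ≠ y → 0 ≤ L t x y
  L_row_sum : ∀ t, 0 ≤ t → ∀ x, ∑ y, L t x y = 0
  detailed_balance : ∀ t, 0 ≤ t → ∀ x y, μ t x * L t x y = μ t y * L t y x
  lam_nonneg : ∀ t, 0 ≤ t → 0 ≤ lam t
  lam_continuous : ContinuousOn lam (Ici 0)

/-- A bound for linear vector fields with continuous coefficients. -/
theorem linear_field_bound {S : Type*} [Fintype S] {T : ℝ} (hT : 0 ≤ T) (B : ℝ → S → S → ℝ)
    (hB : ∀ x y, ContinuousOn (fun s => B s x y) (Icc 0 T)) :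
    ∃ K : ℝ, 0 ≤ K ∧ ∀ s ∈ Icc 0 T, ∀ (w : S → ℝ) (C : ℝ), 0 ≤ C → (∀ y, |w y| ≤ C) →
      ‖fun x => ∑ y, B s x y * w y‖ ≤ K * C := by
  obtain ⟨K, hK⟩ := isCompact_Icc.exists_bound_of_continuousOn
    (f := fun s => ∑ x, ∑ y, |B s x y|) (s := Icc 0 T)
    (continuousOn_finsetSum _ fun x _ => continuousOn_finsetSum _ fun y _ => (hB x y).abs)
  have hK0 : 0 ≤ K := (norm_nonneg _).trans (hK 0 ⟨le_rfl, hT⟩)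
  have hrow : ∀ s ∈ Icc 0 T, ∀ x, ∑ y, |B s x y| ≤ K := fun s hs x =>
    (Finset.single_le_sum (f := fun x => ∑ y, |B s x y|)
      (fun i _ => Finset.sum_nonneg fun y _ => abs_nonneg _) (Finset.mem_univ x)).trans
      ((le_abs_self _).trans (hK s hs))
  refine ⟨K, hK0, fun s hs w C hC hw => ?_⟩
  refine (pi_norm_le_iff_of_nonneg (by positivity)).2 fun x => ?_
  calc ‖∑ y, B s x y * w y‖ ≤ ∑ y, ‖B s x y * w y‖ := norm_sum_le _ _
    _ ≤ ∑ y, |B s x y| * C := by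
      refine Finset.sum_le_sum fun y _ => ?_
      rw [norm_mul, Real.norm_eq_abs, Real.norm_eq_abs]
      exact mul_le_mul_of_nonneg_left (hw y) (abs_nonneg _)
    _ = (∑ y, |B s x y|) * C := by rw [Finset.sum_mul]
    _ ≤ K * C := mul_le_mul_of_nonneg_right (hrow s hs x) hC

/-- Existence for linear systems of differential equations with continuous coefficients. -/
theorem exists_linear_ode {S : Type*} [Fintype S] {T : ℝ} (hT : 0 ≤ T) (B : ℝ → S → S → ℝ)
    (hB : ∀ x y, ContinuousOn (fun s => B s x y) (Icc 0 T)) (f : S → ℝ) :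
    ∃ u : ℝ → S → ℝ, u 0 = f ∧ ∀ s ∈ Icc 0 T, ∀ x,
      HasDerivWithinAt (fun r => u r x) (∑ y, B s x y * u s y) (Icc 0 T) s := by
  obtain ⟨K, hK0, hmul⟩ := linear_field_bound hT B hB
  set R : ℝ := ‖f‖ * Real.exp (K * T) with hR
  have hR0 : 0 ≤ R := by positivity
  let c : ℝ → ℝ := fun a => max (-R) (min a R)
  have hc_abs : ∀ a, |c a| ≤ R := fun a => abs_le.2 ⟨le_max_left _ _, max_le (by linarith)
    (min_le_right _ _)⟩
  have hc_le : ∀ a, |c a| ≤ |a| := by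
    intro a
    refine abs_le.2 ⟨?_, ?_⟩
    · rcases le_total a R with h | h
      · simp only [c, min_eq_left h]; exact (neg_abs_le a).trans (le_max_right _ _)
      · simp only [c, min_eq_right h]
        exact le_max_of_le_right ((neg_nonpos.2 (abs_nonneg a)).trans hR0)
    · exact max_le ((neg_nonpos.2 hR0).trans (abs_nonneg a))
        ((min_le_left _ _).trans (le_abs_self a))
  have hc_lip : ∀ a b, |c a - c b| ≤ |a - b| := by
    intro a b
    refine (abs_max_sub_max_le_max (-R) (min a R) (-R) (min b R)).trans (max_le (by simp) ?_)
    exact (abs_min_sub_min_le_max a R b R).trans (max_le le_rfl (by simp))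
  have hc_id : ∀ a, |a| ≤ R → c a = a := by
    intro a ha
    have := abs_le.1 ha
    simp only [c, min_eq_left this.2, max_eq_right this.1]
  let v : ℝ → (S → ℝ) → S → ℝ := fun s w x => ∑ y, B s x y * c (w y)
  have hPL : IsPicardLindelof v (⟨0, le_rfl, hT⟩ : Icc (0 : ℝ) T) f
      (⟨K * R * T, by positivity⟩) 0 ⟨K * R, by positivity⟩ ⟨K, hK0⟩ := by
    refine ⟨fun s hs => ?_, fun w _ => ?_, fun s hs w _ => ?_, ?_⟩
    · refine (LipschitzWith.of_dist_le_mul fun w w' => ?_).lipschitzOnWith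
      rw [dist_eq_norm, dist_eq_norm]
      have := hmul s hs (fun y => c (w y) - c (w' y)) ‖w - w'‖ (norm_nonneg _)
        fun y => (hc_lip _ _).trans (norm_le_pi_norm (w - w') y)
      refine le_trans (le_of_eq ?_) this
      congr 1
      funext x
      simp only [v, Pi.sub_apply, mul_sub, Finset.sum_sub_distrib]
    · exact continuousOn_pi.2 fun x => continuousOn_finsetSum _ fun y _ =>
        (hB x y).mul continuousOn_const
    · exact hmul s hs _ R hR0 fun y => hc_abs _
    · simp only [sub_zero, sub_self, max_eq_left hT, NNReal.coe_zero]
      exact le_rfl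
  obtain ⟨u, hu0, hu⟩ := hPL.exists_eq_forall_mem_Icc_hasDerivWithinAt₀
  have hbound : ∀ s ∈ Icc 0 T, ‖u s‖ ≤ R := by
    intro s hs
    have := norm_le_gronwallBound_of_norm_deriv_right_le (f := u) (f' := fun s => v s (u s))
      (δ := ‖f‖) (K := K) (ε := 0) (a := 0) (b := T)
      (fun r hr => (hu r hr).continuousWithinAt)
      (fun r hr => (hu r ⟨hr.1, hr.2.le⟩).mono_of_mem_nhdsWithin
        (Icc_mem_nhdsGE_of_mem ⟨hr.1, hr.2⟩))
      (by simp only [] at hu0; rw [hu0])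
      (fun r hr => by
        rw [add_zero]
        exact hmul r ⟨hr.1, hr.2.le⟩ _ _ (norm_nonneg _)
          fun y => (hc_le _).trans (norm_le_pi_norm (u r) y)) s hs
    rw [gronwallBound_ε0, sub_zero] at this
    refine this.trans ?_
    rw [hR]
    gcongr
    exact hs.2
  refine ⟨u, hu0, fun s hs x => ?_⟩
  have h := hasDerivWithinAt_pi.1 (hu s hs) x
  have he : v s (u s) x = ∑ y, B s x y * u s y :=
    Finset.sum_congr rfl fun y _ => by
      rw [hc_id _ ((norm_le_pi_norm (u s) y).trans (hbound s hs))]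
  rwa [he] at h

namespace EvolvingModel

variable {S : Type*} [Fintype S] (M : EvolvingModel S)

/-- The negative logarithmic time derivative `H_t(x) = -∂/∂t log μ_t(x)` (one-sided at `t = 0`). -/
def H (t : ℝ) (x : S) : ℝ := -derivWithin (fun s => Real.log (M.μ s x)) (Ici 0) t

/-- The action `(L_t f)(x) = ∑_y L_t(x,y) f(y)` of the generator on functions. -/
def genL (t : ℝ) (f : S → ℝ) (x : S) : ℝ := ∑ y, M.L t x y * f y

/-! ### The Feynman-Kac propagators -/

/-- `g` solves the backward equation `-∂/∂s g_s = lam_s L_s g_s - H_s g_s` for `s ∈ [0, t]`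
with terminal condition `g_t = f`. -/
def IsBackwardSolution (t : ℝ) (f : S → ℝ) (g : ℝ → S → ℝ) : Prop :=
  g t = f ∧ ∀ s ∈ Icc 0 t, ∀ x,
    HasDerivWithinAt (fun u => g u x) (-(M.lam s * M.genL s (g s) x - M.H s x * g s x)) (Icc 0 t) s

theorem μ_pos {t : ℝ} (ht : 0 ≤ t) (x : S) : 0 < M.μ t x := by
  have hne : (Finset.univ : Finset S).Nonempty := ⟨x, Finset.mem_univ x⟩
  have hZ : 0 < ∑ y, Real.exp (-M.U t y) * M.μ 0 y :=
    Finset.sum_pos (fun y _ => mul_pos (Real.exp_pos _) (M.μ_zero_pos y)) hne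
  rw [M.μ_eq t ht x]
  exact mul_pos (mul_pos (one_div_pos.2 hZ) (Real.exp_pos _)) (M.μ_zero_pos x)

theorem μ_contDiff (x : S) : ContDiffOn ℝ 1 (fun t => M.μ t x) (Ici 0) := by
  have hne : (Finset.univ : Finset S).Nonempty := ⟨x, Finset.mem_univ x⟩
  have hexp : ∀ y, ContDiffOn ℝ 1 (fun t => Real.exp (-M.U t y)) (Ici 0) :=
    fun y => (M.U_contDiff y).neg.exp
  refine ContDiffOn.congr (f := fun t => (1 / ∑ y, Real.exp (-M.U t y) * M.μ 0 y) *
    Real.exp (-M.U t x) * M.μ 0 x) ?_ fun t (ht : 0 ≤ t) => M.μ_eq t ht x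
  refine ((contDiffOn_const.div (ContDiffOn.sum fun y _ => (hexp y).mul contDiffOn_const)
    fun _ _ => ?_).mul (hexp x)).mul contDiffOn_const
  exact (Finset.sum_pos (fun y _ => mul_pos (Real.exp_pos _) (M.μ_zero_pos y)) hne).ne'

theorem H_continuous (x : S) : ContinuousOn (fun t => M.H t x) (Ici 0) :=
  (((M.μ_contDiff x).log fun _ ht => (M.μ_pos ht x).ne').continuousOn_derivWithin
    (uniqueDiffOn_Ici 0) le_rfl).neg

open Classical in
/-- The coefficients of the linear system solved by backward solutions, up to sign. -/
def coeff (s : ℝ) (x y : S) : ℝ := M.lam s * M.L s x y - if x = y then M.H s x else 0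

theorem sum_coeff (s : ℝ) (g : S → ℝ) (x : S) :
    ∑ y, M.coeff s x y * g y = M.lam s * M.genL s g x - M.H s x * g x := by
  simp only [coeff, sub_mul, Finset.sum_sub_distrib, ite_mul, zero_mul, genL, Finset.mul_sum,
    mul_assoc]
  congr 1
  rw [Finset.sum_eq_single x (fun y _ h => if_neg (Ne.symm h))
    (fun h => absurd (Finset.mem_univ x) h), if_pos rfl]

theorem coeff_continuous (x y : S) : ContinuousOn (fun s => M.coeff s x y) (Ici 0) := by
  refine (M.lam_continuous.mul (M.L_continuous x y)).sub ?_
  split_ifs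
  · exact M.H_continuous x
  · exact continuousOn_const

theorem exists_backwardSolution {t : ℝ} (ht : 0 ≤ t) (f : S → ℝ) :
    ∃ g, M.IsBackwardSolution t f g := by
  have hmaps : MapsTo (fun s => t - s) (Icc 0 t) (Ici 0) := fun s hs => sub_nonneg.2 hs.2
  have hcont : ContinuousOn (fun s : ℝ => t - s) (Icc 0 t) := by fun_prop
  obtain ⟨u, hu0, hu⟩ := exists_linear_ode ht (fun s => M.coeff (t - s))
    (fun x y => (M.coeff_continuous x y).comp hcont hmaps) f
  refine ⟨fun s => u (t - s), by simpa using hu0, fun s hs x => ?_⟩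
  have hs' : t - s ∈ Icc 0 t := ⟨sub_nonneg.2 hs.2, by linarith [hs.1]⟩
  have h := (hu _ hs' x).scomp s (h := fun r => t - r) (h' := -1)
    (by simpa using (hasDerivWithinAt_id s (Icc 0 t)).const_sub t)
    (fun r (hr : r ∈ Icc 0 t) => ⟨sub_nonneg.2 hr.2, by linarith [hr.1]⟩)
  refine h.congr_deriv ?_
  rw [sub_sub_cancel, M.sum_coeff, smul_eq_mul, neg_one_mul]

/-- The backward equation with terminal condition `f` has only one solution on `[0, t]`. -/
theorem IsBackwardSolution.eqOn {M : EvolvingModel S} {t : ℝ} {f : S → ℝ} {g g' : ℝ → S → ℝ}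
    (hg : M.IsBackwardSolution t f g) (hg' : M.IsBackwardSolution t f g') :
    EqOn g g' (Icc 0 t) := by
  rcases lt_or_ge t 0 with ht | ht
  · simp [Icc_eq_empty_of_lt ht]
  obtain ⟨K, hK0, hmul⟩ := linear_field_bound ht M.coeff
    (fun x y => (M.coeff_continuous x y).mono Icc_subset_Ici_self)
  have key : ∀ {g : ℝ → S → ℝ}, M.IsBackwardSolution t f g → ∀ s ∈ Icc 0 t,
      HasDerivWithinAt g ((fun s w x => -∑ y, M.coeff s x y * w y) s (g s)) (Icc 0 t) s :=
    fun hg s hs => hasDerivWithinAt_pi.2 fun x => (hg.2 s hs x).congr_deriv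
      (congrArg Neg.neg (M.sum_coeff s _ x)).symm
  have key' : ∀ {g : ℝ → S → ℝ}, M.IsBackwardSolution t f g → ∀ s ∈ Ioc 0 t,
      HasDerivWithinAt g ((fun s w x => -∑ y, M.coeff s x y * w y) s (g s)) (Iic s) s :=
    fun hg s hs => (key hg s (Ioc_subset_Icc_self hs)).mono_of_mem_nhdsWithin
      (Icc_mem_nhdsLE_of_mem hs)
  refine ODE_solution_unique_of_mem_Icc_left (K := ⟨K, hK0⟩) (s := fun _ => univ)
    (v := fun s w x => -∑ y, M.coeff s x y * w y) (fun s hs => ?_)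
    (fun s hs => (key hg s hs).continuousWithinAt) (key' hg) (fun _ _ => mem_univ _)
    (fun s hs => (key hg' s hs).continuousWithinAt) (key' hg') (fun _ _ => mem_univ _)
    (hg.1.trans hg'.1.symm)
  refine (LipschitzWith.of_dist_le_mul fun w w' => ?_).lipschitzOnWith
  rw [dist_comm, dist_eq_norm, dist_eq_norm]
  refine le_trans (le_of_eq ?_) (hmul s (Ioc_subset_Icc_self hs) (w - w') ‖w - w'‖
    (norm_nonneg _) fun y => norm_le_pi_norm (w - w') y)
  congr 1
  funext x
  simp only [Pi.sub_apply, mul_sub, Finset.sum_sub_distrib]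
  ring

/-- The Feynman-Kac propagator: for `0 ≤ s ≤ t`, `q s t f` is the value at time `s` of the unique
solution on `[0, t]` of the backward equation with terminal condition `f` at time `t`. -/
def q (s t : ℝ) (f : S → ℝ) : S → ℝ :=
  if ht : 0 ≤ t then (M.exists_backwardSolution ht f).choose s else f

/-! ### Norms and constants -/

section Norms

variable [MeasurableSpace S]

/-- The probability measure on `S` with weights `μ t x`. -/
def measure (t : ℝ) : Measure S := ∑ x, ENNReal.ofReal (M.μ t x) • Measure.dirac x

/-- The norm `‖f‖_{L^p(μ_t)}`, as an extended nonnegative real, for `p ∈ [1, ∞]`. -/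
def normLp (p : ℝ≥0∞) (t : ℝ) (f : S → ℝ) : ℝ≥0∞ := eLpNorm f p (M.measure t)

/-- The constant `C_{s,t}(p,q)` for `2 ≤ p ≤ q ≤ ∞`, where `r` is given by `1/p = 1/q + 1/r`. -/
def C (s t : ℝ) (p q : ℝ≥0∞) : ℝ≥0∞ :=
  let r : ℝ≥0∞ := (p⁻¹ - q⁻¹)⁻¹
  (⨆ (f : S → ℝ) (_ : f ≠ 0), M.normLp (2 * r) s (M.q s t f) / M.normLp p t f) ⊔
    (⨆ (f : S → ℝ) (_ : f ≠ 0), M.normLp p s (M.q s t f) / M.normLp (p / 2) t f) ⊔ 1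

/-- The constant `C̄_t(p,q,δ)`, the supremum over `τ ∈ [0, t]` of
`∫_0^{(τ - δ)⁺} ‖H_s‖_{L^q(μ_s)} C_{s,τ}(p,q)² ds`. -/
def Cbar (t : ℝ) (p q : ℝ≥0∞) (δ : ℝ) : ℝ≥0∞ :=
  ⨆ τ ∈ Icc 0 t, ∫⁻ s in Ioc 0 (max (τ - δ) 0), M.normLp q s (M.H s) * M.C s τ p q ^ 2

end Norms

/-- `ω`, the supremum over `s ∈ [0, t₀]` of the oscillation `max H_s - min H_s`. -/
def omega (t₀ : ℝ) : ℝ := sSup ((fun s => (⨆ x, M.H s x) - ⨅ x, M.H s x) '' Icc 0 t₀)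

/-- The variance `Var_{μ_t}(f) = ⟨f², μ_t⟩ - ⟨f, μ_t⟩²`. -/
def var (t : ℝ) (f : S → ℝ) : ℝ :=
  pairing (fun x => f x ^ 2) (M.μ t) - pairing f (M.μ t) ^ 2

/-- The quantity `V_{s,t}(f)`, equal to
`-⟨H_s (q_{s,t} f)², μ_s⟩ + ∬ |H_s(x)| (q_{s,t} f(y) - q_{s,t} f(x))² μ_s(dx) μ_s(dy)`. -/
def V (s t : ℝ) (f : S → ℝ) : ℝ :=
  -pairing (fun x => M.H s x * M.q s t f x ^ 2) (M.μ s) +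
    ∑ x, ∑ y, |M.H s x| * (M.q s t f y - M.q s t f x) ^ 2 * M.μ s x * M.μ s y

/-- The quantity `v_t(p)`, the supremum over `τ ∈ [0, t]` and `f ≠ 0` of
`(∫_0^τ V_{s,τ}(f) ds) / ‖f‖²_{L^p(μ_τ)}`. -/
def v [MeasurableSpace S] (t : ℝ) (p : ℝ≥0∞) : EReal :=
  ⨆ τ ∈ Icc 0 t, ⨆ (f : S → ℝ) (_ : f ≠ 0),
    (((∫ s in (0 : ℝ)..τ, M.V s τ f) / (M.normLp p τ f).toReal ^ 2 : ℝ) : EReal)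

/-! ### The interacting particle system -/

/-- The generator `L_t^N` of the particle system, acting on functions on `S^N`. -/
def particleGenerator (N : ℕ) (t : ℝ) (φ : (Fin N → S) → ℝ) (x : Fin N → S) : ℝ :=
  M.lam t * ∑ i, M.genL t (fun y => φ (Function.update x i y)) (x i) +
    1 / (N : ℝ) * ∑ i, ∑ j, max (M.H t (x i) - M.H t (x j)) 0 *
      (φ (Function.update x i (x j)) - φ x)

end EvolvingModel

/-- The sigma-algebra generated by the process `X` on the time interval `[0, s]`. -/
@[reducible] def past {Ω E : Type*} [MeasurableSpace E] (X : ℝ → Ω → E) (s : ℝ) : MeasurableSpace Ω :=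
  ⨆ u ∈ Icc 0 s, MeasurableSpace.comap (X u) inferInstance

/-- `(X t)_{t ≥ 0}` is, under `ℙ`, a right continuous time-inhomogeneous Markov process on the
finite (discrete) space `E` with generator `A t` at time `t`: it has the Markov property with
transition matrices `P s t`, which solve Kolmogorov's forward equation
`∂/∂t P_{s,t} = P_{s,t} A_t`, `P_{s,s} = I`. -/
structure IsMarkovProcess {Ω E : Type*} [MeasurableSpace Ω] [Fintype E] [MeasurableSpace E]
    (A : ℝ → (E → ℝ) → E → ℝ) (ℙ : Measure Ω) (X : ℝ → Ω → E) : Prop where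
  measurable : ∀ t, 0 ≤ t → Measurable (X t)
  right_continuous : ∀ ω t, 0 ≤ t → ∀ᶠ u in 𝓝[≥] t, X u ω = X t ω
  markov : ∃ P : ℝ → ℝ → E → E → ℝ,
    (∀ s t, 0 ≤ s → s ≤ t → ∀ x, (∀ y, 0 ≤ P s t x y) ∧ ∑ y, P s t x y = 1) ∧
    (∀ s, 0 ≤ s → ∀ (φ : E → ℝ) (x : E), ∑ y, P s s x y * φ y = φ x) ∧
    (∀ s t, 0 ≤ s → s ≤ t → ∀ (φ : E → ℝ) (x : E),
      HasDerivWithinAt (fun u => ∑ y, P s u x y * φ y) (∑ y, P s t x y * A t φ y) (Ici s) t) ∧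
    ∀ s t, 0 ≤ s → s ≤ t → ∀ φ : E → ℝ,
      ℙ[fun ω => φ (X t ω) | past X s] =ᵐ[ℙ] fun ω => ∑ y, P s t (X s ω) y * φ y

namespace EvolvingModel

variable {S : Type*} [Fintype S] [MeasurableSpace S] (M : EvolvingModel S)

/-- `X` is the particle system with `N` particles: the Markov process on `S^N` with generators
`L_t^N` whose initial law is the `N`-fold product of `μ 0`. -/
structure IsParticleSystem {Ω : Type*} [MeasurableSpace Ω] (N : ℕ) (ℙ : Measure Ω)
    (X : ℝ → Ω → Fin N → S) : Prop where
  markov : IsMarkovProcess (M.particleGenerator N) ℙ X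
  initial : ℙ.map (X 0) = Measure.pi fun _ : Fin N => M.measure 0

variable {Ω : Type*} [MeasurableSpace Ω] {N : ℕ}

/-- The integral `⟨f, η_t^N⟩` against the empirical distribution. -/
def empirical (X : ℝ → Ω → Fin N → S) (t : ℝ) (f : S → ℝ) (ω : Ω) : ℝ :=
  1 / (N : ℝ) * ∑ i, f (X t ω i)

/-- The integral `⟨f, ν_t^N⟩` against the reweighted empirical distribution
`ν_t^N = exp (-∫_0^t ⟨H_s, η_s^N⟩ ds) η_t^N`. -/
def reweighted (X : ℝ → Ω → Fin N → S) (t : ℝ) (f : S → ℝ) (ω : Ω) : ℝ :=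
  Real.exp (-∫ s in (0 : ℝ)..t, empirical X s (M.H s) ω) * empirical X t f ω

/-- The mean square error `E[|⟨f, ν_t^N⟩ - ⟨f, μ_t⟩|²]`. -/
def mse (ℙ : Measure Ω) (X : ℝ → Ω → Fin N → S) (t : ℝ) (f : S → ℝ) : ℝ≥0∞ :=
  ∫⁻ ω, ENNReal.ofReal (|M.reweighted X t f ω - pairing f (M.μ t)| ^ 2) ∂ℙ

/-- The quantity `ε_t^{N,p}`, the supremum of the mean square errors at times `s ∈ [0, t]` over
all `f` with `‖f‖_{L^p(μ_s)} ≤ 1`. -/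
def eps (ℙ : Measure Ω) (X : ℝ → Ω → Fin N → S) (t : ℝ) (p : ℝ≥0∞) : ℝ≥0∞ :=
  ⨆ s ∈ Icc 0 t, ⨆ (f : S → ℝ) (_ : M.normLp p s f ≤ 1), M.mse ℙ X s f

end EvolvingModel

end

end SeqMC

/-! ### Scalar calculus: backward Gronwall, endpoint derivatives, squared negative part. -/

namespace SeqMC

/-! The reweighted empirical measure ν is unbiased, so the mean square error is a second moment
minus ⟨f,μ_t⟩², and the proof rests on an exact formula for that moment. Interpolate with g =
q_{s,t}f. On an average ⟨a⟩ over the particles, selection contributes ⟨H⟩⟨a⟩ − ⟨Ha⟩ to the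
generator; the weight exp(−∫⟨H⟩) cancels the first term and the backward equation the second, so
E[ν_s(g)] is constant (`feynmanKac_one_avg`). For squares, the right quantity is N ν(g)² −
ν(1)ν(g²): the carré du champ of the mutation part cancels, and only the average of a two-point
kernel in H and g remains (`feynmanKac_two_avg_sq`).

The integral of this kernel is estimated in two ways. On the last interval, of length at most δ, the
oscillation ω bounds it pointwise, at a cost of 3/16 of E[ν_t(1)ν_t(f²)]. Before that, it is bounded
by mixed moments E[ν(a)ν(b)]. Each differs from ⟨a,μ⟩⟨b,μ⟩ by a covariance, at most ε‖a‖‖b‖ by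
Cauchy-Schwarz, and Hölder with the definition of C bounds the norms. The products of means add up
to V, because ⟨H,μ⟩ = 0. This gives `mixedMoment_sub_le`, with ε C̄ on the right-hand side.

There remains E[ν_t(1)ν_t(f²)]. A crude estimate of the same type (`feynmanKac_avg_sq_le`) shows
that ε is at most 0.32 for the exponent p'. Since p' ≤ p/2, the norm of f² in L^{p'} is at most
‖f‖_p², so E[ν_t(1)ν_t(f²)] ≤ ⟨f²,μ_t⟩ + 0.32‖f‖_p². This proves the first bound. Taking suprema in
it gives Nε ≤ 2 + v + 7C̄ε, which is solved for ε using C̄/N ≤ 1/25. Such absorption needs ε to be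
finite beforehand (`eps_ne_top`). -/

/-- A differential inequality `f' ≥ -c f` on `[a, b]` bounds `f` by its terminal value. -/
theorem le_exp_mul_of_neg_mul_le_deriv {f f' : ℝ → ℝ} {a b c : ℝ}
    (h : ∀ s ∈ Icc a b, HasDerivWithinAt f (f' s) (Icc a b) s)
    (h' : ∀ s ∈ Icc a b, -c * f s ≤ f' s) {s : ℝ} (hs : s ∈ Icc a b) :
    f s ≤ Real.exp (c * (b - s)) * f b := by
  have hexp : ∀ s, HasDerivAt (fun s => Real.exp (c * s)) (Real.exp (c * s) * c) s := fun s => by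
    simpa using ((hasDerivAt_id s).const_mul c).exp
  have hd : ∀ s ∈ Icc a b, HasDerivWithinAt (fun s => Real.exp (c * s) * f s)
      (Real.exp (c * s) * c * f s + Real.exp (c * s) * f' s) (Icc a b) s := fun s hs =>
    (hexp s).hasDerivWithinAt.mul (h s hs)
  have hmono : MonotoneOn (fun s => Real.exp (c * s) * f s) (Icc a b) := by
    refine monotoneOn_of_hasDerivWithinAt_nonneg (convex_Icc a b)
      (fun s hs => (hd s hs).continuousWithinAt)
      (fun s hs => (hd s (interior_subset hs)).mono interior_subset) fun s hs => ?_
    have := h' s (interior_subset hs)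
    have := mul_le_mul_of_nonneg_left this (Real.exp_pos (c * s)).le
    linarith
  have hb := hmono hs (right_mem_Icc.2 (hs.1.trans hs.2)) hs.2
  have e : Real.exp (c * b) = Real.exp (c * s) * Real.exp (c * (b - s)) := by
    rw [← Real.exp_add]; ring_nf
  simp only [e] at hb
  rw [mul_assoc] at hb
  exact le_of_mul_le_mul_left hb (Real.exp_pos _)

/-- The fundamental theorem of calculus for one-sided derivatives at the endpoints. -/
theorem integral_eq_sub_of_hasDerivWithinAt_Icc {f f' : ℝ → ℝ} {a b : ℝ} (hab : a ≤ b)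
    (h : ∀ s ∈ Icc a b, HasDerivWithinAt f (f' s) (Icc a b) s)
    (h' : ContinuousOn f' (Icc a b)) : ∫ s in a..b, f' s = f b - f a :=
  intervalIntegral.integral_eq_sub_of_hasDerivAt_of_le hab
    (fun s hs => (h s hs).continuousWithinAt)
    (fun s hs => (h s (Ioo_subset_Icc_self hs)).hasDerivAt (Icc_mem_nhds hs.1 hs.2))
    (ContinuousOn.intervalIntegrable (by rwa [uIcc_of_le hab]))

/-- Squaring smooths the kink of the negative part, which can then serve as an energy in the
positivity proof for the propagators. -/
theorem hasDerivAt_min_zero_sq (x : ℝ) :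
    HasDerivAt (fun y : ℝ => min y 0 ^ 2) (2 * min x 0) x := by
  rcases lt_trichotomy x 0 with hx | rfl | hx
  · have : (fun y : ℝ => min y 0 ^ 2) =ᶠ[𝓝 x] fun y => y ^ 2 := by
      filter_upwards [Iio_mem_nhds hx] with y hy
      rw [min_eq_left (le_of_lt hy)]
    rw [min_eq_left hx.le]
    simpa using (hasDerivAt_pow 2 x).congr_of_eventuallyEq this
  · have h : HasDerivAt (fun y : ℝ => y * min y 0) (min 0 0) 0 := by
      rw [hasDerivAt_iff_tendsto_slope]
      have h2 : Filter.Tendsto (fun y : ℝ => min y 0) (𝓝[≠] 0) (𝓝 (min 0 0)) :=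
        ((continuous_id.min continuous_const).tendsto (0 : ℝ)).mono_left nhdsWithin_le_nhds
      refine h2.congr' ?_
      filter_upwards [self_mem_nhdsWithin] with y hy
      have : y ≠ 0 := hy
      simp [slope_def_field]
      field_simp
    have e : (fun y : ℝ => min y 0 ^ 2) = fun y => y * min y 0 := by
      funext y
      rcases le_total y 0 with hy | hy
      · rw [min_eq_left hy, sq]
      · rw [min_eq_right hy]; ring
    rw [e]
    simpa using h
  · have : (fun y : ℝ => min y 0 ^ 2) =ᶠ[𝓝 x] fun y => 0 := by
      filter_upwards [Ioi_mem_nhds hx] with y hy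
      rw [min_eq_right (le_of_lt hy)]; ring
    rw [min_eq_right hx.le, mul_zero]
    exact (hasDerivAt_const x (0 : ℝ)).congr_of_eventuallyEq this

/-! ### The evolving measures and their propagators. -/

namespace EvolvingModel

variable {S : Type*} [Fintype S] (M : EvolvingModel S)

theorem pairing_add {S : Type*} [Fintype S] (f g m : S → ℝ) :
    pairing (fun x => f x + g x) m = pairing f m + pairing g m := by
  simp [pairing, add_mul, Finset.sum_add_distrib]

theorem nonempty (M : EvolvingModel S) : Nonempty S := by
  by_contra h
  rw [not_nonempty_iff] at h
  simpa using M.μ_zero_sum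

theorem sum_μ {t : ℝ} (ht : 0 ≤ t) : ∑ x, M.μ t x = 1 := by
  have := M.nonempty
  have hZ : 0 < ∑ y, Real.exp (-M.U t y) * M.μ 0 y :=
    Finset.sum_pos (fun y _ => mul_pos (Real.exp_pos _) (M.μ_zero_pos y)) Finset.univ_nonempty
  rw [Finset.sum_congr rfl fun x _ => M.μ_eq t ht x]
  simp only [mul_assoc]
  rw [← Finset.mul_sum, one_div_mul_cancel hZ.ne']

theorem hasDerivWithinAt_μ {t : ℝ} (ht : 0 ≤ t) (x : S) :
    HasDerivWithinAt (fun s => M.μ s x) (-M.H t x * M.μ t x) (Ici 0) t := by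
  have hd : DifferentiableWithinAt ℝ (fun s => M.μ s x) (Ici 0) t :=
    (M.μ_contDiff x).differentiableOn one_ne_zero t ht
  have h1 := hd.hasDerivWithinAt.log (M.μ_pos ht x).ne'
  have h2 : M.H t x = -(derivWithin (fun s => M.μ s x) (Ici 0) t / M.μ t x) := by
    rw [H, h1.derivWithin (uniqueDiffOn_Ici 0 t ht)]
  refine hd.hasDerivWithinAt.congr_deriv ?_
  rw [h2]
  have := (M.μ_pos ht x).ne'
  field_simp

/-- The total mass is constantly 1, so its derivative vanishes. This is why mixed moments involving
ν(H) have no main term later. -/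
theorem pairing_H {t : ℝ} (ht : 0 ≤ t) : pairing (M.H t) (M.μ t) = 0 := by
  have h1 : HasDerivWithinAt (fun s => ∑ x, M.μ s x) (∑ x, -M.H t x * M.μ t x) (Ici 0) t :=
    HasDerivWithinAt.fun_sum fun x _ => M.hasDerivWithinAt_μ ht x
  have h2 : HasDerivWithinAt (fun s => ∑ x, M.μ s x) 0 (Ici 0) t :=
    (hasDerivWithinAt_const t (Ici 0) (1 : ℝ)).congr (fun s hs => M.sum_μ hs) (M.sum_μ ht)
  have := (uniqueDiffOn_Ici (0 : ℝ) t ht).eq_deriv _ h1 h2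
  simp only [neg_mul, Finset.sum_neg_distrib, neg_eq_zero] at this
  exact this

theorem H_sub_le_omega {t₀ s : ℝ} (hs : s ∈ Icc 0 t₀) (x y : S) :
    M.H s x - M.H s y ≤ M.omega t₀ := by
  have := M.nonempty
  -- A real `sSup` is 0 on unbounded sets, so `omega` is meaningful only because H is bounded on
  -- compact time intervals.
  have hbdd : BddAbove ((fun s => (⨆ x, M.H s x) - ⨅ x, M.H s x) '' Icc 0 t₀) := by
    choose K hK using fun x => isCompact_Icc.exists_bound_of_continuousOn
      ((M.H_continuous x).mono (Icc_subset_Ici_self : Icc 0 t₀ ⊆ Ici 0))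
    refine ⟨(∑ x, |K x|) - -∑ x, |K x|, ?_⟩
    rintro _ ⟨r, hr, rfl⟩
    have hb : ∀ x, |M.H r x| ≤ ∑ x, |K x| := fun x =>
      ((hK x r hr).trans (le_abs_self _)).trans
        (Finset.single_le_sum (f := fun x => |K x|) (fun _ _ => abs_nonneg _) (Finset.mem_univ x))
    exact sub_le_sub (ciSup_le fun x => (abs_le.1 (hb x)).2)
      (le_ciInf fun x => (abs_le.1 (hb x)).1)
  refine le_trans (sub_le_sub (le_ciSup (Finite.bddAbove_range _) x)
    (ciInf_le (Finite.bddBelow_range _) y)) (le_csSup hbdd ⟨s, hs, rfl⟩)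

theorem abs_H_sub_le_omega {t₀ s : ℝ} (hs : s ∈ Icc 0 t₀) (x y : S) :
    |M.H s x - M.H s y| ≤ M.omega t₀ :=
  abs_sub_le_iff.2 ⟨M.H_sub_le_omega hs x y, M.H_sub_le_omega hs y x⟩

theorem omega_nonneg {t₀ : ℝ} (ht₀ : 0 ≤ t₀) : 0 ≤ M.omega t₀ := by
  obtain ⟨x⟩ := M.nonempty
  simpa using M.H_sub_le_omega ⟨le_rfl, ht₀⟩ x x

/-- Averaging a bound against `μ_t`. -/
theorem le_of_forall_le {t : ℝ} (ht : 0 ≤ t) {f g : S → ℝ} (h : ∀ x, f x ≤ g x) :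
    pairing f (M.μ t) ≤ pairing g (M.μ t) :=
  Finset.sum_le_sum fun x _ => mul_le_mul_of_nonneg_right (h x) (M.μ_pos ht x).le

theorem pairing_const {t : ℝ} (ht : 0 ≤ t) (c : ℝ) : pairing (fun _ => c) (M.μ t) = c := by
  simp [pairing, ← Finset.mul_sum, M.sum_μ ht]

/-- H has mean zero under μ, so averaging the oscillation bound over the second point bounds H
itself. -/
theorem abs_H_le_omega {t₀ s : ℝ} (hs : s ∈ Icc 0 t₀) (x : S) : |M.H s x| ≤ M.omega t₀ := by
  have e : ∀ c : ℝ, pairing (fun y => c + M.H s y) (M.μ s) = c := fun c => by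
    rw [pairing_add (fun _ => c), M.pairing_const hs.1]; erw [M.pairing_H hs.1]; ring
  have h1 := M.le_of_forall_le hs.1 (f := fun _ => M.H s x)
    (g := fun y => M.omega t₀ + M.H s y) fun y => by linarith [M.H_sub_le_omega hs x y]
  have h2 := M.le_of_forall_le hs.1 (g := fun _ => M.H s x)
    (f := fun y => -M.omega t₀ + M.H s y) fun y => by linarith [M.H_sub_le_omega hs y x]
  rw [e, M.pairing_const hs.1] at h1 h2
  exact abs_le.2 ⟨h2, h1⟩

/-- Detailed balance makes μ invariant: after the sums are exchanged, a row sum of L appears. -/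
theorem pairing_genL {t : ℝ} (ht : 0 ≤ t) (f : S → ℝ) :
    pairing (M.genL t f) (M.μ t) = 0 := by
  simp only [pairing, genL, Finset.sum_mul]
  rw [Finset.sum_comm]
  refine Finset.sum_eq_zero fun y _ => ?_
  calc ∑ x, M.L t x y * f y * M.μ t x = ∑ x, f y * M.μ t y * M.L t y x := by
        refine Finset.sum_congr rfl fun x _ => ?_
        linear_combination f y * M.detailed_balance t ht x y
    _ = 0 := by rw [← Finset.mul_sum, M.L_row_sum t ht, mul_zero]

/-- The carré du champ of the generator `L_t`. -/
noncomputable def carre (t : ℝ) (f : S → ℝ) (x : S) : ℝ := ∑ y, M.L t x y * (f y - f x) ^ 2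

theorem carre_nonneg {t : ℝ} (ht : 0 ≤ t) (f : S → ℝ) (x : S) : 0 ≤ M.carre t f x := by
  refine Finset.sum_nonneg fun y _ => ?_
  rcases eq_or_ne x y with rfl | h
  · simp
  · exact mul_nonneg (M.L_nonneg t ht x y h) (sq_nonneg _)

theorem genL_sq {t : ℝ} (ht : 0 ≤ t) (f : S → ℝ) (x : S) :
    M.genL t (fun y => f y ^ 2) x = M.carre t f x + 2 * f x * M.genL t f x := by
  have h := M.L_row_sum t ht x
  have : M.carre t f x = M.genL t (fun y => f y ^ 2) x - 2 * f x * M.genL t f x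
      + (∑ y, M.L t x y) * f x ^ 2 := by
    simp only [carre, genL, Finset.mul_sum, Finset.sum_mul, ← Finset.sum_sub_distrib,
      ← Finset.sum_add_distrib]
    exact Finset.sum_congr rfl fun y _ => by ring
  rw [this, h]; ring

theorem q_isBackwardSolution {t : ℝ} (ht : 0 ≤ t) (f : S → ℝ) :
    M.IsBackwardSolution t f fun s => M.q s t f := by
  have h := (M.exists_backwardSolution ht f).choose_spec
  have e : (fun s => M.q s t f) = (M.exists_backwardSolution ht f).choose := by
    funext s; simp only [q, dif_pos ht]
  rw [e]; exact h

variable {t : ℝ}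

theorem q_self (ht : 0 ≤ t) (f : S → ℝ) : M.q t t f = f := (M.q_isBackwardSolution ht f).1

theorem hasDerivWithinAt_q (ht : 0 ≤ t) (f : S → ℝ) {s : ℝ} (hs : s ∈ Icc 0 t) (x : S) :
    HasDerivWithinAt (fun u => M.q u t f x)
      (M.H s x * M.q s t f x - M.lam s * M.genL s (M.q s t f) x) (Icc 0 t) s :=
  ((M.q_isBackwardSolution ht f).2 s hs x).congr_deriv (by ring)

theorem q_continuousOn (ht : 0 ≤ t) (f : S → ℝ) (x : S) :
    ContinuousOn (fun u => M.q u t f x) (Icc 0 t) :=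
  fun _ hs => (M.hasDerivWithinAt_q ht f hs x).continuousWithinAt

theorem H_continuousOn_Icc (x : S) : ContinuousOn (fun u => M.H u x) (Icc 0 t) :=
  (M.H_continuous x).mono Icc_subset_Ici_self

theorem μ_continuousOn_Icc (x : S) : ContinuousOn (fun u => M.μ u x) (Icc 0 t) :=
  (M.μ_contDiff x).continuousOn.mono Icc_subset_Ici_self

theorem q_zero_fun (ht : 0 ≤ t) {s : ℝ} (hs : s ∈ Icc 0 t) : M.q s t 0 = 0 := by
  refine (M.q_isBackwardSolution ht 0).eqOn (g' := fun _ => 0) ⟨rfl, fun r _ x => ?_⟩ hs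
  simpa [genL] using hasDerivWithinAt_const r (Icc 0 t) (0 : ℝ)

/-- The derivative −Hμ of the weights cancels the potential term of the backward equation, and the
generator term has mean zero. -/
theorem hasDerivWithinAt_pairing_q (ht : 0 ≤ t) (f : S → ℝ) {s : ℝ} (hs : s ∈ Icc 0 t) :
    HasDerivWithinAt (fun u => pairing (M.q u t f) (M.μ u)) 0 (Icc 0 t) s := by
  have h := HasDerivWithinAt.fun_sum (u := Finset.univ) fun x _ =>
    (M.hasDerivWithinAt_q ht f hs x).mul
      ((M.hasDerivWithinAt_μ hs.1 x).mono Icc_subset_Ici_self)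
  refine h.congr_deriv ?_
  have := M.pairing_genL hs.1 (M.q s t f)
  calc _ = -M.lam s * pairing (M.genL s (M.q s t f)) (M.μ s) := by
        rw [pairing, Finset.mul_sum]
        exact Finset.sum_congr rfl fun x _ => by ring
    _ = 0 := by rw [this, mul_zero]

theorem pairing_q (ht : 0 ≤ t) (f : S → ℝ) {s : ℝ} (hs : s ∈ Icc 0 t) :
    pairing (M.q s t f) (M.μ s) = pairing f (M.μ t) := by
  have h := integral_eq_sub_of_hasDerivWithinAt_Icc (f' := fun _ => (0 : ℝ)) hs.2
    (fun r hr => (M.hasDerivWithinAt_pairing_q ht f ⟨hs.1.trans hr.1, hr.2⟩).mono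
      (Icc_subset_Icc_left hs.1)) continuousOn_const
  simp only [intervalIntegral.integral_zero, M.q_self ht] at h
  linarith

/-- The second moment of `q_{s,t} f` under `μ_s`. -/
theorem hasDerivWithinAt_pairing_q_sq (ht : 0 ≤ t) (f : S → ℝ) {s : ℝ} (hs : s ∈ Icc 0 t) :
    HasDerivWithinAt (fun u => pairing (fun x => M.q u t f x ^ 2) (M.μ u))
      (pairing (fun x => M.H s x * M.q s t f x ^ 2) (M.μ s) +
        M.lam s * pairing (M.carre s (M.q s t f)) (M.μ s)) (Icc 0 t) s := by
  have h := HasDerivWithinAt.fun_sum (u := Finset.univ) fun x _ =>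
    ((M.hasDerivWithinAt_q ht f hs x).pow 2).mul
      ((M.hasDerivWithinAt_μ hs.1 x).mono Icc_subset_Ici_self)
  refine h.congr_deriv ?_
  have h0 := M.pairing_genL hs.1 (fun x => M.q s t f x ^ 2)
  have e : M.lam s * pairing (M.genL s fun x => M.q s t f x ^ 2) (M.μ s) = 0 := by
    rw [h0, mul_zero]
  -- Subtracting the vanishing mean of L(g²) turns −2gLg into the carré du champ.
  rw [← sub_zero (_ + _), ← e]
  simp only [pairing, Finset.mul_sum, ← Finset.sum_add_distrib, ← Finset.sum_sub_distrib]
  refine Finset.sum_congr rfl fun x _ => ?_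
  rw [M.genL_sq hs.1]
  simp only [Pi.pow_apply]
  norm_num
  ring

/-- The carré du champ is nonnegative and H ≥ −ω, so backward Gronwall applies with rate ω. -/
theorem pairing_q_sq_le {t₀ : ℝ} (ht : t ∈ Icc 0 t₀) (f : S → ℝ) {s : ℝ} (hs : s ∈ Icc 0 t) :
    pairing (fun x => M.q s t f x ^ 2) (M.μ s) ≤
      Real.exp (M.omega t₀ * (t - s)) * pairing (fun x => f x ^ 2) (M.μ t) := by
  have h := le_exp_mul_of_neg_mul_le_deriv (c := M.omega t₀)
    (fun r hr => M.hasDerivWithinAt_pairing_q_sq ht.1 f hr) (fun r hr => ?_) hs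
  · simpa only [M.q_self ht.1] using h
  · have hr0 : r ∈ Icc 0 t₀ := ⟨hr.1, hr.2.trans ht.2⟩
    have h1 : 0 ≤ M.lam r * pairing (M.carre r (M.q r t f)) (M.μ r) :=
      mul_nonneg (M.lam_nonneg r hr.1) (Finset.sum_nonneg fun x _ =>
        mul_nonneg (M.carre_nonneg hr.1 _ x) (M.μ_pos hr.1 x).le)
    have h2 : -M.omega t₀ * pairing (fun x => M.q r t f x ^ 2) (M.μ r) ≤
        pairing (fun x => M.H r x * M.q r t f x ^ 2) (M.μ r) := by
      simp only [pairing, Finset.mul_sum]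
      refine Finset.sum_le_sum fun x _ => ?_
      have := (abs_le.1 (M.abs_H_le_omega hr0 x)).1
      have h3 := mul_le_mul_of_nonneg_right this
        (mul_nonneg (sq_nonneg (M.q r t f x)) (M.μ_pos hr.1 x).le)
      linarith
    linarith

theorem coeff_nonneg {s : ℝ} (hs : 0 ≤ s) {x y : S} (h : x ≠ y) : 0 ≤ M.coeff s x y := by
  rw [coeff, if_neg h, sub_zero]
  exact mul_nonneg (M.lam_nonneg s hs) (M.L_nonneg s hs x y h)

/-- The propagators preserve nonnegativity. -/
theorem q_nonneg (ht : 0 ≤ t) {f : S → ℝ} (hf : ∀ x, 0 ≤ f x) {s : ℝ} (hs : s ∈ Icc 0 t)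
    (x : S) : 0 ≤ M.q s t f x := by
  obtain ⟨K, hK0, hK⟩ := linear_field_bound ht M.coeff
    (fun x y => (M.coeff_continuous x y).mono Icc_subset_Ici_self)
  -- The energy m of the negative part satisfies m' ≥ −2K|S| m and vanishes at time t, so backward
  -- Gronwall forces it to vanish on the whole interval.
  let n : ℝ → S → ℝ := fun r x => min (M.q r t f x) 0
  let m : ℝ → ℝ := fun r => ∑ x, n r x ^ 2
  have hq : ∀ r ∈ Icc 0 t, ∀ x, HasDerivWithinAt (fun u => M.q u t f x)
      (-∑ y, M.coeff r x y * M.q r t f y) (Icc 0 t) r := fun r hr x =>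
    ((M.q_isBackwardSolution ht f).2 r hr x).congr_deriv
      (congrArg Neg.neg (M.sum_coeff r _ x).symm)
  have hd : ∀ r ∈ Icc 0 t, HasDerivWithinAt m
      (∑ x, 2 * n r x * -∑ y, M.coeff r x y * M.q r t f y) (Icc 0 t) r := fun r hr =>
    HasDerivWithinAt.fun_sum fun x _ =>
      (hasDerivAt_min_zero_sq (M.q r t f x)).comp_hasDerivWithinAt (h₂ := fun y => min y 0 ^ 2)
        r (hq r hr x)
  have key : ∀ r ∈ Icc 0 t, -(2 * K * Fintype.card S) * m r ≤
      ∑ x, 2 * n r x * -∑ y, M.coeff r x y * M.q r t f y := by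
    intro r hr
    have hn : ∀ x, n r x ≤ 0 := fun x => min_le_right _ _
    have hle : ∀ x, n r x ≤ M.q r t f x := fun x => min_le_left _ _
    have hmul : ∀ x, n r x * M.q r t f x = n r x * n r x := fun x => by
      simp only [n]
      rcases le_total (M.q r t f x) 0 with h | h
      · rw [min_eq_left h]
      · rw [min_eq_right h]; ring
    -- Replacing q by its negative part only lowers the derivative: off the diagonal the
    -- coefficients are nonnegative and n ≤ 0, while on the diagonal n q = n².
    have h1 : ∀ x, 2 * n r x * -∑ y, M.coeff r x y * n r y ≤
        2 * n r x * -∑ y, M.coeff r x y * M.q r t f y := by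
      intro x
      rw [mul_neg, mul_neg, neg_le_neg_iff, Finset.mul_sum, Finset.mul_sum]
      refine Finset.sum_le_sum fun y _ => ?_
      rcases eq_or_ne x y with rfl | hxy
      · have := hmul x
        exact le_of_eq (by linear_combination 2 * M.coeff r x x * this)
      · have h2 := mul_le_mul_of_nonneg_left (hle y) (M.coeff_nonneg hr.1 hxy)
        have h3 : 2 * n r x ≤ 0 := by linarith [hn x]
        exact mul_le_mul_of_nonpos_left h2 h3
    refine le_trans ?_ (Finset.sum_le_sum fun x _ => h1 x)
    have hm0 : 0 ≤ m r := Finset.sum_nonneg fun x _ => sq_nonneg _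
    have hnb : ∀ y, |n r y| ≤ √(m r) := fun y => by
      rw [← Real.sqrt_sq_eq_abs]
      exact Real.sqrt_le_sqrt (Finset.single_le_sum (f := fun x => n r x ^ 2)
        (fun _ _ => sq_nonneg _) (Finset.mem_univ y))
    have hb := hK r hr (n r) (√(m r)) (Real.sqrt_nonneg _) hnb
    have h4 : ∀ x, -(2 * K * m r) ≤ 2 * n r x * -∑ y, M.coeff r x y * n r y := fun x => by
      have h5 : |∑ y, M.coeff r x y * n r y| ≤ K * √(m r) :=
        (norm_le_pi_norm (fun x => ∑ y, M.coeff r x y * n r y) x).trans hb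
      have h6 : |n r x * ∑ y, M.coeff r x y * n r y| ≤ √(m r) * (K * √(m r)) := by
        rw [abs_mul]
        exact mul_le_mul (hnb x) h5 (abs_nonneg _) (Real.sqrt_nonneg _)
      have h7 : √(m r) * (K * √(m r)) = K * m r := by
        nlinarith [Real.mul_self_sqrt hm0]
      have := (abs_le.1 h6).2
      rw [h7] at this
      linarith
    calc -(2 * K * Fintype.card S) * m r = ∑ _x : S, -(2 * K * m r) := by
          simp; ring
      _ ≤ _ := Finset.sum_le_sum fun x _ => h4 x
  have hmt : m t = 0 := Finset.sum_eq_zero fun x _ => by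
    simp only [n, M.q_self ht, min_eq_right (hf x)]; norm_num
  have h := le_exp_mul_of_neg_mul_le_deriv hd key hs
  rw [hmt, mul_zero] at h
  have h2 : n s x ^ 2 ≤ 0 := (Finset.single_le_sum (f := fun x => n s x ^ 2)
    (fun _ _ => sq_nonneg _) (Finset.mem_univ x)).trans h
  have h3 : n s x = 0 := pow_eq_zero_iff two_ne_zero |>.1 (le_antisymm h2 (sq_nonneg _))
  exact min_eq_right_iff.1 h3

theorem V_continuousOn (ht : 0 ≤ t) (f : S → ℝ) :
    ContinuousOn (fun s => M.V s t f) (Icc 0 t) := by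
  have hq := M.q_continuousOn ht f
  have hH := fun x => M.H_continuousOn_Icc (t := t) x
  have hμ := fun x => M.μ_continuousOn_Icc (t := t) x
  unfold V pairing
  fun_prop

/-- The double sum in V is nonnegative and H ≤ ω. This controls how negative V can be on the last
short interval. -/
theorem neg_V_le {t₀ : ℝ} (ht : t ≤ t₀) (f : S → ℝ) {s : ℝ} (hs : s ∈ Icc 0 t) :
    -M.V s t f ≤ M.omega t₀ * pairing (fun x => M.q s t f x ^ 2) (M.μ s) := by
  have h1 : 0 ≤ ∑ x, ∑ y, |M.H s x| * (M.q s t f y - M.q s t f x) ^ 2 * M.μ s x * M.μ s y :=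
    Finset.sum_nonneg fun x _ => Finset.sum_nonneg fun y _ => by
      have := (M.μ_pos hs.1 x).le
      have := (M.μ_pos hs.1 y).le
      positivity
  have h2 : pairing (fun x => M.H s x * M.q s t f x ^ 2) (M.μ s) ≤
      M.omega t₀ * pairing (fun x => M.q s t f x ^ 2) (M.μ s) := by
    simp only [pairing, Finset.mul_sum]
    refine Finset.sum_le_sum fun x _ => ?_
    have := (abs_le.1 (M.abs_H_le_omega ⟨hs.1, hs.2.trans ht⟩ x)).2
    have h3 := mul_le_mul_of_nonneg_right this
      (mul_nonneg (sq_nonneg (M.q s t f x)) (M.μ_pos hs.1 x).le)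
    linarith
  unfold V
  linarith

end EvolvingModel

end SeqMC

namespace SeqMC

/-! ### Feynman-Kac formula for Markov processes on a finite space -/

section PathIntegral

variable {Ω E : Type*} [Fintype E] [MeasurableSpace E] [DiscreteMeasurableSpace E]

/-- A right-continuous path, evaluated in a time-dependent potential, is jointly measurable. -/
theorem measurable_potential_path [MeasurableSpace Ω] {X : ℝ → Ω → E} {t : ℝ} (ht : 0 ≤ t)
    (hm : ∀ u ∈ Icc 0 t, Measurable (X u))
    (hr : ∀ ω u, 0 ≤ u → ∀ᶠ r in 𝓝[≥] u, X r ω = X u ω) {h : ℝ → E → ℝ}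
    (hc : ∀ x, ContinuousOn (fun s => h s x) (Ici 0)) :
    Measurable fun z : Ω × ℝ => h (max z.2 0) (X (min t (max z.2 0)) z.1) := by
  have hh : Measurable fun z : E × ℝ => h (max z.2 0) z.1 := by
    refine measurable_from_prod_countable_right fun x => ?_
    have : Continuous fun r : ℝ => h (max r 0) x :=
      (hc x).comp_continuous (by fun_prop) fun r => le_max_right r 0
    exact this.measurable
  -- Grid times to the right of the argument, capped at t. Right continuity makes the path agree
  -- with its sampled value for large n, and the cap ensures that only times in [0, t] are used.
  let c : ℕ → ℕ → ℝ := fun n k => min t ((k + 1 : ℝ) / (n + 1))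
  have hc0 : ∀ n k, c n k ∈ Icc 0 t := fun n k =>
    ⟨le_min ht (by positivity), min_le_left _ _⟩
  have hF : ∀ n, Measurable fun z : Ω × ℝ =>
      h (max z.2 0) (X (c n ⌊(n + 1 : ℝ) * max z.2 0⌋₊) z.1) := by
    intro n
    have hk : Measurable fun w : ℕ × (Ω × ℝ) => h (max w.2.2 0) (X (c n w.1) w.2.1) :=
      measurable_from_prod_countable_right fun k =>
        hh.comp (((hm _ (hc0 n k)).comp measurable_fst).prodMk measurable_snd)
    have hfl : Measurable fun z : Ω × ℝ => ⌊(n + 1 : ℝ) * max z.2 0⌋₊ :=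
      Nat.measurable_floor.comp (measurable_const.mul (measurable_snd.max measurable_const))
    exact hk.comp (hfl.prodMk measurable_id)
  refine measurable_of_tendsto_metrizable hF (tendsto_pi_nhds.2 fun z => ?_)
  set ρ := max z.2 0 with hρ
  have hρ0 : 0 ≤ ρ := le_max_right _ _
  have hlt : ∀ n : ℕ, ρ ≤ ((⌊(n + 1 : ℝ) * ρ⌋₊ : ℝ) + 1) / (n + 1) := fun n => by
    rw [le_div_iff₀ (by positivity), mul_comm]
    exact (Nat.lt_floor_add_one _).le
  have hle : ∀ n : ℕ, ((⌊(n + 1 : ℝ) * ρ⌋₊ : ℝ) + 1) / (n + 1) ≤ ρ + 1 / (n + 1 : ℝ) := fun n => by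
    rw [add_div]
    gcongr
    rw [div_le_iff₀ (by positivity), mul_comm]
    exact Nat.floor_le (by positivity)
  have hlim : Filter.Tendsto (fun n : ℕ => ((⌊(n + 1 : ℝ) * ρ⌋₊ : ℝ) + 1) / (n + 1))
      Filter.atTop (𝓝 ρ) := by
    refine tendsto_of_tendsto_of_tendsto_of_le_of_le tendsto_const_nhds ?_ hlt hle
    simpa using tendsto_const_nhds.add (tendsto_one_div_add_atTop_nhds_zero_nat (𝕜 := ℝ))
  have hlim2 : Filter.Tendsto (fun n : ℕ => c n ⌊(n + 1 : ℝ) * ρ⌋₊) Filter.atTop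
      (𝓝[≥] (min t ρ)) := by
    refine tendsto_nhdsWithin_iff.2 ⟨tendsto_const_nhds.min hlim, .of_forall fun n => ?_⟩
    exact min_le_min le_rfl (hlt n)
  have hev := hlim2.eventually (hr z.1 (min t ρ) (le_min ht hρ0))
  refine tendsto_const_nhds.congr' ?_
  filter_upwards [hev] with n hn
  rw [hn]

/-- The σ-algebra on Ω is arbitrary, so that `past X t` may be inserted; this makes the Feynman-Kac
weight adapted. -/
theorem stronglyMeasurable_integral_path [MeasurableSpace Ω] {X : ℝ → Ω → E} {t : ℝ}
    (ht : 0 ≤ t) (hm : ∀ u ∈ Icc 0 t, Measurable (X u))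
    (hr : ∀ ω u, 0 ≤ u → ∀ᶠ r in 𝓝[≥] u, X r ω = X u ω) {h : ℝ → E → ℝ}
    (hc : ∀ x, ContinuousOn (fun s => h s x) (Ici 0)) :
    StronglyMeasurable fun ω => ∫ s in (0 : ℝ)..t, h s (X s ω) := by
  have h1 := (measurable_potential_path ht hm hr hc).stronglyMeasurable
  have h2 := h1.integral_prod_right' (ν := volume.restrict (Ioc 0 t))
  convert h2 using 2 with ω
  rw [intervalIntegral.integral_of_le ht]
  refine setIntegral_congr_fun measurableSet_Ioc fun s hs => ?_
  simp only [max_eq_left hs.1.le, min_eq_right hs.2]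

theorem integrableOn_path [MeasurableSpace Ω] {X : ℝ → Ω → E} {t : ℝ} (ht : 0 ≤ t)
    (hm : ∀ u ∈ Icc 0 t, Measurable (X u))
    (hr : ∀ ω u, 0 ≤ u → ∀ᶠ r in 𝓝[≥] u, X r ω = X u ω) {h : ℝ → E → ℝ}
    (hc : ∀ x, ContinuousOn (fun s => h s x) (Ici 0)) {K : ℝ}
    (hK : ∀ s ∈ Icc 0 t, ∀ x, |h s x| ≤ K) (ω : Ω) :
    IntegrableOn (fun s => h s (X s ω)) (Icc 0 t) := by
  refine Integrable.of_bound ?_ K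
    ((ae_restrict_iff' measurableSet_Icc).2 (.of_forall fun s hs => hK s hs _))
  have h1 : Measurable fun s : ℝ => h (max s 0) (X (min t (max s 0)) ω) :=
    (measurable_potential_path ht hm hr hc).comp (measurable_const.prodMk measurable_id)
  refine (h1.aestronglyMeasurable (μ := volume.restrict (Icc 0 t))).congr
    ((ae_restrict_iff' measurableSet_Icc).2 (.of_forall fun s hs => ?_))
  simp only [max_eq_left hs.1, min_eq_right hs.2]

end PathIntegral

section FeynmanKac

variable {Ω E : Type*} [MeasurableSpace Ω] [Fintype E] [MeasurableSpace E]
  [DiscreteMeasurableSpace E]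

/-- The Feynman-Kac weight `exp (-∫_0^t h_s(X_s) ds)`. -/
noncomputable def weight (h : ℝ → E → ℝ) (X : ℝ → Ω → E) (t : ℝ) (ω : Ω) : ℝ :=
  Real.exp (-∫ s in (0 : ℝ)..t, h s (X s ω))

/-- The Feynman-Kac functional `E[exp (-∫_0^t h_s(X_s) ds) φ(X_t)]`. -/
noncomputable def feynmanKac (h : ℝ → E → ℝ) (ℙ : Measure Ω) (X : ℝ → Ω → E) (t : ℝ)
    (φ : E → ℝ) : ℝ := ∫ ω, weight h X t ω * φ (X t ω) ∂ℙ

/-- The data of a Markov process with continuous generators, together with a continuous potential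
bounded by `K` on `[0, T]`. -/
structure FKSetting (A : ℝ → (E → ℝ) → E → ℝ) (h : ℝ → E → ℝ) (ℙ : Measure Ω)
    (X : ℝ → Ω → E) (T K : ℝ) : Prop where
  process : IsMarkovProcess A ℙ X
  T_nonneg : 0 ≤ T
  generator_continuous : ∀ φ x, ContinuousOn (fun s => A s φ x) (Ici 0)
  potential_continuous : ∀ x, ContinuousOn (fun s => h s x) (Ici 0)
  potential_bound : ∀ s ∈ Icc 0 T, ∀ x, |h s x| ≤ K

namespace FKSetting

variable {A : ℝ → (E → ℝ) → E → ℝ} {h : ℝ → E → ℝ} {ℙ : Measure Ω} [IsProbabilityMeasure ℙ]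
  {X : ℝ → Ω → E} {T K : ℝ} (F : FKSetting A h ℙ X T K)
include F

omit [IsProbabilityMeasure ℙ] in
theorem intervalIntegrable_path (ω : Ω) {s u : ℝ} (hs : s ∈ Icc 0 T) (hu : u ∈ Icc 0 T) :
    IntervalIntegrable (fun r => h r (X r ω)) volume s u :=
  ((integrableOn_path F.T_nonneg (fun u hu => F.process.measurable u hu.1)
    F.process.right_continuous F.potential_continuous F.potential_bound ω).mono_set
      (uIcc_subset_Icc hs hu)).intervalIntegrable

omit [DiscreteMeasurableSpace E] [IsProbabilityMeasure ℙ] in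
theorem abs_integral_path_le (ω : Ω) {s u : ℝ} (hs : s ∈ Icc 0 T) (hu : u ∈ Icc 0 T) :
    |∫ r in s..u, h r (X r ω)| ≤ K * |u - s| :=
  intervalIntegral.norm_integral_le_of_norm_le_const (f := fun r => h r (X r ω)) fun r hr =>
    F.potential_bound r (uIcc_subset_Icc hs hu (uIoc_subset_uIcc hr)) _

omit [DiscreteMeasurableSpace E] [IsProbabilityMeasure ℙ] in
theorem past_le {s : ℝ} : past X s ≤ (inferInstance : MeasurableSpace Ω) :=
  iSup₂_le fun u hu => (F.process.measurable u hu.1).comap_le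

omit [IsProbabilityMeasure ℙ] in
theorem stronglyMeasurable_weight {s : ℝ} (hs : 0 ≤ s) :
    StronglyMeasurable[past X s] (weight h X s) := by
  have h1 : StronglyMeasurable[past X s] fun ω => ∫ r in (0 : ℝ)..s, h r (X r ω) :=
    @stronglyMeasurable_integral_path _ _ _ _ _ (past X s) X s hs
      (fun u hu => Measurable.mono (comap_measurable (X u))
        (le_iSup₂_of_le (f := fun u _ => MeasurableSpace.comap (X u) inferInstance) u hu le_rfl)
        le_rfl)
      F.process.right_continuous h F.potential_continuous
  exact Real.continuous_exp.comp_stronglyMeasurable h1.neg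

omit [DiscreteMeasurableSpace E] [IsProbabilityMeasure ℙ] in
theorem weight_le {s : ℝ} (hs : s ∈ Icc 0 T) (ω : Ω) :
    weight h X s ω ≤ Real.exp (K * T) := by
  have h1 := F.abs_integral_path_le ω ⟨le_rfl, F.T_nonneg⟩ hs
  obtain ⟨x⟩ : Nonempty E := ⟨X 0 ω⟩
  have hK : 0 ≤ K := (abs_nonneg _).trans (F.potential_bound 0 ⟨le_rfl, F.T_nonneg⟩ x)
  refine Real.exp_le_exp.2 ((neg_le_abs _).trans (h1.trans ?_))
  rw [sub_zero, abs_of_nonneg hs.1]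
  exact mul_le_mul_of_nonneg_left hs.2 hK

omit F in
theorem abs_exp_sub_exp_le {a b R : ℝ} (ha : a ≤ R) (hb : b ≤ R) :
    |Real.exp a - Real.exp b| ≤ Real.exp R * |a - b| := by
  wlog hab : b ≤ a generalizing a b
  · rw [abs_sub_comm, abs_sub_comm a b]
    exact this hb ha (le_of_not_ge hab)
  rw [abs_of_nonneg (sub_nonneg.2 (Real.exp_le_exp.2 hab)), abs_of_nonneg (sub_nonneg.2 hab)]
  have h1 := Real.add_one_le_exp (b - a)
  have h2 : Real.exp b = Real.exp a * Real.exp (b - a) := by rw [← Real.exp_add]; ring_nf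
  have h3 : Real.exp a ≤ Real.exp R := Real.exp_le_exp.2 ha
  calc Real.exp a - Real.exp b ≤ Real.exp a * (a - b) := by
        rw [h2]; nlinarith [Real.exp_pos a]
    _ ≤ _ := mul_le_mul_of_nonneg_right h3 (sub_nonneg.2 hab)

omit [IsProbabilityMeasure ℙ] in
theorem abs_weight_sub_le {s u : ℝ} (hs : s ∈ Icc 0 T) (hu : u ∈ Icc 0 T) (ω : Ω) :
    |weight h X u ω - weight h X s ω| ≤ Real.exp (K * T) * (K * |u - s|) := by
  have hle : ∀ s ∈ Icc 0 T, -∫ r in (0 : ℝ)..s, h r (X r ω) ≤ K * T := fun s hs =>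
    Real.exp_le_exp.1 (F.weight_le hs ω)
  refine (abs_exp_sub_exp_le (hle u hu) (hle s hs)).trans
    (mul_le_mul_of_nonneg_left ?_ (Real.exp_pos _).le)
  have h0 : (0 : ℝ) ∈ Icc 0 T := ⟨le_rfl, F.T_nonneg⟩
  have := intervalIntegral.integral_add_adjacent_intervals
    (F.intervalIntegrable_path ω h0 hs) (F.intervalIntegrable_path ω hs hu)
  rw [← this, neg_add, add_sub_right_comm, sub_self, zero_add, abs_neg]
  exact F.abs_integral_path_le ω hs hu

omit [IsProbabilityMeasure ℙ] in
theorem measurable_comp {u : ℝ} (hu : 0 ≤ u) (φ : E → ℝ) : Measurable fun ω => φ (X u ω) :=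
  (measurable_of_countable φ).comp (F.process.measurable u hu)

omit F [MeasurableSpace E] [DiscreteMeasurableSpace E] in
theorem abs_le_sum (φ : E → ℝ) (x : E) : |φ x| ≤ ∑ y, |φ y| :=
  Finset.single_le_sum (f := fun y => |φ y|) (fun _ _ => abs_nonneg _) (Finset.mem_univ x)

theorem integrable_weight_mul {s u : ℝ} (hs : s ∈ Icc 0 T) (hu : 0 ≤ u) (φ : E → ℝ) :
    Integrable (fun ω => weight h X s ω * φ (X u ω)) ℙ := by
  refine Integrable.of_bound (C := Real.exp (K * T) * ∑ y, |φ y|)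
    (((F.stronglyMeasurable_weight hs.1).mono F.past_le).aestronglyMeasurable.mul
      (F.measurable_comp hu φ).aestronglyMeasurable) (.of_forall fun ω => ?_)
  rw [norm_mul]
  refine mul_le_mul ?_ (abs_le_sum φ _) (norm_nonneg _) (Real.exp_pos _).le
  rw [Real.norm_eq_abs, weight, Real.abs_exp]
  exact F.weight_le hs ω

/-- The Feynman-Kac functional as a finite sum over the state space. -/
theorem feynmanKac_eq_sum [DecidableEq E] {s : ℝ} (hs : s ∈ Icc 0 T) (φ : E → ℝ) :
    feynmanKac h ℙ X s φ = ∑ x, feynmanKac h ℙ X s (fun y => if y = x then 1 else 0) * φ x := by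
  simp only [feynmanKac, ← integral_mul_const]
  rw [← integral_finsetSum Finset.univ (f := fun x ω =>
    (weight h X s ω * if X s ω = x then 1 else 0) * φ x) fun x _ =>
    (F.integrable_weight_mul hs hs.1 (fun y => if y = x then 1 else 0)).mul_const _]
  refine integral_congr_ae (.of_forall fun ω => ?_)
  simp

theorem feynmanKac_add {s : ℝ} (hs : s ∈ Icc 0 T) (φ ψ : E → ℝ) :
    feynmanKac h ℙ X s (fun x => φ x + ψ x) = feynmanKac h ℙ X s φ + feynmanKac h ℙ X s ψ := by
  simp only [feynmanKac, mul_add]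
  exact integral_add (F.integrable_weight_mul hs hs.1 _) (F.integrable_weight_mul hs hs.1 _)

omit F [Fintype E] [MeasurableSpace E] [DiscreteMeasurableSpace E] [IsProbabilityMeasure ℙ] in
theorem feynmanKac_const_mul {s : ℝ} (c : ℝ) (φ : E → ℝ) :
    feynmanKac h ℙ X s (fun x => c * φ x) = c * feynmanKac h ℙ X s φ := by
  simp only [feynmanKac, mul_left_comm _ c, integral_const_mul]

theorem feynmanKac_mono {s : ℝ} (hs : s ∈ Icc 0 T) {φ ψ : E → ℝ} (hφ : ∀ x, φ x ≤ ψ x) :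
    feynmanKac h ℙ X s φ ≤ feynmanKac h ℙ X s ψ :=
  integral_mono (F.integrable_weight_mul hs hs.1 _) (F.integrable_weight_mul hs hs.1 _)
    fun _ => mul_le_mul_of_nonneg_left (hφ _) (Real.exp_pos _).le

/-- The Markov property inside a Feynman-Kac functional. -/
theorem integral_weight_mul {P : E → E → ℝ} {s u : ℝ} (hs : s ∈ Icc 0 T) (hsu : s ≤ u)
    {φ : E → ℝ} (hP : ℙ[fun ω => φ (X u ω) | past X s] =ᵐ[ℙ] fun ω => ∑ y, P (X s ω) y * φ y) :
    ∫ ω, weight h X s ω * φ (X u ω) ∂ℙ =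
      feynmanKac h ℙ X s fun x => ∑ y, P x y * φ y := by
  have hint := F.integrable_weight_mul hs (hs.1.trans hsu) φ
  have h1 : ℙ[fun ω => weight h X s ω * φ (X u ω) | past X s] =ᵐ[ℙ]
      fun ω => weight h X s ω * (ℙ[fun ω => φ (X u ω) | past X s]) ω :=
    condExp_mul_of_stronglyMeasurable_left (F.stronglyMeasurable_weight hs.1) hint
      (Integrable.of_bound (F.measurable_comp (hs.1.trans hsu) φ).aestronglyMeasurable
        (∑ y, |φ y|) (.of_forall fun ω => abs_le_sum φ _))
  rw [← integral_condExp F.past_le, feynmanKac]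
  refine integral_congr_ae ?_
  filter_upwards [h1, hP] with ω h1 h2
  rw [h1, h2]

omit [IsProbabilityMeasure ℙ] in
-- Along a path the potential is only right continuous, because of the jumps; hence a derivative
-- from the right.
theorem hasDerivWithinAt_weight {s : ℝ} (hs : s ∈ Ico 0 T) (ω : Ω) :
    HasDerivWithinAt (fun u => weight h X u ω) (weight h X s ω * -h s (X s ω)) (Ici s) s := by
  have hsT : s ∈ Icc 0 T := ⟨hs.1, hs.2.le⟩
  have hcw : ContinuousWithinAt (fun r => h r (X r ω)) (Ici s) s := by
    have h1 : ContinuousWithinAt (fun r => h r (X s ω)) (Ici s) s :=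
      (F.potential_continuous (X s ω) s hs.1).mono (Ici_subset_Ici.2 hs.1)
    refine h1.congr_of_eventuallyEq ?_ rfl
    filter_upwards [F.process.right_continuous ω s hs.1] with r hr
    rw [hr]
  have h2 := (integrableOn_path F.T_nonneg (fun u hu => F.process.measurable u hu.1)
    F.process.right_continuous F.potential_continuous F.potential_bound ω).aestronglyMeasurable
  have h3 : HasDerivWithinAt (fun u => ∫ r in (0 : ℝ)..u, h r (X r ω)) (h s (X s ω)) (Ici s) s :=
    intervalIntegral.integral_hasDerivWithinAt_right
      (F.intervalIntegrable_path ω ⟨le_rfl, F.T_nonneg⟩ hsT)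
      (s := Ici s) (t := Ioi s) ⟨Icc 0 T, nhdsWithin_mono s Ioi_subset_Ici_self
        (Icc_mem_nhdsGE_of_mem hs), h2⟩
      (hcw.mono Ioi_subset_Ici_self)
  exact h3.neg.exp

/-- The right derivative of the Feynman-Kac functional. -/
theorem hasDerivWithinAt_Ici_feynmanKac {s : ℝ} (hs : s ∈ Ico 0 T) (φ : E → ℝ) :
    HasDerivWithinAt (fun u => feynmanKac h ℙ X u φ)
      (feynmanKac h ℙ X s fun x => A s φ x - h s x * φ x) (Ici s) s := by
  classical
  have hsT : s ∈ Icc 0 T := ⟨hs.1, hs.2.le⟩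
  obtain ⟨P, hP1, hP2, hP3, hP4⟩ := F.process.markov
  have hu0 : ∀ u ∈ Ici s, 0 ≤ u := fun u hu => hs.1.trans hu
  -- The moment at u is split into the increment of the weight and a part with the weight frozen at
  -- s; the Markov property reduces the latter to a transition matrix.
  have hsplit : ∀ u ∈ Icc s T, feynmanKac h ℙ X u φ =
      (∫ ω, (weight h X u ω - weight h X s ω) * φ (X u ω) ∂ℙ) +
        ∑ x, feynmanKac h ℙ X s (fun y => if y = x then 1 else 0) * ∑ y, P s u x y * φ y := by
    intro u hu
    have huT : u ∈ Icc 0 T := ⟨hs.1.trans hu.1, hu.2⟩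
    rw [← F.feynmanKac_eq_sum hsT,
      ← F.integral_weight_mul hsT hu.1 (hP4 s u hs.1 hu.1 φ)]
    simp only [sub_mul]
    rw [integral_sub (F.integrable_weight_mul huT huT.1 _)
      (F.integrable_weight_mul hsT huT.1 _), sub_add_cancel, feynmanKac]
  have hd2 : HasDerivWithinAt (fun u => ∑ x, feynmanKac h ℙ X s (fun y => if y = x then 1 else 0) *
      ∑ y, P s u x y * φ y) (feynmanKac h ℙ X s (A s φ)) (Ici s) s := by
    rw [F.feynmanKac_eq_sum hsT (A s φ)]
    refine HasDerivWithinAt.fun_sum fun x _ => ?_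
    have := (hP3 s s hs.1 le_rfl φ x).const_mul
      (feynmanKac h ℙ X s (fun y => if y = x then 1 else 0))
    rwa [hP2 s hs.1 (A s φ) x] at this
  have hnear : ∀ᶠ u in 𝓝[>] s, u ∈ Icc s T :=
    nhdsWithin_mono s Ioi_subset_Ici_self (Icc_mem_nhdsGE hs.2)
  have hd1 : HasDerivWithinAt
      (fun u => ∫ ω, (weight h X u ω - weight h X s ω) * φ (X u ω) ∂ℙ)
      (∫ ω, (weight h X s ω * -h s (X s ω)) * φ (X s ω) ∂ℙ) (Ici s) s := by
    rw [hasDerivWithinAt_iff_tendsto_slope, Ici_sdiff_left]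
    have he : ∀ u, slope (fun u => ∫ ω, (weight h X u ω - weight h X s ω) * φ (X u ω) ∂ℙ) s u =
        ∫ ω, slope (fun u => weight h X u ω) s u * φ (X u ω) ∂ℙ := fun u => by
      simp only [slope_def_field, sub_self, zero_mul, integral_zero, sub_zero]
      rw [← integral_div]
      congr 1; funext ω; ring
    refine Filter.Tendsto.congr (fun u => (he u).symm) ?_
    -- The Lipschitz bound on the weight dominates the difference quotients.
    refine tendsto_integral_filter_of_dominated_convergence
      (fun _ => (Real.exp (K * T) * K) * ∑ y, |φ y|) ?_ ?_ (integrable_const _) ?_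
    · filter_upwards [hnear] with u hu
      have huT : u ∈ Icc 0 T := ⟨hs.1.trans hu.1, hu.2⟩
      simp only [slope_def_field]
      exact (((((F.stronglyMeasurable_weight huT.1).mono F.past_le).measurable.sub
        ((F.stronglyMeasurable_weight hsT.1).mono F.past_le).measurable).div_const _).mul
          (F.measurable_comp huT.1 φ)).aestronglyMeasurable
    · filter_upwards [hnear, self_mem_nhdsWithin] with u hu hu'
      refine .of_forall fun ω => ?_
      have huT : u ∈ Icc 0 T := ⟨hs.1.trans hu.1, hu.2⟩
      have hpos : 0 < u - s := sub_pos.2 hu'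
      have hb := F.abs_weight_sub_le hsT huT ω
      rw [norm_mul]
      refine mul_le_mul ?_ (abs_le_sum φ _) (norm_nonneg _) ?_
      · rw [slope_def_field, Real.norm_eq_abs, abs_div, div_le_iff₀ (abs_pos.2 hpos.ne'), mul_assoc]
        exact hb
      · rw [abs_of_pos hpos, ← mul_assoc] at hb
        exact nonneg_of_mul_nonneg_left ((abs_nonneg _).trans hb) hpos
    · refine .of_forall fun ω => ?_
      have h1 := hasDerivWithinAt_iff_tendsto_slope.1 (F.hasDerivWithinAt_weight hs ω)
      rw [Ici_sdiff_left] at h1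
      refine h1.mul (tendsto_const_nhds.congr' ?_)
      filter_upwards [nhdsWithin_mono s Ioi_subset_Ici_self
        (F.process.right_continuous ω s hs.1)] with u hu
      rw [show X u ω = X s ω from hu]
  have hval : (feynmanKac h ℙ X s fun x => A s φ x - h s x * φ x) =
      (∫ ω, (weight h X s ω * -h s (X s ω)) * φ (X s ω) ∂ℙ) + feynmanKac h ℙ X s (A s φ) := by
    have e : (∫ ω, (weight h X s ω * -h s (X s ω)) * φ (X s ω) ∂ℙ) =
        feynmanKac h ℙ X s fun x => -h s x * φ x := by
      simp only [feynmanKac, mul_assoc]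
    rw [e, ← F.feynmanKac_add hsT]
    congr 1; funext x; ring
  rw [hval]
  refine (hd1.add hd2).congr_of_eventuallyEq ?_ (hsplit s ⟨le_rfl, hs.2.le⟩)
  filter_upwards [Icc_mem_nhdsGE hs.2] with u hu using hsplit u hu

/-- The same splitting shows Lipschitz dependence on time, since weights and transition matrices
both move at bounded speed. Continuity is what allows right derivatives to be upgraded to two-sided
ones. -/
theorem continuousOn_feynmanKac (φ : E → ℝ) :
    ContinuousOn (fun u => feynmanKac h ℙ X u φ) (Icc 0 T) := by
  classical
  obtain ⟨P, hP1, hP2, hP3, hP4⟩ := F.process.markov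
  choose R hR using fun x => isCompact_Icc.exists_bound_of_continuousOn
    ((F.generator_continuous φ x).mono (Icc_subset_Ici_self : Icc 0 T ⊆ Ici 0))
  set B := ∑ x, |R x| with hB
  have hB0 : 0 ≤ B := Finset.sum_nonneg fun _ _ => abs_nonneg _
  have hAB : ∀ s ∈ Icc 0 T, ∀ x, |A s φ x| ≤ B := fun s hs x =>
    ((hR x s hs).trans (le_abs_self _)).trans (abs_le_sum R x)
  have hPφ : ∀ s ∈ Icc 0 T, ∀ u ∈ Icc s T, ∀ x, |∑ y, P s u x y * φ y - φ x| ≤ B * (u - s) := by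
    intro s hs u hu x
    have := norm_image_sub_le_of_norm_deriv_right_le_segment
      (f := fun u => ∑ y, P s u x y * φ y) (a := s) (b := T) (C := B)
      (f' := fun r => ∑ y, P s r x y * A r φ y)
      (fun r hr => ((hP3 s r hs.1 hr.1 φ x).mono Icc_subset_Ici_self).continuousWithinAt)
      (fun r hr => (hP3 s r hs.1 hr.1 φ x).mono (Ici_subset_Ici.2 hr.1)) (fun r hr => ?_) u hu
    · rwa [hP2 s hs.1] at this
    · have hr0 : r ∈ Icc 0 T := ⟨hs.1.trans hr.1, hr.2.le⟩
      obtain ⟨hp, hp1⟩ := hP1 s r hs.1 hr.1 x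
      calc ‖∑ y, P s r x y * A r φ y‖ ≤ ∑ y, ‖P s r x y * A r φ y‖ := norm_sum_le _ _
        _ ≤ ∑ y, P s r x y * B := Finset.sum_le_sum fun y _ => by
            rw [norm_mul, Real.norm_of_nonneg (hp y)]
            exact mul_le_mul_of_nonneg_left (hAB r hr0 y) (hp y)
        _ = B := by rw [← Finset.sum_mul, hp1, one_mul]
  set D := Real.exp (K * T) * K * (∑ y, |φ y|) + Real.exp (K * T) * B with hD
  have hlip : ∀ s ∈ Icc 0 T, ∀ u ∈ Icc s T,
      |feynmanKac h ℙ X u φ - feynmanKac h ℙ X s φ| ≤ D * (u - s) := by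
    intro s hs u hu
    have huT : u ∈ Icc 0 T := ⟨hs.1.trans hu.1, hu.2⟩
    have hsu : 0 ≤ u - s := sub_nonneg.2 hu.1
    have e : feynmanKac h ℙ X u φ - feynmanKac h ℙ X s φ =
        (∫ ω, (weight h X u ω - weight h X s ω) * φ (X u ω) ∂ℙ) +
        ∫ ω, weight h X s ω * (∑ y, P s u (X s ω) y * φ y - φ (X s ω)) ∂ℙ := by
      have h1 := F.integral_weight_mul hs hu.1 (hP4 s u hs.1 hu.1 φ)
      simp only [sub_mul, mul_sub]
      rw [integral_sub (F.integrable_weight_mul huT huT.1 _) (F.integrable_weight_mul hs huT.1 _),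
        integral_sub (F.integrable_weight_mul hs hs.1 (fun x => ∑ y, P s u x y * φ y))
          (F.integrable_weight_mul hs hs.1 _), h1]
      simp only [feynmanKac]
      ring
    rw [e, hD, add_mul]
    refine (abs_add_le _ _).trans (add_le_add ?_ ?_) <;> rw [← Real.norm_eq_abs]
    · refine (norm_integral_le_of_norm_le_const (μ := ℙ) (C := Real.exp (K * T) * (K * (u - s)) *
        ∑ y, |φ y|) (.of_forall fun ω => ?_)).trans ?_
      swap
      · rw [probReal_univ, mul_one]; exact le_of_eq (by ring)
      have hw := F.abs_weight_sub_le hs huT ω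
      rw [abs_of_nonneg hsu] at hw
      rw [norm_mul]
      exact mul_le_mul hw (abs_le_sum φ _) (norm_nonneg _) ((abs_nonneg _).trans hw)
    · refine (norm_integral_le_of_norm_le_const (μ := ℙ) (C := Real.exp (K * T) * (B * (u - s)))
        (.of_forall fun ω => ?_)).trans ?_
      swap
      · rw [probReal_univ, mul_one]; exact le_of_eq (by ring)
      rw [norm_mul]
      refine mul_le_mul ?_ (hPφ s hs u hu _) (norm_nonneg _) (Real.exp_pos _).le
      rw [Real.norm_eq_abs, weight, Real.abs_exp]
      exact F.weight_le hs ω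
  rcases F.T_nonneg.eq_or_lt with h0 | h0
  · rw [← h0, Icc_self]; exact continuousOn_singleton _ _
  have hD0 : 0 ≤ D := by
    have := (abs_nonneg _).trans (hlip 0 ⟨le_rfl, h0.le⟩ T ⟨h0.le, le_rfl⟩)
    rw [sub_zero] at this
    exact nonneg_of_mul_nonneg_left this h0
  refine (LipschitzOnWith.of_dist_le_mul (K := ⟨D, hD0⟩) fun s hs u hu => ?_).continuousOn
  rw [Real.dist_eq, Real.dist_eq]
  rcases le_total s u with hsu | hsu
  · rw [abs_sub_comm, abs_sub_comm s, abs_of_nonneg (sub_nonneg.2 hsu)]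
    exact hlip s hs u ⟨hsu, hu.2⟩
  · rw [abs_of_nonneg (sub_nonneg.2 hsu)]
    exact hlip u hu s ⟨hsu, hs.2⟩

/-- The derivative of the Feynman-Kac functional of a fixed function. -/
theorem hasDerivWithinAt_feynmanKac {s : ℝ} (hs : s ∈ Icc 0 T) (φ : E → ℝ) :
    HasDerivWithinAt (fun u => feynmanKac h ℙ X u φ)
      (feynmanKac h ℙ X s fun x => A s φ x - h s x * φ x) (Icc 0 T) s := by
  classical
  -- A continuous function with continuous right derivative G is a primitive of G, hence
  -- differentiable from both sides. The constant extension G' of G beyond [0, T] makes the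
  -- fundamental theorem usable at the endpoints.
  set G : ℝ → ℝ := fun s => feynmanKac h ℙ X s fun x => A s φ x - h s x * φ x with hG
  have hGc : ContinuousOn G (Icc 0 T) := by
    have h1 : ContinuousOn (fun s => ∑ x, feynmanKac h ℙ X s (fun y => if y = x then 1 else 0) *
        (A s φ x - h s x * φ x)) (Icc 0 T) := by
      refine continuousOn_finsetSum _ fun x _ => (F.continuousOn_feynmanKac _).mul ?_
      exact ((F.generator_continuous φ x).sub
        ((F.potential_continuous x).mul continuousOn_const)).mono Icc_subset_Ici_self
    exact h1.congr fun s hs => F.feynmanKac_eq_sum hs _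
  set G' : ℝ → ℝ := IccExtend F.T_nonneg ((Icc 0 T).domRestrict G) with hG'
  have hGc' : Continuous G' := (continuousOn_iff_continuous_domRestrict.1 hGc).Icc_extend'
  have hGG : ∀ r ∈ Icc 0 T, G' r = G r := fun r hr => IccExtend_of_mem F.T_nonneg _ hr
  have hint : ∀ u ∈ Icc 0 T, feynmanKac h ℙ X u φ =
      feynmanKac h ℙ X 0 φ + ∫ r in (0 : ℝ)..u, G' r := by
    intro u hu
    have := intervalIntegral.integral_eq_sub_of_hasDeriv_right_of_le hu.1
      ((F.continuousOn_feynmanKac φ).mono (Icc_subset_Icc_right hu.2)) (f' := G')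
      (fun r hr => ?_) (hGc'.intervalIntegrable _ _)
    · rw [this]; ring
    · have hr' : r ∈ Ico 0 T := ⟨hr.1.le, hr.2.trans_le hu.2⟩
      rw [hGG r ⟨hr'.1, hr'.2.le⟩]
      exact (F.hasDerivWithinAt_Ici_feynmanKac hr' φ).mono Ioi_subset_Ici_self
  have hd : HasDerivAt (fun u => feynmanKac h ℙ X 0 φ + ∫ r in (0 : ℝ)..u, G' r) (G' s) s :=
    (hGc'.integral_hasStrictDerivAt 0 s).hasDerivAt.const_add _
  rw [hGG s hs] at hd
  exact hd.hasDerivWithinAt.congr (fun u hu => hint u hu) (hint s hs)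

/-- The derivative of the Feynman-Kac functional of a time-dependent function. -/
theorem hasDerivWithinAt_feynmanKac_of_hasDerivWithinAt {t : ℝ} (htT : t ≤ T)
    (ht : 0 < t) {s : ℝ} (hs : s ∈ Icc 0 t) {φ : ℝ → E → ℝ}
    {φ' : E → ℝ} (hφ : ∀ x, HasDerivWithinAt (fun u => φ u x) (φ' x) (Icc 0 t) s) :
    HasDerivWithinAt (fun u => feynmanKac h ℙ X u (φ u))
      (feynmanKac h ℙ X s fun x => φ' x + (A s (φ s) x - h s x * φ s x)) (Icc 0 t) s := by
  classical
  have hsT : s ∈ Icc 0 T := ⟨hs.1, hs.2.trans htT⟩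
  have hmono : Icc 0 t ⊆ Icc 0 T := Icc_subset_Icc_right htT
  let e : E → E → ℝ := fun x y => if y = x then 1 else 0
  let c : E → ℝ := fun x => feynmanKac h ℙ X s fun y => A s (e x) y - h s y * e x y
  have hc : ∀ x, HasDerivWithinAt (fun u => feynmanKac h ℙ X u (e x)) (c x) (Icc 0 t) s :=
    fun x => (F.hasDerivWithinAt_feynmanKac hsT (e x)).mono hmono
  have h1 : HasDerivWithinAt (fun u => ∑ x, feynmanKac h ℙ X u (e x) * φ u x)
      (∑ x, (c x * φ s x + feynmanKac h ℙ X s (e x) * φ' x)) (Icc 0 t) s :=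
    HasDerivWithinAt.fun_sum fun x _ => (hc x).mul (hφ x)
  have h2 : HasDerivWithinAt (fun u => ∑ x, feynmanKac h ℙ X u (e x) * φ s x)
      (∑ x, c x * φ s x) (Icc 0 t) s :=
    HasDerivWithinAt.fun_sum fun x _ => (hc x).mul_const _
  have h3 : HasDerivWithinAt (fun u => ∑ x, feynmanKac h ℙ X u (e x) * φ s x)
      (feynmanKac h ℙ X s fun x => A s (φ s) x - h s x * φ s x) (Icc 0 t) s :=
    ((F.hasDerivWithinAt_feynmanKac hsT (φ s)).mono hmono).congr
      (fun u hu => (F.feynmanKac_eq_sum (hmono hu) (φ s)).symm)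
      (F.feynmanKac_eq_sum hsT (φ s)).symm
  -- Linearity of `A` is not among the assumptions. The expansion over indicators is instead
  -- obtained by computing one derivative in two ways, and uniqueness of that derivative needs 0 <
  -- t.
  have h4 := (uniqueDiffOn_Icc ht s hs).eq_deriv _ h2 h3
  refine (h1.congr (fun u hu => F.feynmanKac_eq_sum (hmono hu) (φ u))
    (F.feynmanKac_eq_sum hsT (φ s))).congr_deriv ?_
  rw [Finset.sum_add_distrib, h4, ← F.feynmanKac_eq_sum hsT φ', F.feynmanKac_add hsT, add_comm]

theorem continuousOn_feynmanKac_of_continuousOn {t : ℝ} (htT : t ≤ T) {φ : ℝ → E → ℝ}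
    (hφ : ∀ x, ContinuousOn (fun u => φ u x) (Icc 0 t)) :
    ContinuousOn (fun u => feynmanKac h ℙ X u (φ u)) (Icc 0 t) := by
  classical
  have hmono : Icc 0 t ⊆ Icc 0 T := Icc_subset_Icc_right htT
  have h1 : ContinuousOn (fun u => ∑ x, feynmanKac h ℙ X u (fun y => if y = x then 1 else 0) *
      φ u x) (Icc 0 t) :=
    continuousOn_finsetSum _ fun x _ => ((F.continuousOn_feynmanKac _).mono hmono).mul (hφ x)
  exact h1.congr fun u hu => F.feynmanKac_eq_sum (hmono hu) (φ u)

end FKSetting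

end FeynmanKac

end SeqMC

namespace SeqMC

namespace EvolvingModel

/-! ### Empirical averages and the generator of the particle system -/

section Averages

variable {S : Type*} {N : ℕ}

/-- The average of a function over a configuration of `N` particles. -/
noncomputable def avg (a : S → ℝ) (x : Fin N → S) : ℝ := 1 / (N : ℝ) * ∑ i, a (x i)

/-- The average of a two-point function over pairs of particles. -/
noncomputable def avg₂ (F : S → S → ℝ) (x : Fin N → S) : ℝ :=
  1 / (N : ℝ) ^ 2 * ∑ i, ∑ j, F (x i) (x j)

theorem avg_mul_avg (a b : S → ℝ) (x : Fin N → S) :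
    avg a x * avg b x = avg₂ (fun y z => a y * b z) x := by
  simp only [avg, avg₂, ← Finset.mul_sum, ← Finset.sum_mul]
  ring

theorem avg_eq_avg₂_left (hN : 0 < N) (a : S → ℝ) (x : Fin N → S) :
    avg a x = avg₂ (fun y _ => a y) x := by
  have : (N : ℝ) ≠ 0 := by positivity
  simp only [avg, avg₂, Finset.sum_const, Finset.card_univ, Fintype.card_fin, nsmul_eq_mul,
    ← Finset.mul_sum]
  field_simp

theorem avg₂_swap (F : S → S → ℝ) (x : Fin N → S) :
    avg₂ (fun y z => F z y) x = avg₂ F x := by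
  simp only [avg₂]
  rw [Finset.sum_comm]

theorem avg_eq_avg₂_right (hN : 0 < N) (a : S → ℝ) (x : Fin N → S) :
    avg a x = avg₂ (fun _ z => a z) x := by
  rw [avg_eq_avg₂_left hN, ← avg₂_swap]

theorem avg₂_add (F G : S → S → ℝ) (x : Fin N → S) :
    avg₂ (fun y z => F y z + G y z) x = avg₂ F x + avg₂ G x := by
  simp only [avg₂, Finset.sum_add_distrib, mul_add]

theorem avg₂_const_mul (c : ℝ) (F : S → S → ℝ) (x : Fin N → S) :
    avg₂ (fun y z => c * F y z) x = c * avg₂ F x := by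
  simp only [avg₂, ← Finset.mul_sum]; ring

theorem avg₂_mono {F G : S → S → ℝ} (h : ∀ y z, F y z ≤ G y z) (x : Fin N → S) :
    avg₂ F x ≤ avg₂ G x :=
  mul_le_mul_of_nonneg_left (Finset.sum_le_sum fun _ _ => Finset.sum_le_sum fun _ _ => h _ _)
    (by positivity)

theorem avg_add (a b : S → ℝ) (x : Fin N → S) :
    avg (fun y => a y + b y) x = avg a x + avg b x := by
  simp only [avg, Finset.sum_add_distrib, mul_add]

theorem avg_const_mul (c : ℝ) (a : S → ℝ) (x : Fin N → S) :
    avg (fun y => c * a y) x = c * avg a x := by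
  simp only [avg, ← Finset.mul_sum]; ring

theorem avg_one (hN : 0 < N) (x : Fin N → S) : avg (fun _ => 1) x = 1 := by
  have : (N : ℝ) ≠ 0 := by positivity
  simp [avg, this]

theorem avg_update (a : S → ℝ) (x : Fin N → S) (i : Fin N) (y : S) :
    avg a (Function.update x i y) = avg a x + 1 / (N : ℝ) * (a y - a (x i)) := by
  have : ∑ k, a (Function.update x i y k) = ∑ k, a (x k) + (a y - a (x i)) := by
    have h : ∀ k, a (Function.update x i y k) = a (x k) + if k = i then a y - a (x i) else 0 := by
      intro k
      rcases eq_or_ne k i with rfl | hk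
      · simp
      · simp [hk]
    simp only [h, Finset.sum_add_distrib, Finset.sum_ite_eq', Finset.mem_univ, if_true]
  rw [avg, this, mul_add, avg]

end Averages

variable {S : Type*} [Fintype S] (M : EvolvingModel S) {N : ℕ}

theorem genL_avg_update {s : ℝ} (hs : 0 ≤ s) (a : S → ℝ) (x : Fin N → S) (i : Fin N) :
    M.genL s (fun y => avg a (Function.update x i y)) (x i) =
      1 / (N : ℝ) * M.genL s a (x i) := by
  have h := M.L_row_sum s hs (x i)
  calc _ = (∑ y, M.L s (x i) y) * (avg a x - 1 / (N : ℝ) * a (x i)) +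
        1 / (N : ℝ) * M.genL s a (x i) := by
        simp only [genL, avg_update, Finset.sum_mul, Finset.mul_sum, ← Finset.sum_add_distrib]
        exact Finset.sum_congr rfl fun y _ => by ring
    _ = _ := by rw [h]; ring

/-- The positive part of an antisymmetric kernel, tested against an antisymmetric function. -/
theorem sum_posPart_mul (F G : Fin N → Fin N → ℝ) (hF : ∀ i j, F j i = -F i j)
    (hG : ∀ i j, G j i = -G i j) :
    ∑ i, ∑ j, max (F i j) 0 * G i j = ∑ i, ∑ j, 1 / 2 * (F i j * G i j) := by
  have h1 : ∑ i, ∑ j, max (F i j) 0 * G i j = ∑ i, ∑ j, max (F j i) 0 * G j i :=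
    Finset.sum_comm
  have h2 : ∑ i, ∑ j, max (F i j) 0 * G i j + ∑ i, ∑ j, max (F j i) 0 * G j i =
      ∑ i, ∑ j, F i j * G i j := by
    simp only [← Finset.sum_add_distrib]
    refine Finset.sum_congr rfl fun i _ => Finset.sum_congr rfl fun j _ => ?_
    rw [hF i j, hG i j]
    rcases le_total (F i j) 0 with h | h
    · rw [max_eq_right h, max_eq_left (by linarith)]; ring
    · rw [max_eq_left h, max_eq_right (by linarith)]; ring
  simp only [← Finset.mul_sum]
  linarith

/-- The positive part of an antisymmetric kernel, tested against a symmetric function. -/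
theorem sum_posPart_mul_symm (F G : Fin N → Fin N → ℝ) (hF : ∀ i j, F j i = -F i j)
    (hG : ∀ i j, G j i = G i j) :
    ∑ i, ∑ j, max (F i j) 0 * G i j = ∑ i, ∑ j, 1 / 2 * (|F i j| * G i j) := by
  have h1 : ∑ i, ∑ j, max (F i j) 0 * G i j = ∑ i, ∑ j, max (F j i) 0 * G j i :=
    Finset.sum_comm
  have h2 : ∑ i, ∑ j, max (F i j) 0 * G i j + ∑ i, ∑ j, max (F j i) 0 * G j i =
      ∑ i, ∑ j, |F i j| * G i j := by
    simp only [← Finset.sum_add_distrib]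
    refine Finset.sum_congr rfl fun i _ => Finset.sum_congr rfl fun j _ => ?_
    rw [hF i j, hG i j]
    rcases le_total (F i j) 0 with h | h
    · rw [max_eq_right h, max_eq_left (by linarith), abs_of_nonpos h]; ring
    · rw [max_eq_left h, max_eq_right (by linarith), abs_of_nonneg h]; ring
  simp only [← Finset.mul_sum]
  linarith

/-- A jump of i to j changes the average by (a(x_j) − a(x_i))/N, which is antisymmetric, so the
positive part of the rate acts as half the signed rate. -/
theorem particleGenerator_avg {s : ℝ} (hs : 0 ≤ s) (a : S → ℝ) (x : Fin N → S) :
    M.particleGenerator N s (avg a) x = M.lam s * avg (M.genL s a) x +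
      avg₂ (fun y z => 1 / 2 * ((M.H s y - M.H s z) * (a z - a y))) x := by
  simp only [particleGenerator, M.genL_avg_update hs]
  simp only [avg_update, add_sub_cancel_left]
  congr 1
  · rw [avg, ← Finset.mul_sum]
  · rw [avg₂, ← sum_posPart_mul (fun i j => M.H s (x i) - M.H s (x j))
      (fun i j => a (x j) - a (x i)) (fun i j => by ring) (fun i j => by ring)]
    simp only [Finset.mul_sum]
    exact Finset.sum_congr rfl fun i _ => Finset.sum_congr rfl fun j _ => by ring

/-- Beyond the chain rule there remain squared jumps. They are symmetric in the pair, hence see half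
the absolute rate, and their size 1/N² leaves a term of order 1/N. -/
theorem particleGenerator_avg_sq {s : ℝ} (hs : 0 ≤ s) (a : S → ℝ) (x : Fin N → S) :
    M.particleGenerator N s (fun x => avg a x ^ 2) x =
      2 * avg a x * M.particleGenerator N s (avg a) x +
      1 / (N : ℝ) * (M.lam s * avg (M.carre s a) x +
        avg₂ (fun y z => 1 / 2 * (|M.H s y - M.H s z| * (a z - a y) ^ 2)) x) := by
  have h1 : ∀ i, M.genL s (fun y => avg a (Function.update x i y) ^ 2) (x i) =
      2 * avg a x * M.genL s (fun y => avg a (Function.update x i y)) (x i) +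
        1 / (N : ℝ) ^ 2 * M.carre s a (x i) := by
    intro i
    rw [M.genL_sq hs, Function.update_eq_self, add_comm]
    congr 1
    simp only [carre, avg_update, Finset.mul_sum]
    exact Finset.sum_congr rfl fun y _ => by ring
  have h2 : ∀ i j, max (M.H s (x i) - M.H s (x j)) 0 *
      (avg a (Function.update x i (x j)) ^ 2 - avg a x ^ 2) =
      2 * avg a x * (max (M.H s (x i) - M.H s (x j)) 0 *
        (avg a (Function.update x i (x j)) - avg a x)) +
      1 / (N : ℝ) ^ 2 * (max (M.H s (x i) - M.H s (x j)) 0 * (a (x j) - a (x i)) ^ 2) := by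
    intro i j
    rw [avg_update]; ring
  simp only [particleGenerator, h1, h2, Finset.sum_add_distrib, ← Finset.mul_sum]
  rw [sum_posPart_mul_symm (fun i j => M.H s (x i) - M.H s (x j))
      (fun i j => (a (x j) - a (x i)) ^ 2) (fun i j => by ring) (fun i j => by ring)]
  simp only [avg, avg₂]
  ring

theorem particleGenerator_add {s : ℝ} (φ ψ : (Fin N → S) → ℝ) (x : Fin N → S) (c d : ℝ) :
    M.particleGenerator N s (fun x => c * φ x + d * ψ x) x =
      c * M.particleGenerator N s φ x + d * M.particleGenerator N s ψ x := by
  simp only [particleGenerator, genL, Finset.mul_sum, mul_add, ← Finset.sum_add_distrib]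
  refine Finset.sum_congr rfl fun i _ => ?_
  rw [add_add_add_comm]
  simp only [← Finset.sum_add_distrib]
  congr 1 <;> exact Finset.sum_congr rfl fun j _ => by ring

/-- The two-point function whose average drives the second moments of the particle system. -/
noncomputable def driftKernel (s : ℝ) (g : S → ℝ) (y z : S) : ℝ :=
  1 / 2 * (|M.H s y - M.H s z| * (g z - g y) ^ 2) +
    1 / 2 * ((M.H s y - M.H s z) * (g z ^ 2 - g y ^ 2))

/-- Selection acts as minus the empirical covariance of H and a; its quadratic term is the one that
the reweighting compensates. -/
theorem avg₂_antisymm (hN : 0 < N) (s : ℝ) (a : S → ℝ) (x : Fin N → S) :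
    avg₂ (fun y z => 1 / 2 * ((M.H s y - M.H s z) * (a z - a y))) x =
      avg (M.H s) x * avg a x - avg (fun y => M.H s y * a y) x := by
  have h2 : ∀ y z : S, 1 / 2 * ((M.H s y - M.H s z) * (a z - a y)) =
      1 / 2 * (M.H s y * a z) + (1 / 2 * (M.H s z * a y) +
      (-(1 / 2) * (M.H s y * a y) + -(1 / 2) * (M.H s z * a z))) :=
    fun y z => by ring
  simp only [h2, avg₂_add, avg₂_const_mul]
  rw [← avg_eq_avg₂_left hN fun y => M.H s y * a y,
    ← avg_eq_avg₂_right hN fun y => M.H s y * a y,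
    avg₂_swap fun y z => M.H s y * a z, ← avg_mul_avg]
  ring

theorem hasDerivWithinAt_avg_q {t : ℝ} (ht : 0 ≤ t) (f : S → ℝ) {s : ℝ} (hs : s ∈ Icc 0 t)
    (x : Fin N → S) : HasDerivWithinAt (fun u => avg (M.q u t f) x)
      (avg (fun y => M.H s y * M.q s t f y) x - M.lam s * avg (M.genL s (M.q s t f)) x)
      (Icc 0 t) s := by
  refine ((HasDerivWithinAt.fun_sum (u := Finset.univ) fun i _ =>
    M.hasDerivWithinAt_q ht f hs (x i)).const_mul (1 / (N : ℝ))).congr_deriv ?_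
  simp only [avg, Finset.sum_sub_distrib, ← Finset.mul_sum]
  ring

theorem hasDerivWithinAt_avg_q_sq {t : ℝ} (ht : 0 ≤ t) (f : S → ℝ) {s : ℝ} (hs : s ∈ Icc 0 t)
    (x : Fin N → S) : HasDerivWithinAt (fun u => avg (fun y => M.q u t f y ^ 2) x)
      (avg (fun y => 2 * M.q s t f y * (M.H s y * M.q s t f y -
        M.lam s * M.genL s (M.q s t f) y)) x) (Icc 0 t) s := by
  refine HasDerivWithinAt.const_mul _ (HasDerivWithinAt.fun_sum fun i _ => ?_)
  simpa using (M.hasDerivWithinAt_q ht f hs (x i)).fun_pow 2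

/-- The time derivative of (q f)² and the mutation part of the generator combine into a carré du
champ. -/
theorem avg_two_mul_q {t : ℝ} (f : S → ℝ) {s : ℝ} (hs : s ∈ Icc 0 t) (x : Fin N → S) :
    avg (fun y => 2 * M.q s t f y * (M.H s y * M.q s t f y -
        M.lam s * M.genL s (M.q s t f) y)) x + M.lam s * avg (M.genL s fun y =>
          M.q s t f y ^ 2) x =
      M.lam s * avg (M.carre s (M.q s t f)) x +
        2 * avg (fun y => M.H s y * M.q s t f y ^ 2) x := by
  simp only [← avg_const_mul, ← avg_add]
  congr 1
  funext y
  rw [M.genL_sq hs.1]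
  ring

theorem particleGenerator_continuousOn (φ : (Fin N → S) → ℝ) (x : Fin N → S) :
    ContinuousOn (fun s => M.particleGenerator N s φ x) (Ici 0) := by
  have hL := M.L_continuous
  have hH := M.H_continuous
  have hl := M.lam_continuous
  unfold particleGenerator genL
  refine (hl.mul (continuousOn_finsetSum _ fun i _ => continuousOn_finsetSum _ fun y _ =>
    (hL _ _).mul continuousOn_const)).add (continuousOn_const.mul ?_)
  exact continuousOn_finsetSum _ fun i _ => continuousOn_finsetSum _ fun j _ =>
    (((hH _).sub (hH _)).sup continuousOn_const).mul continuousOn_const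

/-- The potential `k ⟨H_s, η_s⟩` of the particle system. -/
noncomputable def potential (N : ℕ) (k : ℝ) (s : ℝ) (x : Fin N → S) : ℝ := k * avg (M.H s) x

/-! ### Exact first and second moments of the particle system. -/

section ParticleLaw

variable [MeasurableSpace S] [DiscreteMeasurableSpace S] {Ω : Type*} [MeasurableSpace Ω]
  {ℙ : Measure Ω} {X : ℝ → Ω → Fin N → S}

omit [DiscreteMeasurableSpace S] in
theorem exists_fkSetting (hX : M.IsParticleSystem N ℙ X) (k : ℝ) {T : ℝ} (hT : 0 ≤ T) :
    ∃ K, FKSetting (M.particleGenerator N) (M.potential N k) ℙ X T K := by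
  have hc : ∀ x : Fin N → S, ContinuousOn (fun s => M.potential N k s x) (Ici 0) := fun x =>
    continuousOn_const.mul (continuousOn_const.mul
      (continuousOn_finsetSum _ fun i _ => M.H_continuous _))
  choose K hK using fun x => isCompact_Icc.exists_bound_of_continuousOn
    ((hc x).mono (Icc_subset_Ici_self : Icc 0 T ⊆ Ici 0))
  exact ⟨∑ x, |K x|, hX.markov, hT, M.particleGenerator_continuousOn, hc, fun s hs x =>
    ((hK x s hs).trans (le_abs_self _)).trans (FKSetting.abs_le_sum K x)⟩

omit [MeasurableSpace S] [DiscreteMeasurableSpace S] [MeasurableSpace Ω] in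
theorem reweighted_eq (t : ℝ) (f : S → ℝ) (ω : Ω) :
    M.reweighted X t f ω = weight (M.potential N 1) X t ω * avg f (X t ω) := by
  simp only [reweighted, weight, potential, one_mul]
  rfl

omit [MeasurableSpace S] [DiscreteMeasurableSpace S] [MeasurableSpace Ω] in
-- Second moments of ν thereby become Feynman-Kac functionals with doubled potential.
theorem weight_sq (t : ℝ) (ω : Ω) :
    weight (M.potential N 1) X t ω ^ 2 = weight (M.potential N 2) X t ω := by
  simp only [weight, potential, one_mul, intervalIntegral.integral_const_mul]
  rw [← Real.exp_nat_mul]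
  congr 1
  push_cast; ring

theorem integral_measure {t : ℝ} (ht : 0 ≤ t) (a : S → ℝ) :
    ∫ x, a x ∂M.measure t = pairing a (M.μ t) := by
  rw [measure, integral_finsetSum_measure]
  · refine Finset.sum_congr rfl fun x _ => ?_
    rw [integral_smul_measure, integral_dirac, ENNReal.toReal_ofReal (M.μ_pos ht x).le,
      smul_eq_mul, mul_comm]
  · intro x _
    exact (integrable_dirac (by simp)).smul_measure (by simp)

omit [DiscreteMeasurableSpace S] in
theorem isProbabilityMeasure_measure {t : ℝ} (ht : 0 ≤ t) :
    IsProbabilityMeasure (M.measure t) := by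
  refine ⟨?_⟩
  rw [measure, Measure.finsetSum_apply]
  simp only [Measure.smul_apply, measure_univ, smul_eq_mul, mul_one]
  rw [← ENNReal.ofReal_sum_of_nonneg fun x _ => (M.μ_pos ht x).le, M.sum_μ ht,
    ENNReal.ofReal_one]

instance isProbabilityMeasure_measure_zero : IsProbabilityMeasure (M.measure 0) :=
  M.isProbabilityMeasure_measure le_rfl

theorem feynmanKac_zero (hX : M.IsParticleSystem N ℙ X) (h : ℝ → (Fin N → S) → ℝ)
    (φ : (Fin N → S) → ℝ) :
    feynmanKac h ℙ X 0 φ = ∫ x, φ x ∂(Measure.pi fun _ : Fin N => M.measure 0) := by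
  rw [← hX.initial, integral_map (hX.markov.measurable 0 le_rfl).aemeasurable
    (measurable_of_countable φ).aestronglyMeasurable]
  simp [feynmanKac, weight]

theorem integral_pi_eval (a : S → ℝ) (i : Fin N) :
    ∫ x, a (x i) ∂(Measure.pi fun _ : Fin N => M.measure 0) = pairing a (M.μ 0) := by
  have h := integral_map (μ := Measure.pi fun _ : Fin N => M.measure 0)
    (measurable_pi_apply i).aemeasurable
    (measurable_of_countable a).aestronglyMeasurable
  rw [(measurePreserving_eval (fun _ : Fin N => M.measure 0) i).map_eq,
    M.integral_measure le_rfl] at h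
  exact h.symm

theorem integrable_pi (φ : (Fin N → S) → ℝ) :
    Integrable φ (Measure.pi fun _ : Fin N => M.measure 0) :=
  Integrable.of_finite

theorem integral_pi_eval_mul (a : S → ℝ) {i j : Fin N} (hij : i ≠ j) :
    ∫ x, a (x i) * a (x j) ∂(Measure.pi fun _ : Fin N => M.measure 0) =
      pairing a (M.μ 0) ^ 2 := by
  have h := ProbabilityTheory.iIndepFun_pi (μ := fun _ : Fin N => M.measure 0)
    (X := fun _ => a) fun _ => (measurable_of_countable a).aemeasurable
  have h2 := (h.indepFun hij).integral_fun_mul_eq_mul_integral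
    (measurable_of_countable _).aestronglyMeasurable
    (measurable_of_countable _).aestronglyMeasurable
  rw [h2, M.integral_pi_eval, M.integral_pi_eval, sq]

theorem feynmanKac_zero_avg (hN : 0 < N) (hX : M.IsParticleSystem N ℙ X)
    (h : ℝ → (Fin N → S) → ℝ) (a : S → ℝ) :
    feynmanKac h ℙ X 0 (avg a) = pairing a (M.μ 0) := by
  have : (N : ℝ) ≠ 0 := by positivity
  rw [M.feynmanKac_zero hX]
  simp only [avg]
  rw [integral_const_mul, integral_finsetSum _ fun i _ => M.integrable_pi _]
  simp only [M.integral_pi_eval, Finset.sum_const, Finset.card_univ, Fintype.card_fin,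
    nsmul_eq_mul]
  field_simp

/-- Removing the diagonal leaves 1/N times a sum over N(N − 1) ordered pairs of distinct particles,
which are independent at time 0. -/
theorem feynmanKac_zero_avg_sq (hN : 0 < N) (hX : M.IsParticleSystem N ℙ X)
    (h : ℝ → (Fin N → S) → ℝ) (a : S → ℝ) :
    feynmanKac h ℙ X 0 (fun x => N * avg a x ^ 2 - avg (fun y => a y ^ 2) x) =
      (N - 1) * pairing a (M.μ 0) ^ 2 := by
  have hN0 : (N : ℝ) ≠ 0 := by positivity
  have e : ∀ x : Fin N → S, N * avg a x ^ 2 - avg (fun y => a y ^ 2) x =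
      1 / (N : ℝ) * ∑ i, ∑ j, if i = j then 0 else a (x i) * a (x j) := by
    intro x
    have h1 : ∑ i, ∑ j, (if i = j then 0 else a (x i) * a (x j)) + ∑ i, a (x i) ^ 2 =
        (∑ i, a (x i)) ^ 2 := by
      rw [sq, Finset.sum_mul_sum, ← Finset.sum_add_distrib]
      refine Finset.sum_congr rfl fun i _ => ?_
      have : a (x i) ^ 2 = ∑ j, if i = j then a (x i) * a (x j) else 0 := by simp [sq]
      rw [this, ← Finset.sum_add_distrib]
      refine Finset.sum_congr rfl fun j _ => ?_
      split_ifs <;> simp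
    simp only [avg]
    rw [← sub_eq_iff_eq_add.2 h1.symm]
    field_simp
  rw [M.feynmanKac_zero hX]
  simp only [e]
  rw [integral_const_mul, integral_finsetSum _ fun i _ => M.integrable_pi _]
  have h2 : ∀ i j : Fin N, (∫ x, (if i = j then 0 else a (x i) * a (x j))
      ∂(Measure.pi fun _ : Fin N => M.measure 0)) =
      pairing a (M.μ 0) ^ 2 - if i = j then pairing a (M.μ 0) ^ 2 else 0 := by
    intro i j
    split_ifs with hij
    · simp
    · rw [M.integral_pi_eval_mul a hij, sub_zero]
  have h3 : ∀ i : Fin N, (∫ x, ∑ j, (if i = j then 0 else a (x i) * a (x j))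
      ∂(Measure.pi fun _ : Fin N => M.measure 0)) =
      ∑ j, (pairing a (M.μ 0) ^ 2 - if i = j then pairing a (M.μ 0) ^ 2 else 0) := fun i => by
    rw [integral_finsetSum _ fun j _ => M.integrable_pi _]
    exact Finset.sum_congr rfl fun j _ => h2 i j
  simp only [h3, Finset.sum_sub_distrib, Finset.sum_ite_eq, Finset.mem_univ, if_true,
    Finset.sum_const, Finset.card_univ, Fintype.card_fin, nsmul_eq_mul]
  field_simp

variable [IsProbabilityMeasure ℙ] {t : ℝ}

/-- The reweighted empirical distribution is unbiased. -/
theorem feynmanKac_one_avg (hN : 0 < N) (hX : M.IsParticleSystem N ℙ X) (ht : 0 ≤ t)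
    (f : S → ℝ) : feynmanKac (M.potential N 1) ℙ X t (avg f) = pairing f (M.μ t) := by
  -- The derivative formula is for 0 < t: on a one-point interval derivatives are not unique.
  rcases ht.eq_or_lt with rfl | ht0
  · exact M.feynmanKac_zero_avg hN hX _ f
  obtain ⟨K, F⟩ := M.exists_fkSetting hX 1 ht
  have hd : ∀ s ∈ Icc 0 t, HasDerivWithinAt
      (fun u => feynmanKac (M.potential N 1) ℙ X u (avg (M.q u t f))) 0 (Icc 0 t) s := by
    intro s hs
    refine (F.hasDerivWithinAt_feynmanKac_of_hasDerivWithinAt le_rfl ht0 hs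
      (M.hasDerivWithinAt_avg_q ht f hs)).congr_deriv ?_
    have e : ∀ x : Fin N → S,
        avg (fun y => M.H s y * M.q s t f y) x - M.lam s * avg (M.genL s (M.q s t f)) x +
        (M.particleGenerator N s (avg (M.q s t f)) x -
          M.potential N 1 s x * avg (M.q s t f) x) = 0 := fun x => by
      rw [M.particleGenerator_avg hs.1, M.avg₂_antisymm hN, potential]
      ring
    simp only [e]
    simp [feynmanKac]
  have h := integral_eq_sub_of_hasDerivWithinAt_Icc ht hd continuousOn_const
  simp only [intervalIntegral.integral_zero, M.q_self ht] at h
  rw [M.feynmanKac_zero_avg hN hX, M.pairing_q ht f ⟨le_rfl, ht⟩] at h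
  linarith

theorem continuousOn_feynmanKac_driftKernel (hX : M.IsParticleSystem N ℙ X) (ht : 0 ≤ t)
    (f : S → ℝ) : ContinuousOn (fun s => feynmanKac (M.potential N 2) ℙ X s
      (avg₂ (M.driftKernel s (M.q s t f)))) (Icc 0 t) := by
  obtain ⟨K, F⟩ := M.exists_fkSetting hX 2 ht
  refine F.continuousOn_feynmanKac_of_continuousOn le_rfl fun x => ?_
  have hq := M.q_continuousOn ht f
  have hH := fun x => M.H_continuousOn_Icc (t := t) x
  unfold avg₂ driftKernel
  fun_prop

/-- The evolution of `E[ν_s(1) ν_s((q_{s,t} f)²)]`. -/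
theorem hasDerivWithinAt_feynmanKac_avg_q_sq (hN : 0 < N) (hX : M.IsParticleSystem N ℙ X)
    (ht : 0 < t) (f : S → ℝ) {s : ℝ} (hs : s ∈ Icc 0 t) :
    HasDerivWithinAt (fun u => feynmanKac (M.potential N 2) ℙ X u
        (avg fun y => M.q u t f y ^ 2))
      (feynmanKac (M.potential N 2) ℙ X s fun x => M.lam s * avg (M.carre s (M.q s t f)) x +
        (avg (fun y => M.H s y * M.q s t f y ^ 2) x -
          avg (M.H s) x * avg (fun y => M.q s t f y ^ 2) x)) (Icc 0 t) s := by
  obtain ⟨K, F⟩ := M.exists_fkSetting hX 2 ht.le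
  refine (F.hasDerivWithinAt_feynmanKac_of_hasDerivWithinAt le_rfl ht hs
    fun x => M.hasDerivWithinAt_avg_q_sq ht.le f hs x).congr_deriv ?_
  congr 1
  funext x
  have h1 := M.avg_two_mul_q f hs x
  rw [M.particleGenerator_avg hs.1, M.avg₂_antisymm hN s fun y => M.q s t f y ^ 2, potential]
  linear_combination h1

/-- The evolution of `E[ν_s(1) ν_s(q_{s,t} f)]`. -/
theorem hasDerivWithinAt_feynmanKac_avg_q (hN : 0 < N) (hX : M.IsParticleSystem N ℙ X)
    (ht : 0 < t) (f : S → ℝ) {s : ℝ} (hs : s ∈ Icc 0 t) :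
    HasDerivWithinAt (fun u => feynmanKac (M.potential N 2) ℙ X u (avg (M.q u t f)))
      (feynmanKac (M.potential N 2) ℙ X s fun x => -1 * (avg (M.H s) x * avg (M.q s t f) x))
      (Icc 0 t) s := by
  obtain ⟨K, F⟩ := M.exists_fkSetting hX 2 ht.le
  refine (F.hasDerivWithinAt_feynmanKac_of_hasDerivWithinAt le_rfl ht hs
    (M.hasDerivWithinAt_avg_q ht.le f hs)).congr_deriv ?_
  congr 1
  funext x
  rw [M.particleGenerator_avg hs.1, M.avg₂_antisymm hN, potential]
  ring

/-- The second moment identity for the reweighted empirical distribution. -/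
theorem feynmanKac_two_avg_sq (hN : 0 < N) (hX : M.IsParticleSystem N ℙ X) (ht : 0 ≤ t)
    (f : S → ℝ) :
    N * feynmanKac (M.potential N 2) ℙ X t (fun x => avg f x ^ 2) =
      feynmanKac (M.potential N 2) ℙ X t (avg fun y => f y ^ 2) +
      (N - 1) * pairing f (M.μ t) ^ 2 +
      ∫ s in (0 : ℝ)..t, feynmanKac (M.potential N 2) ℙ X s
        (avg₂ (M.driftKernel s (M.q s t f))) := by
  have hN0 : (N : ℝ) ≠ 0 := by positivity
  obtain ⟨K, F⟩ := M.exists_fkSetting hX 2 ht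
  have hsub : feynmanKac (M.potential N 2) ℙ X t
      (fun x => N * avg f x ^ 2 - avg (fun y => f y ^ 2) x) =
      N * feynmanKac (M.potential N 2) ℙ X t (fun x => avg f x ^ 2) -
      feynmanKac (M.potential N 2) ℙ X t (avg fun y => f y ^ 2) := by
    have h1 := F.feynmanKac_add ⟨ht, le_rfl⟩ (fun x => N * avg f x ^ 2)
      (fun x => -1 * avg (fun y => f y ^ 2) x)
    rw [FKSetting.feynmanKac_const_mul, FKSetting.feynmanKac_const_mul] at h1
    simp only [neg_one_mul, ← sub_eq_add_neg] at h1
    exact h1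
  rcases ht.eq_or_lt with rfl | ht0
  · have h0 := M.feynmanKac_zero_avg_sq hN hX (M.potential N 2) f
    rw [hsub] at h0
    rw [intervalIntegral.integral_same]
    linarith
  -- N⟨g⟩² and ⟨g²⟩ produce the same carré du champ term, so λ drops out of the derivative of their
  -- difference and only the selection kernel survives.
  have hd : ∀ s ∈ Icc 0 t, HasDerivWithinAt
      (fun u => feynmanKac (M.potential N 2) ℙ X u
        fun x => N * avg (M.q u t f) x ^ 2 - avg (fun y => M.q u t f y ^ 2) x)
      (feynmanKac (M.potential N 2) ℙ X s (avg₂ (M.driftKernel s (M.q s t f)))) (Icc 0 t) s := by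
    intro s hs
    refine (F.hasDerivWithinAt_feynmanKac_of_hasDerivWithinAt le_rfl ht0 hs
      (φ := fun u x => N * avg (M.q u t f) x ^ 2 - avg (fun y => M.q u t f y ^ 2) x)
      fun x => (((M.hasDerivWithinAt_avg_q ht f hs x).fun_pow 2).const_mul (N : ℝ)).sub
        (M.hasDerivWithinAt_avg_q_sq ht f hs x)).congr_deriv ?_
    congr 1
    funext x
    have h1 := M.avg_two_mul_q f hs x
    have h4 : avg₂ (M.driftKernel s (M.q s t f)) x =
        avg₂ (fun y z => 1 / 2 * (|M.H s y - M.H s z| * (M.q s t f z - M.q s t f y) ^ 2)) x +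
        (avg (M.H s) x * avg (fun y => M.q s t f y ^ 2) x -
          avg (fun y => M.H s y * M.q s t f y ^ 2) x) := by
      rw [← M.avg₂_antisymm hN, ← avg₂_add]; rfl
    have h5 := M.particleGenerator_add (s := s) (fun x => avg (M.q s t f) x ^ 2)
      (avg fun y => M.q s t f y ^ 2) x N (-1)
    simp only [neg_one_mul, ← sub_eq_add_neg] at h5
    rw [h5, M.particleGenerator_avg_sq hs.1, M.particleGenerator_avg hs.1 (M.q s t f),
      M.particleGenerator_avg hs.1, M.avg₂_antisymm hN, M.avg₂_antisymm hN, h4, potential]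
    have hNN : (N : ℝ) * (1 / N) = 1 := by field_simp
    simp only [Nat.cast_ofNat, Nat.add_one_sub_one, pow_one]
    linear_combination -h1 + (M.lam s * avg (M.carre s (M.q s t f)) x +
        avg₂ (fun y z => 1 / 2 * (|M.H s y - M.H s z| *
          (M.q s t f z - M.q s t f y) ^ 2)) x) * hNN
  have h := integral_eq_sub_of_hasDerivWithinAt_Icc ht hd
    (M.continuousOn_feynmanKac_driftKernel hX ht f)
  rw [M.feynmanKac_zero_avg_sq hN hX, M.pairing_q ht f ⟨le_rfl, ht⟩] at h
  simp only [M.q_self ht] at h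
  rw [hsub] at h
  rw [h]; ring

end ParticleLaw

end EvolvingModel

end SeqMC

namespace SeqMC

/-- The integral of a centered product, expanded. -/
theorem integral_sub_add_add_const {Ω : Type*} [MeasurableSpace Ω] {ℙ : Measure Ω}
    [IsProbabilityMeasure ℙ] {F G H : Ω → ℝ} (hF : Integrable F ℙ) (hG : Integrable G ℙ)
    (hH : Integrable H ℙ) (a b c : ℝ) :
    Integrable (fun ω => F ω - (a * G ω + b * H ω) + c) ℙ ∧
    ∫ ω, (F ω - (a * G ω + b * H ω) + c) ∂ℙ =
      ∫ ω, F ω ∂ℙ - (a * ∫ ω, G ω ∂ℙ + b * ∫ ω, H ω ∂ℙ) + c := by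
  have h1 : Integrable (fun ω => a * G ω + b * H ω) ℙ := (hG.const_mul a).add (hH.const_mul b)
  have h2 : Integrable (fun ω => F ω - (a * G ω + b * H ω)) ℙ := hF.sub h1
  refine ⟨h2.add (integrable_const c), ?_⟩
  rw [integral_add h2 (integrable_const c), integral_sub hF h1,
    integral_add (hG.const_mul a) (hH.const_mul b), integral_const_mul, integral_const_mul]
  simp

namespace EvolvingModel

/-! ### Norm inequalities -/

section NormInequalities

variable {S : Type*} [Fintype S] [MeasurableSpace S] [DiscreteMeasurableSpace S]
  (M : EvolvingModel S) {s t : ℝ}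

theorem aestronglyMeasurable_measure (f : S → ℝ) : AEStronglyMeasurable f (M.measure t) :=
  (measurable_of_countable f).aestronglyMeasurable

theorem normLp_mul_le (p q : ℝ≥0∞) {r : ℝ≥0∞} (h : p⁻¹ + q⁻¹ = r⁻¹) (f g : S → ℝ) :
    M.normLp r t (fun x => f x * g x) ≤ M.normLp p t f * M.normLp q t g := by
  have : ENNReal.HolderTriple p q r := ⟨h⟩
  have h2 := eLpNorm_smul_le_mul_eLpNorm (p := p) (q := q) (r := r)
    (M.aestronglyMeasurable_measure (t := t) g) (M.aestronglyMeasurable_measure (t := t) f)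
  exact h2

theorem normLp_mono (ht : 0 ≤ t) {p q : ℝ≥0∞} (h : p ≤ q) (f : S → ℝ) :
    M.normLp p t f ≤ M.normLp q t f :=
  have := M.isProbabilityMeasure_measure ht
  eLpNorm_le_eLpNorm_of_exponent_le h (M.aestronglyMeasurable_measure f)

theorem normLp_ne_top (ht : 0 ≤ t) (p : ℝ≥0∞) (f : S → ℝ) : M.normLp p t f ≠ ∞ :=
  have := M.isProbabilityMeasure_measure ht
  (MemLp.of_bound (M.aestronglyMeasurable_measure f) (∑ x, |f x|)
    (.of_forall fun x => FKSetting.abs_le_sum f x)).eLpNorm_ne_top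

theorem normLp_eq_zero (ht : 0 ≤ t) {p : ℝ≥0∞} (hp : p ≠ 0) {f : S → ℝ}
    (h : M.normLp p t f = 0) : f = 0 := by
  have h1 := (eLpNorm_eq_zero_iff (M.aestronglyMeasurable_measure f) hp).1 h
  funext x
  by_contra hx
  have h2 : M.measure t {x | ¬f x = (0 : S → ℝ) x} = 0 := h1
  rw [measure, Measure.finsetSum_apply, Finset.sum_eq_zero_iff] at h2
  have h3 := h2 x (Finset.mem_univ x)
  rw [Measure.smul_apply, Measure.dirac_apply' _ (MeasurableSet.of_discrete), indicator_of_mem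
    (show x ∈ {x | ¬f x = (0 : S → ℝ) x} from hx), smul_eq_mul, Pi.one_apply, mul_one,
    ENNReal.ofReal_eq_zero] at h3
  exact absurd h3 (not_le.2 (M.μ_pos ht x))

omit [DiscreteMeasurableSpace S] in
theorem normLp_zero (p : ℝ≥0∞) : M.normLp p t 0 = 0 := eLpNorm_zero

omit [DiscreteMeasurableSpace S] in
theorem normLp_one (ht : 0 ≤ t) {p : ℝ≥0∞} (hp : p ≠ 0) : M.normLp p t (fun _ => 1) = 1 := by
  have := M.isProbabilityMeasure_measure ht
  rw [normLp, eLpNorm_const _ hp (NeZero.ne _)]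
  simp

omit [DiscreteMeasurableSpace S] in
theorem normLp_const_mul (p : ℝ≥0∞) (c : ℝ) (f : S → ℝ) :
    M.normLp p t (fun x => c * f x) = ‖c‖ₑ * M.normLp p t f :=
  eLpNorm_const_smul c f p _

omit [DiscreteMeasurableSpace S] in
theorem normLp_abs (p : ℝ≥0∞) (f : S → ℝ) :
    M.normLp p t (fun x => |f x|) = M.normLp p t f :=
  eLpNorm_norm f

theorem inv_two_mul_add (p : ℝ≥0∞) : (2 * p)⁻¹ + (2 * p)⁻¹ = p⁻¹ := by
  rw [ENNReal.mul_inv (Or.inl two_ne_zero) (Or.inl ENNReal.ofNat_ne_top), ← add_mul,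
    ENNReal.inv_two_add_inv_two, one_mul]

theorem normLp_sq_le (p : ℝ≥0∞) (f : S → ℝ) :
    M.normLp p t (fun x => f x ^ 2) ≤ M.normLp (2 * p) t f ^ 2 := by
  simp only [sq]
  exact M.normLp_mul_le _ _ (inv_two_mul_add p) f f

theorem two_mul_half (p : ℝ≥0∞) : 2 * (p / 2) = p :=
  ENNReal.mul_div_cancel two_ne_zero ENNReal.ofNat_ne_top

theorem normLp_half_sq_le (p : ℝ≥0∞) (f : S → ℝ) :
    M.normLp (p / 2) t (fun x => f x ^ 2) ≤ M.normLp p t f ^ 2 := by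
  simpa only [two_mul_half] using M.normLp_sq_le (t := t) (p / 2) f

theorem ofReal_abs_pairing_le (ht : 0 ≤ t) {p : ℝ≥0∞} (hp : 1 ≤ p) (f : S → ℝ) :
    ENNReal.ofReal |pairing f (M.μ t)| ≤ M.normLp p t f := by
  rw [← M.integral_measure ht, ← Real.norm_eq_abs, ofReal_norm]
  refine (enorm_integral_le_lintegral_enorm f).trans ?_
  rw [← eLpNorm_one_eq_lintegral_enorm]
  exact M.normLp_mono ht hp f

theorem pairing_sq_le (ht : 0 ≤ t) {p : ℝ≥0∞} (hp : 2 ≤ p) (f : S → ℝ) :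
    pairing (fun x => f x ^ 2) (M.μ t) ≤ (M.normLp p t f).toReal ^ 2 := by
  have hp' : 1 ≤ p / 2 := by
    rw [ENNReal.le_div_iff_mul_le (Or.inl two_ne_zero) (Or.inl ENNReal.ofNat_ne_top), one_mul]
    exact hp
  have h := (M.ofReal_abs_pairing_le ht hp' fun x => f x ^ 2).trans
    (M.normLp_half_sq_le (t := t) p f)
  rw [← ENNReal.toReal_pow]
  exact (le_abs_self _).trans ((ENNReal.ofReal_le_iff_le_toReal
    (ENNReal.pow_ne_top (M.normLp_ne_top ht p f))).1 h)

theorem normLp_q_le {p q : ℝ≥0∞} (hp : p ≠ 0) (ht : 0 ≤ t) (hs : s ∈ Icc 0 t) (f : S → ℝ) :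
    M.normLp (2 * (p⁻¹ - q⁻¹)⁻¹) s (M.q s t f) ≤ M.C s t p q * M.normLp p t f := by
  -- The suprema in C range over nonzero functions; for f = 0 the propagated function vanishes too.
  rcases eq_or_ne f 0 with rfl | hf
  · rw [M.q_zero_fun ht hs, M.normLp_zero]; exact zero_le
  have h1 : M.normLp (2 * (p⁻¹ - q⁻¹)⁻¹) s (M.q s t f) / M.normLp p t f ≤ M.C s t p q :=
    le_sup_of_le_left (le_sup_of_le_left (le_iSup₂_of_le (f := fun (f : S → ℝ) (_ : f ≠ 0) =>
      M.normLp (2 * (p⁻¹ - q⁻¹)⁻¹) s (M.q s t f) / M.normLp p t f) f hf le_rfl))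
  have h0 : M.normLp p t f ≠ 0 := fun h => hf (M.normLp_eq_zero ht hp h)
  exact (ENNReal.div_le_iff h0 (M.normLp_ne_top ht p f)).1 h1

theorem normLp_q_le_half {p q : ℝ≥0∞} (hp : p ≠ 0) (ht : 0 ≤ t) (hs : s ∈ Icc 0 t)
    (f : S → ℝ) : M.normLp p s (M.q s t f) ≤ M.C s t p q * M.normLp (p / 2) t f := by
  rcases eq_or_ne f 0 with rfl | hf
  · rw [M.q_zero_fun ht hs, M.normLp_zero]; exact zero_le
  have h1 : M.normLp p s (M.q s t f) / M.normLp (p / 2) t f ≤ M.C s t p q :=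
    le_sup_of_le_left (le_sup_of_le_right (le_iSup₂_of_le (f := fun (f : S → ℝ) (_ : f ≠ 0) =>
      M.normLp p s (M.q s t f) / M.normLp (p / 2) t f) f hf le_rfl))
  have h0 : M.normLp (p / 2) t f ≠ 0 := fun h => hf (M.normLp_eq_zero ht
    (ENNReal.div_pos hp ENNReal.ofNat_ne_top).ne' h)
  exact (ENNReal.div_le_iff h0 (M.normLp_ne_top ht _ f)).1 h1

omit [DiscreteMeasurableSpace S] in
theorem one_le_C {p q : ℝ≥0∞} : 1 ≤ M.C s t p q := le_sup_right

/-- The integrand `‖H_s‖_{L^q(μ_s)} C_{s,t}(p,q)²` of `C̄`. -/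
noncomputable def rate (s t : ℝ) (p q : ℝ≥0∞) : ℝ≥0∞ :=
  M.normLp q s (M.H s) * M.C s t p q ^ 2

/-- A pair of functions whose product of `L^p`-norms is controlled by the rate. -/
def RateBound (s t : ℝ) (p q : ℝ≥0∞) (f a b : S → ℝ) : Prop :=
  M.normLp p s a * M.normLp p s b ≤ M.rate s t p q * M.normLp p t f ^ 2

section RateBounds

variable {p q : ℝ≥0∞} (hp : 2 ≤ p) (hpq : p ≤ q) (ht : 0 ≤ t) (hs : s ∈ Icc 0 t) (f : S → ℝ)
  {k : S → ℝ} (hk : M.normLp q s k = M.normLp q s (M.H s))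
include hp hpq ht hs hk

omit [DiscreteMeasurableSpace S] ht hk hs hp in
theorem inv_add_inv_exponent : q⁻¹ + ((p⁻¹ - q⁻¹)⁻¹)⁻¹ = p⁻¹ := by
  rw [inv_inv, add_tsub_cancel_of_le (ENNReal.inv_le_inv.2 hpq)]

omit hpq in
theorem mul_normLp_le_rate : M.normLp q s k * M.normLp (2 * (p⁻¹ - q⁻¹)⁻¹) s (M.q s t f) ^ 2 ≤
    M.rate s t p q * M.normLp p t f ^ 2 := by
  have hp0 : p ≠ 0 := (two_pos.trans_le hp).ne'
  rw [hk, rate, mul_assoc, ← mul_pow]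
  gcongr
  exact M.normLp_q_le hp0 ht hs f

/-- With 1/r = 1/p − 1/q one has r ≥ p, and norms increase with the exponent under a probability
measure, so ‖g²‖_p ≤ ‖g‖_{2r}². -/
theorem rateBound_sq : M.RateBound s t p q f k fun x => M.q s t f x ^ 2 := by
  refine le_trans (mul_le_mul' (M.normLp_mono hs.1 hpq k) ((M.normLp_sq_le p _).trans
    (pow_le_pow_left' (M.normLp_mono hs.1 ?_ _) 2))) (M.mul_normLp_le_rate hp ht hs f hk)
  gcongr
  rw [← ENNReal.inv_le_inv, inv_inv]
  exact tsub_le_self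

/-- Hölder with 1/p = 1/q + 1/r gives ‖k g²‖_p ≤ ‖k‖_q ‖g‖_{2r}². This is the reason for the
exponent 2r in C. -/
theorem rateBound_one_mul_sq :
    M.RateBound s t p q f (fun _ => 1) fun x => k x * M.q s t f x ^ 2 := by
  have hp0 : p ≠ 0 := (two_pos.trans_le hp).ne'
  rw [RateBound, M.normLp_one hs.1 hp0, one_mul]
  refine le_trans ?_ (M.mul_normLp_le_rate hp ht hs f hk)
  refine (M.normLp_mul_le q _ (inv_add_inv_exponent hpq) k _).trans ?_
  gcongr
  exact M.normLp_sq_le _ _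

theorem rateBound_mul :
    M.RateBound s t p q f (fun x => k x * M.q s t f x) (M.q s t f) := by
  refine le_trans ?_ (M.mul_normLp_le_rate hp ht hs f hk)
  rw [sq, ← mul_assoc]
  have hr : p ≤ (p⁻¹ - q⁻¹)⁻¹ := by
    rw [← ENNReal.inv_le_inv, inv_inv]; exact tsub_le_self
  have hr2 : (p⁻¹ - q⁻¹)⁻¹ ≤ 2 * (p⁻¹ - q⁻¹)⁻¹ := by
    rw [two_mul]; exact le_self_add
  refine mul_le_mul' ((M.normLp_mul_le q _ (inv_add_inv_exponent hpq) k _).trans ?_)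
    (M.normLp_mono hs.1 (hr.trans hr2) _)
  gcongr
  exact M.normLp_mono hs.1 hr2 _

/-- Here f² is propagated, so the second supremum in C is used: ‖q(f²)‖_p ≤ C‖f²‖_{p/2} ≤ C‖f‖_p².
The clause C ≥ 1 allows C to be replaced by C². -/
theorem rateBound_q_sq : M.RateBound s t p q f k (M.q s t fun x => f x ^ 2) := by
  have hp0 : p ≠ 0 := (two_pos.trans_le hp).ne'
  refine le_trans (mul_le_mul' ((M.normLp_mono hs.1 hpq k).trans hk.le)
    (M.normLp_q_le_half (q := q) hp0 ht hs _)) ?_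
  rw [rate, mul_assoc]
  gcongr
  · exact le_self_pow₀ M.one_le_C two_ne_zero
  · exact M.normLp_half_sq_le p f

omit hp hpq ht hs hk in
theorem RateBound.ofReal_abs_pairing_mul_le {M : EvolvingModel S} {f a b : S → ℝ} (hp : 1 ≤ p)
    (hs : 0 ≤ s) (h : M.RateBound s t p q f a b) :
    ENNReal.ofReal |pairing a (M.μ s) * pairing b (M.μ s)| ≤
      M.rate s t p q * M.normLp p t f ^ 2 := by
  rw [abs_mul, ENNReal.ofReal_mul (abs_nonneg _)]
  exact (mul_le_mul' (M.ofReal_abs_pairing_le hs hp a)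
    (M.ofReal_abs_pairing_le hs hp b)).trans h

end RateBounds

end NormInequalities

/-! ### Mean square errors and covariances -/

section Covariance

variable {S : Type*} [Fintype S] [MeasurableSpace S] [DiscreteMeasurableSpace S]
  (M : EvolvingModel S) {N : ℕ} {Ω : Type*} [MeasurableSpace Ω] {ℙ : Measure Ω}
  [IsProbabilityMeasure ℙ] {X : ℝ → Ω → Fin N → S} (hN : 0 < N)
  (hX : M.IsParticleSystem N ℙ X) {s t : ℝ}
include hN hX

omit hN [IsProbabilityMeasure ℙ] in
theorem measurable_reweighted (hs : 0 ≤ s) (f : S → ℝ) :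
    Measurable (M.reweighted X s f) := by
  obtain ⟨K, F⟩ := M.exists_fkSetting hX 1 hs
  have e : M.reweighted X s f = fun ω => weight (M.potential N 1) X s ω * avg f (X s ω) :=
    funext fun ω => M.reweighted_eq s f ω
  rw [e]
  exact ((F.stronglyMeasurable_weight hs).mono F.past_le).measurable.mul
    (F.measurable_comp hs (avg f))

/-- The mixed second moment `E[ν_s(a) ν_s(b)]`. -/
noncomputable def mixedMoment (N : ℕ) (ℙ : Measure Ω) (X : ℝ → Ω → Fin N → S) (s : ℝ)
    (a b : S → ℝ) : ℝ := feynmanKac (M.potential N 2) ℙ X s fun x => avg a x * avg b x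

/-- Unbiasedness evaluates the cross terms, and the product of two weights is the weight with
doubled potential. -/
theorem integral_error_mul_error (hs : 0 ≤ s) (a b : S → ℝ) :
    Integrable (fun ω => (M.reweighted X s a ω - pairing a (M.μ s)) *
      (M.reweighted X s b ω - pairing b (M.μ s))) ℙ ∧
    ∫ ω, (M.reweighted X s a ω - pairing a (M.μ s)) *
      (M.reweighted X s b ω - pairing b (M.μ s)) ∂ℙ =
      M.mixedMoment N ℙ X s a b - pairing a (M.μ s) * pairing b (M.μ s) := by
  obtain ⟨K, F⟩ := M.exists_fkSetting hX 1 hs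
  obtain ⟨K', F'⟩ := M.exists_fkSetting hX 2 hs
  have hsT : s ∈ Icc 0 s := ⟨hs, le_rfl⟩
  have e : (fun ω => (M.reweighted X s a ω - pairing a (M.μ s)) *
      (M.reweighted X s b ω - pairing b (M.μ s))) = fun ω =>
      weight (M.potential N 2) X s ω * (fun x => avg a x * avg b x) (X s ω) -
      (pairing b (M.μ s) * (weight (M.potential N 1) X s ω * avg a (X s ω)) +
       pairing a (M.μ s) * (weight (M.potential N 1) X s ω * avg b (X s ω))) +
      pairing a (M.μ s) * pairing b (M.μ s) := by
    funext ω
    rw [M.reweighted_eq, M.reweighted_eq, ← M.weight_sq]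
    ring
  have i1 := F'.integrable_weight_mul hsT hs fun x => avg a x * avg b x
  obtain ⟨h1, h2⟩ := integral_sub_add_add_const i1 (F.integrable_weight_mul hsT hs (avg a))
    (F.integrable_weight_mul hsT hs (avg b)) (pairing b (M.μ s)) (pairing a (M.μ s))
    (pairing a (M.μ s) * pairing b (M.μ s))
  have u1 := M.feynmanKac_one_avg hN hX hs a
  have u2 := M.feynmanKac_one_avg hN hX hs b
  rw [feynmanKac] at u1 u2
  rw [u1, u2] at h2
  rw [e]
  refine ⟨h1, h2.trans ?_⟩
  rw [mixedMoment, feynmanKac]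
  ring

theorem mse_eq (hs : 0 ≤ s) (f : S → ℝ) :
    M.mse ℙ X s f =
      ENNReal.ofReal (M.mixedMoment N ℙ X s f f - pairing f (M.μ s) ^ 2) ∧
    0 ≤ M.mixedMoment N ℙ X s f f - pairing f (M.μ s) ^ 2 := by
  obtain ⟨h1, h2⟩ := M.integral_error_mul_error hN hX hs f f
  rw [← sq] at h2
  refine ⟨?_, ?_⟩
  · rw [← h2, ofReal_integral_eq_lintegral_ofReal h1 (.of_forall fun ω => mul_self_nonneg _), mse]
    simp only [abs_mul_abs_self, sq]
  · rw [← h2]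
    exact integral_nonneg fun ω => mul_self_nonneg _

/-- Cauchy-Schwarz for the two errors. -/
theorem ofReal_abs_cov_le (hs : 0 ≤ s) (a b : S → ℝ) :
    ENNReal.ofReal |M.mixedMoment N ℙ X s a b - pairing a (M.μ s) * pairing b (M.μ s)| ≤
      M.mse ℙ X s a ^ (1 / 2 : ℝ) * M.mse ℙ X s b ^ (1 / 2 : ℝ) := by
  rw [← (M.integral_error_mul_error hN hX hs a b).2, ← Real.norm_eq_abs, ofReal_norm]
  refine (enorm_integral_le_lintegral_enorm _).trans ?_
  simp only [enorm_mul]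
  have hm : ∀ a : S → ℝ, AEMeasurable (fun ω => ‖M.reweighted X s a ω - pairing a (M.μ s)‖ₑ) ℙ :=
    fun a => ((M.measurable_reweighted hX hs a).sub_const _).enorm.aemeasurable
  have h := ENNReal.lintegral_mul_le_Lp_mul_Lq ℙ
    (Real.holderConjugate_iff.2 ⟨one_lt_two, by norm_num⟩ : (2 : ℝ).HolderConjugate 2) (hm a) (hm b)
  refine h.trans (le_of_eq ?_)
  have e : ∀ a : S → ℝ, M.mse ℙ X s a =
      ∫⁻ ω, ‖M.reweighted X s a ω - pairing a (M.μ s)‖ₑ ^ (2 : ℝ) ∂ℙ := fun a => by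
    refine lintegral_congr fun ω => ?_
    rw [← ofReal_norm, Real.norm_eq_abs, ENNReal.rpow_ofNat,
      ENNReal.ofReal_pow (abs_nonneg _)]
  rw [e a, e b]

omit [MeasurableSpace S] [MeasurableSpace Ω] [DiscreteMeasurableSpace S] hN hX
  [IsProbabilityMeasure ℙ] in
theorem reweighted_const_mul (c : ℝ) (f : S → ℝ) (ω : Ω) :
    M.reweighted X s (fun x => c * f x) ω = c * M.reweighted X s f ω := by
  simp only [reweighted, empirical, ← Finset.mul_sum]; ring

omit [MeasurableSpace S] [DiscreteMeasurableSpace S] hN hX [IsProbabilityMeasure ℙ] in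
theorem mse_const_mul (c : ℝ) (f : S → ℝ) :
    M.mse ℙ X s (fun x => c * f x) = ENNReal.ofReal (c ^ 2) * M.mse ℙ X s f := by
  rw [mse, mse, ← lintegral_const_mul' _ _ ENNReal.ofReal_ne_top]
  refine lintegral_congr fun ω => ?_
  have hp : pairing (fun x => c * f x) (M.μ s) = c * pairing f (M.μ s) := by
    simp only [pairing, mul_assoc, ← Finset.mul_sum]
  rw [← ENNReal.ofReal_mul (sq_nonneg c), reweighted_const_mul, hp, ← mul_sub, abs_mul, mul_pow,
    sq_abs]

omit hN hX [IsProbabilityMeasure ℙ] in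
theorem mse_le (hs : s ∈ Icc 0 t) {p : ℝ≥0∞} (hp : p ≠ 0) (f : S → ℝ) :
    M.mse ℙ X s f ≤ M.eps ℙ X t p * M.normLp p s f ^ 2 := by
  rcases eq_or_ne (M.normLp p s f) 0 with h0 | h0
  · have e : M.mse ℙ X s f = 0 := by
      have := M.mse_const_mul (ℙ := ℙ) (X := X) (s := s) 0 (0 : S → ℝ)
      rw [M.normLp_eq_zero hs.1 hp h0]
      simp only [zero_mul, ne_eq, OfNat.ofNat_ne_zero, not_false_eq_true, zero_pow,
        ENNReal.ofReal_zero] at this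
      exact this
    rw [e]; exact zero_le
  have hfin := M.normLp_ne_top hs.1 p f
  set c : ℝ := (M.normLp p s f).toReal with hc
  have hc0 : 0 < c := ENNReal.toReal_pos h0 hfin
  have hcE : ENNReal.ofReal c = M.normLp p s f := ENNReal.ofReal_toReal hfin
  have e : f = fun x => c * (c⁻¹ * f x) := by funext x; field_simp
  have hle : M.mse ℙ X s (fun x => c⁻¹ * f x) ≤ M.eps ℙ X t p := by
    refine le_iSup₂_of_le (f := fun s _ => ⨆ (f : S → ℝ) (_ : M.normLp p s f ≤ 1),
      M.mse ℙ X s f) s hs (le_iSup₂_of_le (f := fun (f : S → ℝ) (_ : M.normLp p s f ≤ 1) =>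
      M.mse ℙ X s f) _ ?_ le_rfl)
    rw [M.normLp_const_mul, Real.enorm_eq_ofReal (inv_nonneg.2 hc0.le),
      ENNReal.ofReal_inv_of_pos hc0, hcE, ENNReal.inv_mul_cancel h0 hfin]
  calc M.mse ℙ X s f = ENNReal.ofReal (c ^ 2) * M.mse ℙ X s (fun x => c⁻¹ * f x) := by
        rw [← mse_const_mul, ← e]
    _ ≤ ENNReal.ofReal (c ^ 2) * M.eps ℙ X t p := by gcongr
    _ = _ := by rw [ENNReal.ofReal_pow hc0.le, hcE, mul_comm]

theorem ofReal_abs_cov_le_eps (hs : s ∈ Icc 0 t) {p : ℝ≥0∞} (hp : p ≠ 0) (a b : S → ℝ) :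
    ENNReal.ofReal |M.mixedMoment N ℙ X s a b - pairing a (M.μ s) * pairing b (M.μ s)| ≤
      M.eps ℙ X t p * (M.normLp p s a * M.normLp p s b) := by
  refine (M.ofReal_abs_cov_le hN hX hs.1 a b).trans ?_
  have h : ∀ a : S → ℝ, M.mse ℙ X s a ^ (1 / 2 : ℝ) ≤
      M.eps ℙ X t p ^ (1 / 2 : ℝ) * M.normLp p s a := fun a => by
    refine (ENNReal.rpow_le_rpow (M.mse_le hs hp a) (by norm_num)).trans (le_of_eq ?_)
    rw [ENNReal.mul_rpow_of_nonneg _ _ (by norm_num), ← ENNReal.rpow_ofNat, ← ENNReal.rpow_mul]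
    norm_num
  refine (mul_le_mul' (h a) (h b)).trans (le_of_eq ?_)
  rw [mul_mul_mul_comm, ← ENNReal.rpow_add_of_nonneg _ _ (by norm_num) (by norm_num)]
  norm_num

omit hN hX in
theorem RateBound.ofReal_abs_cov_le {M : EvolvingModel S} {N : ℕ} (hN : 0 < N)
    {X : ℝ → Ω → Fin N → S} (hX : M.IsParticleSystem N ℙ X) {τ : ℝ} (hs : s ∈ Icc 0 t)
    {p q : ℝ≥0∞} (hp : p ≠ 0) {f a b : S → ℝ} (h : M.RateBound s τ p q f a b) :
    ENNReal.ofReal |M.mixedMoment N ℙ X s a b - pairing a (M.μ s) * pairing b (M.μ s)| ≤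
      M.eps ℙ X t p * (M.rate s τ p q * M.normLp p τ f ^ 2) :=
  (M.ofReal_abs_cov_le_eps hN hX hs hp a b).trans (mul_le_mul' le_rfl h)

/-- Finiteness is what permits moving ε across an inequality later. On [0, t] the weights μ_s(x) are
bounded below, so the unit balls of L^p ⊆ L² are uniformly bounded, as are the Feynman-Kac weights.
-/
theorem eps_ne_top (ht : 0 ≤ t) {p : ℝ≥0∞} (hp : 2 ≤ p) : M.eps ℙ X t p ≠ ∞ := by
  obtain ⟨K, F⟩ := M.exists_fkSetting hX 2 ht
  choose R hR using fun x => isCompact_Icc.exists_bound_of_continuousOn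
    ((M.μ_continuousOn_Icc (t := t) x).inv₀ fun s hs => (M.μ_pos hs.1 x).ne')
  have hle : M.eps ℙ X t p ≤ ENNReal.ofReal (Real.exp (K * t) * ∑ x, |R x|) := by
    refine iSup₂_le fun s hs => iSup₂_le fun f hf => ?_
    rw [(M.mse_eq hN hX hs.1 f).1]
    refine ENNReal.ofReal_le_ofReal ((sub_le_self _ (sq_nonneg _)).trans ?_)
    have hfx : ∀ x, f x ^ 2 ≤ |R x| := by
      intro x
      have hμ := M.μ_pos hs.1 x
      have h1 : f x ^ 2 * M.μ s x ≤ 1 := by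
        have h2 := M.pairing_sq_le hs.1 hp f
        have h3 : (M.normLp p s f).toReal ≤ 1 := ENNReal.toReal_le_of_le_ofReal zero_le_one
          (by simpa using hf)
        have h4 : (M.normLp p s f).toReal ^ 2 ≤ 1 := pow_le_one₀ ENNReal.toReal_nonneg h3
        exact (Finset.single_le_sum (f := fun x => f x ^ 2 * M.μ s x)
          (fun y _ => mul_nonneg (sq_nonneg _) (M.μ_pos hs.1 y).le) (Finset.mem_univ x)).trans
          (h2.trans h4)
      have h5 : f x ^ 2 ≤ (M.μ s x)⁻¹ := by
        rw [← one_div, le_div_iff₀ hμ]; exact h1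
      exact h5.trans ((le_abs_self _).trans ((hR x s hs).trans (le_abs_self _)))
    have havg : ∀ x : Fin N → S, avg f x * avg f x ≤ ∑ x, |R x| := by
      intro x
      have hpt : ∀ y z : S, f y * f z ≤ ∑ x, |R x| := fun y z => by
        have hy := (hfx y).trans (Finset.single_le_sum (f := fun x => |R x|)
          (fun _ _ => abs_nonneg _) (Finset.mem_univ y))
        have hz := (hfx z).trans (Finset.single_le_sum (f := fun x => |R x|)
          (fun _ _ => abs_nonneg _) (Finset.mem_univ z))
        nlinarith [sq_nonneg (f y - f z)]
      rw [avg_mul_avg]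
      refine (avg₂_mono hpt x).trans (le_of_eq ?_)
      rw [← avg_eq_avg₂_left hN fun _ => ∑ x, |R x|]
      have := avg_const_mul (∑ x, |R x|) (fun _ : S => 1) x
      rw [avg_one hN, mul_one] at this
      simpa using this
    have hR0 : 0 ≤ ∑ x, |R x| := Finset.sum_nonneg fun _ _ => abs_nonneg _
    calc M.mixedMoment N ℙ X s f f
        ≤ ∫ _ω, Real.exp (K * t) * ∑ x, |R x| ∂ℙ :=
          integral_mono (F.integrable_weight_mul hs hs.1 fun x => avg f x * avg f x)
            (integrable_const _) fun ω =>
            mul_le_mul (F.weight_le hs ω) (havg _) (mul_self_nonneg _) (Real.exp_pos _).le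
      _ = _ := by simp
  exact ne_top_of_le_ne_top ENNReal.ofReal_ne_top hle

end Covariance

end EvolvingModel

end SeqMC

/-! ### Two estimates of the drift: by the oscillation, and by covariances. -/

namespace SeqMC

/-- Follows from 16/17 ≤ e^{−1/17}. It is the source of every factor 17/16 below. -/
theorem exp_le_of_le_inv_seventeen {x : ℝ} (hx : x ≤ 1 / 17) : Real.exp x ≤ 17 / 16 := by
  have h1 := Real.add_one_le_exp (-(1 / 17) : ℝ)
  have h2 : Real.exp (1 / 17 : ℝ) * Real.exp (-(1 / 17) : ℝ) = 1 := by
    rw [← Real.exp_add]; simp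
  have h3 : Real.exp x ≤ Real.exp (1 / 17) := Real.exp_le_exp.2 hx
  nlinarith [Real.exp_pos (1 / 17 : ℝ)]

/-- Integrating a pointwise bound by a possibly non-measurable rate. -/
theorem ofReal_integral_le_mul_lintegral {D : ℝ → ℝ} {k : ℝ → ℝ≥0∞} {c : ℝ≥0∞} {a : ℝ}
    (ha : 0 ≤ a) (hD : ContinuousOn D (Icc 0 a)) (hc : c ≠ ∞)
    (h : ∀ s ∈ Ioc 0 a, ENNReal.ofReal (D s) ≤ c * k s) :
    ENNReal.ofReal (∫ s in (0 : ℝ)..a, D s) ≤ c * ∫⁻ s in Ioc 0 a, k s := by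
  have hint : IntegrableOn D (Ioc 0 a) := hD.integrableOn_Icc.mono_set Ioc_subset_Icc_self
  -- Finiteness of the constant lets it move inside the lower integral without measurability of the
  -- rate.
  rw [intervalIntegral.integral_of_le ha, ← lintegral_const_mul' _ _ hc]
  calc ENNReal.ofReal (∫ s in Ioc 0 a, D s)
      ≤ ENNReal.ofReal (∫ s in Ioc 0 a, max (D s) 0) :=
        ENNReal.ofReal_le_ofReal (integral_mono hint hint.pos_part fun _ => le_max_left _ _)
    _ = ∫⁻ s in Ioc 0 a, ENNReal.ofReal (max (D s) 0) :=
        ofReal_integral_eq_lintegral_ofReal hint.pos_part (.of_forall fun _ => le_max_right _ _)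
    _ ≤ _ := setLIntegral_mono' measurableSet_Ioc fun s hs => by
        rw [ENNReal.ofReal_max, ENNReal.ofReal_zero, max_eq_left zero_le]
        exact h s hs

theorem abs_le_toReal {x : ℝ} {X : ℝ≥0∞} (hX : X ≠ ∞) (h : ENNReal.ofReal |x| ≤ X) :
    |x| ≤ X.toReal := (ENNReal.ofReal_le_iff_le_toReal hX).1 h

namespace EvolvingModel

section Estimates

variable {S : Type*} [Fintype S] [MeasurableSpace S] [DiscreteMeasurableSpace S]
  (M : EvolvingModel S) {N : ℕ} {Ω : Type*} [MeasurableSpace Ω] {ℙ : Measure Ω}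
  [IsProbabilityMeasure ℙ] {X : ℝ → Ω → Fin N → S} {s τ t t₀ : ℝ}

-- The 3 is 2 + 1: (g z − g y)² is at most twice, and |g z² − g y²| at most once, the sum g y² + g
-- z².
omit [MeasurableSpace S] [DiscreteMeasurableSpace S] in
theorem driftKernel_le (hs : s ∈ Icc 0 t₀) (g : S → ℝ) (y z : S) :
    M.driftKernel s g y z ≤ 3 / 2 * M.omega t₀ * (g y ^ 2) + 3 / 2 * M.omega t₀ * (g z ^ 2) := by
  have h1 := M.abs_H_sub_le_omega hs y z
  have h2 : (M.H s y - M.H s z) * (g z ^ 2 - g y ^ 2) ≤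
      |M.H s y - M.H s z| * |g z ^ 2 - g y ^ 2| := by
    rw [← abs_mul]; exact le_abs_self _
  have h3 : (g z - g y) ^ 2 + |g z ^ 2 - g y ^ 2| ≤ 3 * (g y ^ 2 + g z ^ 2) := by
    rcases abs_cases (g z ^ 2 - g y ^ 2) with h | h <;> rw [h.1] <;>
      nlinarith [sq_nonneg (g y + g z), sq_nonneg (g y), sq_nonneg (g z)]
  have h4 : |M.H s y - M.H s z| * ((g z - g y) ^ 2 + |g z ^ 2 - g y ^ 2|) ≤
      M.omega t₀ * (3 * (g y ^ 2 + g z ^ 2)) :=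
    mul_le_mul h1 h3 (by positivity) ((abs_nonneg _).trans h1)
  unfold driftKernel
  linarith

theorem feynmanKac_driftKernel_le (hN : 0 < N) (hX : M.IsParticleSystem N ℙ X)
    (hs : s ∈ Icc 0 t₀) (g : S → ℝ) :
    feynmanKac (M.potential N 2) ℙ X s (avg₂ (M.driftKernel s g)) ≤
      3 * M.omega t₀ * feynmanKac (M.potential N 2) ℙ X s (avg fun y => g y ^ 2) := by
  obtain ⟨K, F⟩ := M.exists_fkSetting hX 2 hs.1
  rw [← FKSetting.feynmanKac_const_mul]
  refine F.feynmanKac_mono ⟨hs.1, le_rfl⟩ fun x => (avg₂_mono (M.driftKernel_le hs g) x).trans ?_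
  rw [avg₂_add, avg₂_const_mul, avg₂_const_mul, ← avg_eq_avg₂_left hN fun y => g y ^ 2,
    ← avg_eq_avg₂_right hN fun y => g y ^ 2]
  linarith

omit [MeasurableSpace S] [DiscreteMeasurableSpace S] [IsProbabilityMeasure ℙ] in
theorem feynmanKac_avg_sq_nonneg (g : S → ℝ) :
    0 ≤ feynmanKac (M.potential N 2) ℙ X s (avg fun y => g y ^ 2) :=
  integral_nonneg fun ω => mul_nonneg (Real.exp_pos _).le
    (mul_nonneg (by positivity) (Finset.sum_nonneg fun _ _ => sq_nonneg _))

/-- The derivative in s is a nonnegative carré du champ plus the empirical covariance of H and g²,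
which is at least −ω⟨g²⟩ because the oscillation of H is at most ω. -/
theorem feynmanKac_avg_q_sq_le (hN : 0 < N) (hX : M.IsParticleSystem N ℙ X)
    (hτ : τ ∈ Icc 0 t₀) (f : S → ℝ) (hs : s ∈ Icc 0 τ) :
    feynmanKac (M.potential N 2) ℙ X s (avg fun y => M.q s τ f y ^ 2) ≤
      Real.exp (M.omega t₀ * (τ - s)) *
        feynmanKac (M.potential N 2) ℙ X τ (avg fun y => f y ^ 2) := by
  rcases hτ.1.eq_or_lt with rfl | hτ0
  · obtain rfl : s = 0 := le_antisymm hs.2 hs.1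
    simp [M.q_self le_rfl]
  have h := le_exp_mul_of_neg_mul_le_deriv (c := M.omega t₀)
    (fun r hr => M.hasDerivWithinAt_feynmanKac_avg_q_sq hN hX hτ0 f hr) (fun r hr => ?_) hs
  · simpa only [M.q_self hτ.1] using h
  · obtain ⟨K, F⟩ := M.exists_fkSetting hX 2 hr.1
    rw [← FKSetting.feynmanKac_const_mul]
    refine F.feynmanKac_mono ⟨hr.1, le_rfl⟩ fun x => ?_
    have h1 : 0 ≤ M.lam r * avg (M.carre r (M.q r τ f)) x :=
      mul_nonneg (M.lam_nonneg r hr.1) (mul_nonneg (by positivity)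
        (Finset.sum_nonneg fun i _ => M.carre_nonneg hr.1 _ _))
    have h2 : avg₂ (fun y z => -M.omega t₀ * M.q r τ f y ^ 2 + M.H r z * M.q r τ f y ^ 2) x ≤
        avg₂ (fun y _ => M.H r y * M.q r τ f y ^ 2) x := avg₂_mono (fun y z => by
      have := M.H_sub_le_omega ⟨hr.1, hr.2.trans hτ.2⟩ z y
      nlinarith [sq_nonneg (M.q r τ f y)]) x
    rw [avg₂_add, avg₂_const_mul, ← avg_eq_avg₂_left hN fun y => M.q r τ f y ^ 2,
      ← avg_eq_avg₂_left hN fun y => M.H r y * M.q r τ f y ^ 2,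
      ← avg₂_swap, ← avg_mul_avg (M.H r) fun y => M.q r τ f y ^ 2] at h2
    linarith

/-- The bound for the integrated drift by mixed moments. -/
theorem feynmanKac_driftKernel_le_mixedMoment (hN : 0 < N) (hX : M.IsParticleSystem N ℙ X)
    (hs : 0 ≤ s) (g : S → ℝ) :
    feynmanKac (M.potential N 2) ℙ X s (avg₂ (M.driftKernel s g)) ≤
      M.mixedMoment N ℙ X s (fun x => |M.H s x|) (fun x => g x ^ 2) +
      -2 * M.mixedMoment N ℙ X s (fun x => |M.H s x| * g x) g +
      M.mixedMoment N ℙ X s (fun _ => 1) (fun x => |M.H s x| * g x ^ 2) +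
      M.mixedMoment N ℙ X s (M.H s) (fun x => g x ^ 2) +
      -1 * M.mixedMoment N ℙ X s (fun _ => 1) (fun x => M.H s x * g x ^ 2) := by
  obtain ⟨K, F⟩ := M.exists_fkSetting hX 2 hs
  have hsT : s ∈ Icc 0 s := ⟨hs, le_rfl⟩
  simp only [mixedMoment]
  rw [← FKSetting.feynmanKac_const_mul, ← FKSetting.feynmanKac_const_mul,
    ← F.feynmanKac_add hsT, ← F.feynmanKac_add hsT, ← F.feynmanKac_add hsT,
    ← F.feynmanKac_add hsT]
  refine F.feynmanKac_mono hsT fun x => ?_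
  have h0 : avg₂ (M.driftKernel s g) x =
      avg₂ (fun y z => 1 / 2 * (|M.H s y - M.H s z| * (g z - g y) ^ 2)) x +
      (avg (M.H s) x * avg (fun y => g y ^ 2) x - avg (fun y => M.H s y * g y ^ 2) x) := by
    rw [← M.avg₂_antisymm hN, ← avg₂_add]; rfl
  -- The triangle inequality for |H y − H z| is the only loss; the two resulting halves agree after
  -- exchanging y and z.
  have h1 : avg₂ (fun y z => 1 / 2 * (|M.H s y - M.H s z| * (g z - g y) ^ 2)) x ≤
      avg₂ (fun y z => 1 / 2 * (|M.H s y| * (g z - g y) ^ 2) +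
        1 / 2 * (|M.H s z| * (g y - g z) ^ 2)) x := avg₂_mono (fun y z => by
    have := abs_sub (M.H s y) (M.H s z)
    nlinarith [sq_nonneg (g z - g y)]) x
  have h2 : avg₂ (fun y z => |M.H s y| * (g z - g y) ^ 2) x =
      avg (fun x => |M.H s x|) x * avg (fun x => g x ^ 2) x +
      -2 * (avg (fun x => |M.H s x| * g x) x * avg g x) +
      avg (fun x => |M.H s x| * g x ^ 2) x := by
    rw [avg_mul_avg, avg_mul_avg, avg_eq_avg₂_left hN, ← avg₂_const_mul, ← avg₂_add, ← avg₂_add]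
    congr 1
    funext y z
    ring
  simp only [avg₂_add, avg₂_const_mul] at h0 h1
  rw [avg₂_swap fun y z => |M.H s y| * (g z - g y) ^ 2, h2] at h1
  rw [avg_one hN, h0]
  linarith

-- Expanding the square puts V in the form of the bounding mixed moments, with each moment replaced
-- by a product of means.
omit [MeasurableSpace S] [DiscreteMeasurableSpace S] in
theorem V_eq_pairing (hs : 0 ≤ s) (f : S → ℝ) :
    M.V s τ f =
      pairing (fun x => |M.H s x|) (M.μ s) * pairing (fun x => M.q s τ f x ^ 2) (M.μ s) +
      -2 * (pairing (fun x => |M.H s x| * M.q s τ f x) (M.μ s) * pairing (M.q s τ f) (M.μ s)) +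
      pairing (fun _ => 1) (M.μ s) * pairing (fun x => |M.H s x| * M.q s τ f x ^ 2) (M.μ s) +
      -1 * (pairing (fun _ => 1) (M.μ s) *
        pairing (fun x => M.H s x * M.q s τ f x ^ 2) (M.μ s)) := by
  rw [M.pairing_const hs]
  have h1 : ∀ a b : S → ℝ, pairing a (M.μ s) * pairing b (M.μ s) =
      ∑ x, ∑ y, a x * b y * (M.μ s x * M.μ s y) := fun a b => by
    simp only [pairing, Finset.sum_mul_sum]
    exact Finset.sum_congr rfl fun x _ => Finset.sum_congr rfl fun y _ => by ring
  have h2 : ∀ a : S → ℝ, pairing a (M.μ s) = ∑ x, ∑ y, a x * (M.μ s x * M.μ s y) := fun a => by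
    have := h1 a fun _ => 1
    rw [M.pairing_const hs, mul_one] at this
    simpa using this
  rw [V, h1, h1, one_mul, one_mul, h2 fun x => |M.H s x| * M.q s τ f x ^ 2]
  have h3 : ∑ x, ∑ y, |M.H s x| * (M.q s τ f y - M.q s τ f x) ^ 2 * M.μ s x * M.μ s y =
      ∑ x, ∑ y, |M.H s x| * M.q s τ f y ^ 2 * (M.μ s x * M.μ s y) +
      -2 * (∑ x, ∑ y, |M.H s x| * M.q s τ f x * M.q s τ f y * (M.μ s x * M.μ s y)) +
      ∑ x, ∑ y, |M.H s x| * M.q s τ f x ^ 2 * (M.μ s x * M.μ s y) := by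
    simp only [Finset.mul_sum, ← Finset.sum_add_distrib]
    exact Finset.sum_congr rfl fun x _ => Finset.sum_congr rfl fun y _ => by ring
  rw [h3]
  ring

variable {p q : ℝ≥0∞}

/-- The 5 adds up the absolute coefficients 1, 2, 1, 1 of the four products of means in V. -/
theorem ofReal_V_le (hp : 2 ≤ p) (hpq : p ≤ q) (hτ : 0 ≤ τ) (hs : s ∈ Icc 0 τ) (f : S → ℝ) :
    ENNReal.ofReal (M.V s τ f) ≤ 5 * M.normLp p τ f ^ 2 * M.rate s τ p q := by
  have hp1 : 1 ≤ p := one_le_two.trans hp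
  set Y := M.rate s τ p q * M.normLp p τ f ^ 2 with hY
  have hk : M.normLp q s (fun x => |M.H s x|) = M.normLp q s (M.H s) := M.normLp_abs q _
  have b1 := (M.rateBound_sq hp hpq hτ hs f hk).ofReal_abs_pairing_mul_le hp1 hs.1
  have b2 := (M.rateBound_mul hp hpq hτ hs f hk).ofReal_abs_pairing_mul_le hp1 hs.1
  have b3 := (M.rateBound_one_mul_sq hp hpq hτ hs f hk).ofReal_abs_pairing_mul_le hp1 hs.1
  have b4 := (M.rateBound_one_mul_sq hp hpq hτ hs f rfl).ofReal_abs_pairing_mul_le hp1 hs.1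
  have e : 5 * M.normLp p τ f ^ 2 * M.rate s τ p q = 5 * Y := by rw [hY]; ring
  rw [e]
  rcases eq_or_ne Y ∞ with hT | hT
  · rw [hT]; simp
  have c1 := abs_le.1 (abs_le_toReal hT b1)
  have c2 := abs_le.1 (abs_le_toReal hT b2)
  have c3 := abs_le.1 (abs_le_toReal hT b3)
  have c4 := abs_le.1 (abs_le_toReal hT b4)
  rw [ENNReal.ofReal_le_iff_le_toReal (ENNReal.mul_ne_top ENNReal.ofNat_ne_top hT),
    ENNReal.toReal_mul, ENNReal.toReal_ofNat, M.V_eq_pairing hs.1]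
  linarith [c1.2, c2.1, c3.2, c4.1]

/-- The 6 adds up the absolute coefficients 1, 2, 1, 1, 1 of the five mixed moments, each compared
with its product of means. -/
theorem ofReal_drift_sub_V_le (hN : 0 < N) (hX : M.IsParticleSystem N ℙ X) (hp : 2 ≤ p)
    (hpq : p ≤ q) (hτ : τ ∈ Icc 0 t) (hs : s ∈ Icc 0 τ) (f : S → ℝ) :
    ENNReal.ofReal (feynmanKac (M.potential N 2) ℙ X s (avg₂ (M.driftKernel s (M.q s τ f))) -
      M.V s τ f) ≤ 6 * M.eps ℙ X t p * M.normLp p τ f ^ 2 * M.rate s τ p q := by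
  have hp0 : p ≠ 0 := (two_pos.trans_le hp).ne'
  have hst : s ∈ Icc 0 t := ⟨hs.1, hs.2.trans hτ.2⟩
  set Y := M.eps ℙ X t p * (M.rate s τ p q * M.normLp p τ f ^ 2) with hY
  have hk : M.normLp q s (fun x => |M.H s x|) = M.normLp q s (M.H s) := M.normLp_abs q _
  have b1 := (M.rateBound_sq hp hpq hτ.1 hs f hk).ofReal_abs_cov_le hN hX hst hp0
  have b2 := (M.rateBound_mul hp hpq hτ.1 hs f hk).ofReal_abs_cov_le hN hX hst hp0
  have b3 := (M.rateBound_one_mul_sq hp hpq hτ.1 hs f hk).ofReal_abs_cov_le hN hX hst hp0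
  have b4 := (M.rateBound_sq hp hpq hτ.1 hs f rfl).ofReal_abs_cov_le hN hX hst hp0
  have b5 := (M.rateBound_one_mul_sq hp hpq hτ.1 hs f rfl).ofReal_abs_cov_le hN hX hst hp0
  have e : 6 * M.eps ℙ X t p * M.normLp p τ f ^ 2 * M.rate s τ p q = 6 * Y := by rw [hY]; ring
  rw [e]
  rcases eq_or_ne Y ∞ with hT | hT
  · rw [hT]; simp
  have c1 := abs_le.1 (abs_le_toReal hT b1)
  have c2 := abs_le.1 (abs_le_toReal hT b2)
  have c3 := abs_le.1 (abs_le_toReal hT b3)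
  have c4 := abs_le.1 (abs_le_toReal hT b4)
  have c5 := abs_le.1 (abs_le_toReal hT b5)
  have h := M.feynmanKac_driftKernel_le_mixedMoment hN hX hs.1 (M.q s τ f)
  -- The moment E[ν(H)ν(g²)] has no counterpart in V, since its product of means is zero.
  have hH := M.pairing_H hs.1
  rw [hH, zero_mul] at c4
  rw [ENNReal.ofReal_le_iff_le_toReal (ENNReal.mul_ne_top ENNReal.ofNat_ne_top hT),
    ENNReal.toReal_mul, ENNReal.toReal_ofNat, M.V_eq_pairing hs.1]
  linarith [c1.2, c2.1, c3.2, c4.2, c5.1]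

omit [DiscreteMeasurableSpace S] in
theorem lintegral_rate_le {δ : ℝ} (hτ : τ ∈ Icc 0 t) :
    ∫⁻ s in Ioc 0 (max (τ - δ) 0), M.rate s τ p q ≤ M.Cbar t p q δ :=
  le_iSup₂_of_le (f := fun τ _ => ∫⁻ s in Ioc 0 (max (τ - δ) 0),
    M.normLp q s (M.H s) * M.C s τ p q ^ 2) τ hτ le_rfl

omit [DiscreteMeasurableSpace S] in
theorem integral_le_toReal_Cbar {δ : ℝ} (hτ : τ ∈ Icc 0 t) (hC : M.Cbar t p q δ ≠ ∞) {D : ℝ → ℝ}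
    (hD : ContinuousOn D (Icc 0 (max (τ - δ) 0))) {c : ℝ≥0∞} (hc : c ≠ ∞)
    (h : ∀ s ∈ Ioc 0 (max (τ - δ) 0), ENNReal.ofReal (D s) ≤ c * M.rate s τ p q) :
    ∫ s in (0 : ℝ)..max (τ - δ) 0, D s ≤ c.toReal * (M.Cbar t p q δ).toReal := by
  rw [← ENNReal.toReal_mul, ← ENNReal.ofReal_le_iff_le_toReal (ENNReal.mul_ne_top hc hC)]
  exact (ofReal_integral_le_mul_lintegral (le_max_right _ _) hD hc h).trans
    (mul_le_mul' le_rfl (M.lintegral_rate_le hτ))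

/-! ### Combining the two estimates across the cutoff time τ − δ. -/

section MainBounds

variable {δ : ℝ} (hN : 0 < N) (hX : M.IsParticleSystem N ℙ X) (hp : 2 ≤ p) (hpq : p ≤ q)
  (hδ : 0 ≤ δ) (hωδ : M.omega t₀ * δ ≤ 1 / 17) (ht : t ∈ Icc 0 t₀) (hτ : τ ∈ Icc 0 t)
  (hC : M.Cbar t p q δ ≠ ∞) (f : S → ℝ)

omit [MeasurableSpace S] [DiscreteMeasurableSpace S] in
theorem cutoff_mem (hδ : 0 ≤ δ) (hωδ : M.omega t₀ * δ ≤ 1 / 17) (ht : t ∈ Icc 0 t₀)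
    (hτ : τ ∈ Icc 0 t) : max (τ - δ) 0 ∈ Icc 0 τ ∧
      ∀ s ∈ Icc (max (τ - δ) 0) τ, M.omega t₀ * (τ - s) ≤ 1 / 17 := by
  refine ⟨⟨le_max_right _ _, max_le (by linarith) hτ.1⟩, fun s hs => le_trans ?_ hωδ⟩
  have := (le_max_left (τ - δ) 0).trans hs.1
  exact mul_le_mul_of_nonneg_left (by linarith) (M.omega_nonneg (ht.1.trans ht.2))

include hδ hωδ ht hτ

include hp hpq hC in
theorem integral_V_le : ∫ s in (0 : ℝ)..max (τ - δ) 0, M.V s τ f ≤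
    5 * (M.normLp p τ f).toReal ^ 2 * (M.Cbar t p q δ).toReal := by
  obtain ⟨hmem, -⟩ := M.cutoff_mem hδ hωδ ht hτ
  have hfin := ENNReal.pow_ne_top (n := 2) (M.normLp_ne_top hτ.1 p f)
  have h := M.integral_le_toReal_Cbar hτ hC
    ((M.V_continuousOn hτ.1 f).mono (Icc_subset_Icc_right hmem.2))
    (ENNReal.mul_ne_top (a := 5) ENNReal.ofNat_ne_top hfin)
    fun s hs => M.ofReal_V_le hp hpq hτ.1 ⟨hs.1.le, hs.2.trans hmem.2⟩ f
  rwa [ENNReal.toReal_mul, ENNReal.toReal_ofNat, ENNReal.toReal_pow] at h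

-- V may be negative after the cutoff. There −V ≤ ω(17/16)⟨f²,μ_τ⟩, and ω times the length is at
-- most 1/17, so completing the integral costs 1/16.
omit [MeasurableSpace S] [DiscreteMeasurableSpace S] in
theorem integral_V_add : ∫ s in (0 : ℝ)..max (τ - δ) 0, M.V s τ f ≤
    (∫ s in (0 : ℝ)..τ, M.V s τ f) + 1 / 16 * pairing (fun x => f x ^ 2) (M.μ τ) := by
  obtain ⟨hmem, hexp⟩ := M.cutoff_mem hδ hωδ ht hτ
  have hτ0 : τ ∈ Icc 0 t₀ := ⟨hτ.1, hτ.2.trans ht.2⟩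
  have hω := M.omega_nonneg (ht.1.trans ht.2)
  set a := max (τ - δ) 0 with ha
  set m := pairing (fun x => f x ^ 2) (M.μ τ) with hm
  have hm0 : 0 ≤ m := Finset.sum_nonneg fun x _ => mul_nonneg (sq_nonneg _) (M.μ_pos hτ.1 x).le
  have hcont := M.V_continuousOn hτ.1 f
  have i1 : IntervalIntegrable (fun s => M.V s τ f) volume 0 a :=
    (hcont.mono (by rw [uIcc_of_le hmem.1]; exact Icc_subset_Icc_right hmem.2)).intervalIntegrable
  have i2 : IntervalIntegrable (fun s => M.V s τ f) volume a τ :=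
    (hcont.mono (by rw [uIcc_of_le hmem.2]; exact Icc_subset_Icc_left hmem.1)).intervalIntegrable
  rw [← intervalIntegral.integral_add_adjacent_intervals i1 i2]
  have hb : ∫ _s in a..τ, -(M.omega t₀ * (17 / 16 * m)) ≤ ∫ s in a..τ, M.V s τ f := by
    refine intervalIntegral.integral_mono_on hmem.2 intervalIntegrable_const i2 fun s hs => ?_
    have hs0 : s ∈ Icc 0 τ := ⟨hmem.1.trans hs.1, hs.2⟩
    have h1 := M.neg_V_le hτ0.2 f hs0
    have h2 := M.pairing_q_sq_le hτ0 f hs0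
    have h3 := exp_le_of_le_inv_seventeen (hexp s hs)
    have h4 := mul_le_mul_of_nonneg_left (h2.trans (mul_le_mul_of_nonneg_right h3 hm0)) hω
    linarith
  rw [intervalIntegral.integral_const, smul_eq_mul] at hb
  have h5 := mul_le_mul_of_nonneg_right (hexp a ⟨le_rfl, hmem.2⟩) hm0
  linarith

include hN hX in
/-- The second moment identity, with the drift on the last interval absorbed. -/
theorem mixedMoment_sub_le (hp : 2 ≤ p) (hpq : p ≤ q) (hC : M.Cbar t p q δ ≠ ∞) :
    N * (M.mixedMoment N ℙ X τ f f - pairing f (M.μ τ) ^ 2) ≤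
      19 / 16 * feynmanKac (M.potential N 2) ℙ X τ (avg fun y => f y ^ 2) -
      pairing f (M.μ τ) ^ 2 + (∫ s in (0 : ℝ)..max (τ - δ) 0, M.V s τ f) +
      6 * (M.eps ℙ X t p).toReal * (M.normLp p τ f).toReal ^ 2 * (M.Cbar t p q δ).toReal := by
  obtain ⟨hmem, hexp⟩ := M.cutoff_mem hδ hωδ ht hτ
  have hτ0 : τ ∈ Icc 0 t₀ := ⟨hτ.1, hτ.2.trans ht.2⟩
  have hω := M.omega_nonneg (ht.1.trans ht.2)
  have hA := M.feynmanKac_avg_sq_nonneg (N := N) (ℙ := ℙ) (X := X) (s := τ) f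
  have hid := M.feynmanKac_two_avg_sq hN hX hτ.1 f
  have heps := M.eps_ne_top hN hX ht.1 hp
  have hfin := ENNReal.pow_ne_top (n := 2) (M.normLp_ne_top hτ.1 p f)
  have hcont := M.continuousOn_feynmanKac_driftKernel hX hτ.1 f
  have hcV := M.V_continuousOn hτ.1 f
  have hh := M.integral_le_toReal_Cbar hτ hC
    ((hcont.sub hcV).mono (Icc_subset_Icc_right hmem.2))
    (ENNReal.mul_ne_top (ENNReal.mul_ne_top (a := 6) ENNReal.ofNat_ne_top heps) hfin)
    fun s hs => M.ofReal_drift_sub_V_le hN hX hp hpq hτ ⟨hs.1.le, hs.2.trans hmem.2⟩ f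
  set a := max (τ - δ) 0 with ha
  set A := feynmanKac (M.potential N 2) ℙ X τ (avg fun y => f y ^ 2) with hAdef
  set R : ℝ → ℝ := fun s =>
    feynmanKac (M.potential N 2) ℙ X s (avg₂ (M.driftKernel s (M.q s τ f))) with hR
  have s1 : uIcc 0 a ⊆ Icc 0 τ := by rw [uIcc_of_le hmem.1]; exact Icc_subset_Icc_right hmem.2
  have s2 : uIcc a τ ⊆ Icc 0 τ := by rw [uIcc_of_le hmem.2]; exact Icc_subset_Icc_left hmem.1
  have i1 : IntervalIntegrable R volume 0 a := (hcont.mono s1).intervalIntegrable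
  have i2 : IntervalIntegrable R volume a τ := (hcont.mono s2).intervalIntegrable
  have i3 : IntervalIntegrable (fun s => M.V s τ f) volume 0 a :=
    (hcV.mono s1).intervalIntegrable
  rw [← intervalIntegral.integral_add_adjacent_intervals i1 i2] at hid
  -- After the cutoff the drift is at most 3ω(17/16)A, so its integral is at most (3/16)A; together
  -- with the A already present this gives 19/16.
  have hb : ∫ s in a..τ, R s ≤ ∫ _s in a..τ, 3 * M.omega t₀ * (17 / 16 * A) := by
    refine intervalIntegral.integral_mono_on hmem.2 i2 intervalIntegrable_const fun s hs => ?_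
    have hs0 : s ∈ Icc 0 τ := ⟨hmem.1.trans hs.1, hs.2⟩
    refine (M.feynmanKac_driftKernel_le hN hX ⟨hs0.1, hs0.2.trans hτ0.2⟩ _).trans ?_
    refine mul_le_mul_of_nonneg_left ((M.feynmanKac_avg_q_sq_le hN hX hτ0 f hs0).trans ?_)
      (by positivity)
    exact mul_le_mul_of_nonneg_right (exp_le_of_le_inv_seventeen (hexp s hs)) hA
  rw [intervalIntegral.integral_const, smul_eq_mul] at hb
  have h5 := mul_le_mul_of_nonneg_right (hexp a ⟨le_rfl, hmem.2⟩) hA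
  simp only [Pi.sub_apply] at hh
  rw [intervalIntegral.integral_sub i1 i3] at hh
  simp only [ENNReal.toReal_mul, ENNReal.toReal_ofNat, ENNReal.toReal_pow] at hh
  have e : M.mixedMoment N ℙ X τ f f =
      feynmanKac (M.potential N 2) ℙ X τ (fun x => avg f x ^ 2) := by
    simp only [mixedMoment, sq]
  rw [e]
  linarith

include hN hX in
/-- The a priori bound for `E[ν_τ(1) ν_τ(f²)]`. -/
theorem feynmanKac_avg_sq_le (hp : 2 ≤ p) (hpq : p ≤ q) (hC : M.Cbar t p q δ ≠ ∞) :
    feynmanKac (M.potential N 2) ℙ X τ (avg fun y => f y ^ 2) ≤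
      17 / 16 * (pairing (fun x => f x ^ 2) (M.μ τ) +
        (M.eps ℙ X t p).toReal * (M.normLp p τ f).toReal ^ 2 * (M.Cbar t p q δ).toReal) := by
  obtain ⟨hmem, hexp⟩ := M.cutoff_mem hδ hωδ ht hτ
  have hp0 : p ≠ 0 := (two_pos.trans_le hp).ne'
  have hτ0 : τ ∈ Icc 0 t₀ := ⟨hτ.1, hτ.2.trans ht.2⟩
  have heps := M.eps_ne_top hN hX ht.1 hp
  have hfin := ENNReal.pow_ne_top (n := 2) (M.normLp_ne_top hτ.1 p f)
  have herr : 0 ≤ (M.eps ℙ X t p).toReal * (M.normLp p τ f).toReal ^ 2 *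
      (M.Cbar t p q δ).toReal := by positivity
  have hm0 : 0 ≤ pairing (fun x => f x ^ 2) (M.μ τ) :=
    Finset.sum_nonneg fun x _ => mul_nonneg (sq_nonneg _) (M.μ_pos hτ.1 x).le
  obtain ⟨K, F⟩ := M.exists_fkSetting hX 2 hτ.1
  rcases hτ.1.eq_or_lt with h0 | h0
  · subst h0
    rw [M.feynmanKac_zero_avg hN hX]
    linarith
  set a := max (τ - δ) 0 with ha
  -- Propagating f² linearly, instead of squaring q f, avoids the carré du champ in the derivative;
  -- its sign would permit only a lower bound on the growth.
  set h : ℝ → S → ℝ := fun s => M.q s τ fun x => f x ^ 2 with hh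
  have hh0 : ∀ s ∈ Icc 0 τ, ∀ x, 0 ≤ h s x := fun s hs x =>
    M.q_nonneg hτ.1 (fun x => sq_nonneg (f x)) hs x
  set G : ℝ → ℝ := fun s => feynmanKac (M.potential N 2) ℙ X s (avg (h s)) with hG
  set G' : ℝ → ℝ := fun s => feynmanKac (M.potential N 2) ℙ X s
    (fun x => -1 * (avg (M.H s) x * avg (h s) x)) with hG'
  have hd : ∀ s ∈ Icc 0 τ, HasDerivWithinAt G (G' s) (Icc 0 τ) s := fun s hs =>
    M.hasDerivWithinAt_feynmanKac_avg_q hN hX h0 _ hs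
  have hGc : ContinuousOn G' (Icc 0 τ) := by
    refine F.continuousOn_feynmanKac_of_continuousOn le_rfl fun x => ?_
    have h1 := fun x => M.H_continuousOn_Icc (t := τ) x
    have h2 := M.q_continuousOn hτ.1 fun x => f x ^ 2
    simp only [avg, hh]
    fun_prop
  -- After the cutoff, positivity of h and |H| ≤ ω give G' ≤ ωG.
  have step1 : G τ ≤ 17 / 16 * G a := by
    have hk := le_exp_mul_of_neg_mul_le_deriv (f := fun s => -G s) (f' := fun s => -G' s)
      (a := a) (b := τ) (c := -M.omega t₀)
      (fun s hs => ((hd s ⟨hmem.1.trans hs.1, hs.2⟩).mono (Icc_subset_Icc_left hmem.1)).neg)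
      (fun s hs => ?_) ⟨le_rfl, hmem.2⟩
    · have hGa : 0 ≤ G a := integral_nonneg fun ω => mul_nonneg (Real.exp_pos _).le
        (mul_nonneg (by positivity) (Finset.sum_nonneg fun i _ => hh0 a hmem _))
      have h1 := exp_le_of_le_inv_seventeen (hexp a ⟨le_rfl, hmem.2⟩)
      have h2 : Real.exp (M.omega t₀ * (τ - a)) * Real.exp (-M.omega t₀ * (τ - a)) = 1 := by
        rw [← Real.exp_add]; simp
      have h3 : Real.exp (-M.omega t₀ * (τ - a)) * G τ ≤ G a := by linarith
      calc G τ = Real.exp (M.omega t₀ * (τ - a)) * (Real.exp (-M.omega t₀ * (τ - a)) * G τ) := by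
            rw [← mul_assoc, h2, one_mul]
        _ ≤ Real.exp (M.omega t₀ * (τ - a)) * G a :=
            mul_le_mul_of_nonneg_left h3 (Real.exp_pos _).le
        _ ≤ _ := mul_le_mul_of_nonneg_right h1 hGa
    · have hs0 : s ∈ Icc 0 τ := ⟨hmem.1.trans hs.1, hs.2⟩
      have e : G' s = -1 * feynmanKac (M.potential N 2) ℙ X s
          (fun x => avg (M.H s) x * avg (h s) x) := FKSetting.feynmanKac_const_mul _ _
      have h1 : -M.omega t₀ * G s ≤ feynmanKac (M.potential N 2) ℙ X s
          (fun x => avg (M.H s) x * avg (h s) x) := by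
        rw [← FKSetting.feynmanKac_const_mul]
        refine F.feynmanKac_mono hs0 fun x => ?_
        rw [avg_mul_avg, avg_eq_avg₂_right hN, ← avg₂_const_mul]
        refine avg₂_mono (fun y z => ?_) x
        exact mul_le_mul_of_nonneg_right
          (abs_le.1 (M.abs_H_le_omega ⟨hs0.1, hs0.2.trans hτ0.2⟩ y)).1 (hh0 s hs0 z)
      rw [e]
      linarith
  -- Before the cutoff G' is minus a mixed moment with H, hence minus a pure covariance, and is
  -- controlled by ε and the rate.
  have step2 : G a ≤ pairing (fun x => f x ^ 2) (M.μ τ) +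
      (M.eps ℙ X t p).toReal * (M.normLp p τ f).toReal ^ 2 * (M.Cbar t p q δ).toReal := by
    have hsub : Icc 0 a ⊆ Icc 0 τ := Icc_subset_Icc_right hmem.2
    have h1 := integral_eq_sub_of_hasDerivWithinAt_Icc hmem.1
      (fun s hs => (hd s (hsub hs)).mono hsub) (hGc.mono hsub)
    have h2 : G 0 = pairing (fun x => f x ^ 2) (M.μ τ) := by
      simp only [hG, hh]
      rw [M.feynmanKac_zero_avg hN hX, M.pairing_q hτ.1 _ ⟨le_rfl, hτ.1⟩]
    have h3 := M.integral_le_toReal_Cbar hτ hC (hGc.mono hsub)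
      (ENNReal.mul_ne_top heps hfin) fun s hs => ?_
    · simp only [ENNReal.toReal_mul, ENNReal.toReal_pow] at h3
      linarith
    · have hs0 : s ∈ Icc 0 τ := ⟨hs.1.le, hs.2.trans hmem.2⟩
      have b := (M.rateBound_q_sq (q := q) hp hpq hτ.1 hs0 f rfl).ofReal_abs_cov_le hN hX
        ⟨hs0.1, hs0.2.trans hτ.2⟩ hp0
      have e : G' s = -1 * M.mixedMoment N ℙ X s (M.H s) (h s) :=
        FKSetting.feynmanKac_const_mul _ _
      rw [M.pairing_H hs0.1, zero_mul, sub_zero] at b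
      rw [e, neg_one_mul]
      refine (ENNReal.ofReal_le_ofReal (neg_le_abs _)).trans (b.trans (le_of_eq ?_))
      ring
  have e : G τ = feynmanKac (M.potential N 2) ℙ X τ (avg fun y => f y ^ 2) := by
    simp only [hG, hh, M.q_self hτ.1]
  rw [← e]
  exact step1.trans (mul_le_mul_of_nonneg_left step2 (by norm_num))

end MainBounds

end Estimates

end EvolvingModel

end SeqMC

/-! ### Closing the estimate: a priori bound, choice of exponents, self-consistency. -/

namespace SeqMC

namespace EvolvingModel

section Conclusion

variable {S : Type*} [Fintype S] [MeasurableSpace S] [DiscreteMeasurableSpace S]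
  (M : EvolvingModel S) {N : ℕ} {Ω : Type*} [MeasurableSpace Ω] {ℙ : Measure Ω}
  [IsProbabilityMeasure ℙ] {X : ℝ → Ω → Fin N → S} {τ t t₀ δ : ℝ} {p p' q : ℝ≥0∞}

omit [DiscreteMeasurableSpace S] in
theorem Cbar_mono (h : t ≤ t₀) : M.Cbar t p q δ ≤ M.Cbar t₀ p q δ :=
  biSup_mono fun _ hτ => ⟨hτ.1, hτ.2.trans h⟩

omit [MeasurableSpace S] [DiscreteMeasurableSpace S] in
theorem omega_mul_inv_le : M.omega t₀ * (17 * M.omega t₀)⁻¹ ≤ 1 / 17 := by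
  -- When ω = 0, the convention `0⁻¹ = 0` makes the product 0.
  rcases eq_or_ne (M.omega t₀) 0 with h | h
  · rw [h]; norm_num
  · rw [mul_inv, mul_left_comm, mul_inv_cancel₀ h]; norm_num

/-- A bound on the mean square errors of normalized functions bounds their supremum. -/
theorem toReal_eps_le (hN : 0 < N) (hX : M.IsParticleSystem N ℙ X) (hp : 2 ≤ p) {B : ℝ}
    (h : ∀ τ ∈ Icc 0 t, ∀ f : S → ℝ, f ≠ 0 → (M.normLp p τ f).toReal ≤ 1 →
      M.mixedMoment N ℙ X τ f f - pairing f (M.μ τ) ^ 2 ≤ B) (hB : 0 ≤ B) :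
    (M.eps ℙ X t p).toReal ≤ B := by
  have hp0 : p ≠ 0 := (two_pos.trans_le hp).ne'
  refine ENNReal.toReal_le_of_le_ofReal hB (iSup₂_le fun τ hτ => iSup₂_le fun f hf => ?_)
  rcases eq_or_ne f 0 with rfl | hf0
  · refine (M.mse_le (t := τ) (p := p) ⟨hτ.1, le_rfl⟩ hp0 0).trans ?_
    rw [M.normLp_zero]; simp
  rw [(M.mse_eq hN hX hτ.1 f).1]
  exact ENNReal.ofReal_le_ofReal (h τ hτ f hf0
    (ENNReal.toReal_le_of_le_ofReal zero_le_one (by simpa using hf)))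

/-- The a priori bound for the uniform mean square error. -/
theorem toReal_eps_le_of_le (hX : M.IsParticleSystem N ℙ X) (hp : 2 ≤ p) (hpq : p ≤ q)
    (hδ : 0 ≤ δ) (hωδ : M.omega t₀ * δ ≤ 1 / 17) (ht : t ∈ Icc 0 t₀)
    (hC : M.Cbar t p q δ ≠ ∞) (hN : 50 ≤ (N : ℝ))
    (hNC : 25 * (M.Cbar t p q δ).toReal ≤ N) : (M.eps ℙ X t p).toReal ≤ 0.32 := by
  have hN0 : 0 < N := by
    have : (0 : ℝ) < N := by linarith
    exact_mod_cast this
  set e := (M.eps ℙ X t p).toReal with he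
  set c := (M.Cbar t p q δ).toReal with hc
  have he0 : 0 ≤ e := ENNReal.toReal_nonneg
  have hc0 : 0 ≤ c := ENNReal.toReal_nonneg
  have hNpos : (0 : ℝ) < N := by linarith
  -- The crude moment bound inserted into the second moment inequality, for ‖f‖_p ≤ 1; the 5c bounds
  -- the integral of V up to the cutoff.
  have key : e ≤ (19 / 16 * (17 / 16 * (1 + e * c)) + 5 * c + 6 * (e * c)) / N := by
    refine M.toReal_eps_le hN0 hX hp (fun τ hτ f _ hf => ?_) (by positivity)
    rw [le_div_iff₀ hNpos, mul_comm]
    have h1 := M.mixedMoment_sub_le hN0 hX hδ hωδ ht hτ f hp hpq hC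
    have h2 := M.feynmanKac_avg_sq_le hN0 hX hδ hωδ ht hτ f hp hpq hC
    have h3 := M.integral_V_le hp hpq hδ hωδ ht hτ hC f
    have h4 := M.pairing_sq_le hτ.1 hp f
    have hn : (M.normLp p τ f).toReal ^ 2 ≤ 1 := pow_le_one₀ ENNReal.toReal_nonneg hf
    rw [← he, ← hc] at h1 h2
    rw [← hc] at h3
    have h5 := mul_le_mul_of_nonneg_left hn (mul_nonneg he0 hc0)
    have h6 := mul_le_mul_of_nonneg_left hn hc0
    nlinarith [sq_nonneg (pairing f (M.μ τ))]
  rw [le_div_iff₀ hNpos] at key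
  have h1 : e * (25 * c) ≤ e * N := mul_le_mul_of_nonneg_left hNC he0
  -- With 25c ≤ N the terms in e c are absorbed on the left. The rest is at most N(0.0253 + 0.2), by
  -- N ≥ 50 and 5c ≤ N/5, and the left coefficient exceeds 0.709.
  have h2 : e * N * (1 - (19 / 16 * (17 / 16) + 6) / 25) ≤ N * (0.32 * 0.709) := by
    nlinarith
  have h3 : e * N ≤ 0.32 * N := by
    nlinarith [mul_nonneg he0 hNpos.le]
  exact le_of_mul_le_mul_right h3 hNpos

/-- The error bound in real form. -/
theorem mixedMoment_sub_le_of_exponents (hX : M.IsParticleSystem N ℙ X) (hp' : 2 ≤ p')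
    (hp'p : p' ≤ p / 2) (hpq : p ≤ q)
    (hδ : 0 ≤ δ) (hωδ : M.omega t₀ * δ ≤ 1 / 17) (ht : t ∈ Icc 0 t₀)
    (hC : M.Cbar t p q δ ≠ ∞) (hC' : M.Cbar t p' q δ ≠ ∞) (hN : 50 ≤ (N : ℝ))
    (hNC : 25 * (M.Cbar t p' q δ).toReal ≤ N) (hτ : τ ∈ Icc 0 t) (f : S → ℝ) :
    N * (M.mixedMoment N ℙ X τ f f - pairing f (M.μ τ) ^ 2) ≤
      (M.var τ f + ∫ s in (0 : ℝ)..τ, M.V s τ f) +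
      (1 + 7 * (M.Cbar t p q δ).toReal * (M.eps ℙ X t p).toReal) *
        (M.normLp p τ f).toReal ^ 2 := by
  have hN0 : 0 < N := by
    have : (0 : ℝ) < N := by linarith
    exact_mod_cast this
  have hhalf : p / 2 ≤ p := ENNReal.half_le_self
  have hp : 2 ≤ p := hp'.trans (hp'p.trans hhalf)
  have hp'0 : p' ≠ 0 := (two_pos.trans_le hp').ne'
  have hfin := M.normLp_ne_top hτ.1 p f
  have heps := M.eps_ne_top hN0 hX ht.1 hp'
  have h1 := M.mixedMoment_sub_le hN0 hX hδ hωδ ht hτ f hp hpq hC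
  have h2 := M.integral_V_add hδ hωδ ht hτ f
  have h3 := M.toReal_eps_le_of_le hX hp' (hp'p.trans (hhalf.trans hpq)) hδ hωδ ht hC' hN hNC
  have h4 := M.pairing_sq_le hτ.1 hp f
  -- The covariance of ν(1) and ν(f²) is measured in L^{p'}, where p' ≤ p/2 gives ‖f²‖_{p'} ≤
  -- ‖f‖_p².
  have h5 := M.ofReal_abs_cov_le_eps hN0 hX hτ hp'0 (fun _ => 1) fun x => f x ^ 2
  rw [M.normLp_one hτ.1 hp'0, one_mul, M.pairing_const hτ.1, one_mul] at h5
  have h6 := abs_le_toReal (ENNReal.mul_ne_top heps (ENNReal.pow_ne_top hfin))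
    (h5.trans (mul_le_mul' le_rfl ((M.normLp_mono hτ.1 hp'p _).trans (M.normLp_half_sq_le p f))))
  rw [ENNReal.toReal_mul, ENNReal.toReal_pow] at h6
  have e : M.mixedMoment N ℙ X τ (fun _ => 1) (fun x => f x ^ 2) =
      feynmanKac (M.potential N 2) ℙ X τ (avg fun y => f y ^ 2) := by
    simp only [mixedMoment, avg_one hN0, one_mul]
  rw [e] at h6
  have h7 := (abs_le.1 h6).2
  have h8 := mul_le_mul_of_nonneg_right h3 (sq_nonneg (M.normLp p τ f).toReal)
  have h9 : 0 ≤ (M.Cbar t p q δ).toReal * (M.eps ℙ X t p).toReal *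
      (M.normLp p τ f).toReal ^ 2 := by positivity
  rw [var]
  -- The excess over the variance is (3/16 + 1/16)⟨f²,μ⟩ + (19/16)·0.32‖f‖_p² ≤ 0.63‖f‖_p², below
  -- the allowed 1; likewise 6 is below 7.
  nlinarith [sq_nonneg (M.normLp p τ f).toReal]

end Conclusion

/-- The lower bound on p makes 1/q + 2/p at most 1/2. Writing 4q/(q − 2) as 4/(1 − 2/q) also covers
q = ∞. -/
theorem exponent_bounds {p q p' : ℝ≥0∞} (hq : 6 < q) (hp : 4 / (1 - 2 / q) < p)
    (hp' : p'⁻¹ = q⁻¹ + (p / 2)⁻¹) : 2 ≤ p' ∧ p' ≤ p / 2 := by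
  refine ⟨?_, ENNReal.inv_le_inv.1 (hp' ▸ le_add_self)⟩
  have h2q : 2 / q ≤ 1 := by
    refine ENNReal.div_le_of_le_mul ?_
    rw [one_mul]
    exact (by norm_num : (2 : ℝ≥0∞) ≤ 6).trans hq.le
  have h1 : p⁻¹ ≤ (1 - 2 / q) / 4 := by
    rw [← ENNReal.inv_div (Or.inr ENNReal.ofNat_ne_top) (Or.inr (by norm_num))]
    exact ENNReal.inv_le_inv.2 hp.le
  have h2 : p⁻¹ * 4 ≤ 1 - 2 / q :=
    (ENNReal.le_div_iff_mul_le (Or.inl (by norm_num)) (Or.inl ENNReal.ofNat_ne_top)).1 h1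
  have h3 : (p / 2)⁻¹ = 2 * p⁻¹ := by
    rw [ENNReal.inv_div (Or.inl ENNReal.ofNat_ne_top) (Or.inl two_ne_zero), div_eq_mul_inv]
  rw [← ENNReal.inv_le_inv, ENNReal.le_inv_iff_mul_le, hp', h3]
  calc (q⁻¹ + 2 * p⁻¹) * 2 = 2 / q + p⁻¹ * 4 := by rw [div_eq_mul_inv]; ring
    _ ≤ 2 / q + (1 - 2 / q) := by gcongr
    _ = 1 := add_tsub_cancel_of_le h2q

/-- Solving the self-consistent error bound. -/
theorem le_of_self_consistent {e w c N : ℝ} (he : 0 ≤ e) (hc : 0 ≤ c) (hN : 0 < N)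
    (hNC : 25 * c ≤ N) (h : N * e ≤ 2 + w + 7 * c * e) :
    e ≤ (2 + w) * (N⁻¹ * (1 + 10 * c * N⁻¹)) := by
  set x := c * N⁻¹ with hx
  have hx0 : 0 ≤ x := by positivity
  have hcx : c = N * x := by rw [hx]; field_simp
  have hx1 : x ≤ 1 / 25 := by
    rw [hcx] at hNC
    nlinarith
  have h1 : e * (1 - 7 * x) ≤ (2 + w) * N⁻¹ := by
    rw [le_mul_inv_iff₀ hN]
    rw [hcx] at h
    linarith
  -- The product is 1 + 3x − 70x², at least 1 for 0 ≤ x ≤ 3/70, and 1/25 < 3/70.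
  have h2 : 1 ≤ (1 - 7 * x) * (1 + 10 * x) := by nlinarith
  calc e ≤ e * ((1 - 7 * x) * (1 + 10 * x)) := le_mul_of_one_le_right he h2
    _ = e * (1 - 7 * x) * (1 + 10 * x) := by ring
    _ ≤ (2 + w) * N⁻¹ * (1 + 10 * x) := mul_le_mul_of_nonneg_right h1 (by positivity)
    _ = _ := by rw [hx]; ring

/-- At τ = 0 the integral vanishes; this excludes the value −∞. -/
theorem v_nonneg {S : Type*} [Fintype S] [MeasurableSpace S] (M : EvolvingModel S) {t : ℝ}
    (ht : 0 ≤ t) (p : ℝ≥0∞) : 0 ≤ M.v t p := by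
  obtain ⟨x⟩ := M.nonempty
  refine le_iSup₂_of_le (f := fun τ _ => ⨆ (f : S → ℝ) (_ : f ≠ 0),
    (((∫ s in (0 : ℝ)..τ, M.V s τ f) / (M.normLp p τ f).toReal ^ 2 : ℝ) : EReal)) 0 ⟨le_rfl, ht⟩
    (le_iSup₂_of_le (f := fun (f : S → ℝ) (_ : f ≠ 0) =>
    (((∫ s in (0 : ℝ)..0, M.V s 0 f) / (M.normLp p 0 f).toReal ^ 2 : ℝ) : EReal))
    (fun _ => 1) (fun h => one_ne_zero (congrFun h x)) ?_)
  simp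

theorem integral_V_le_of_v_eq {S : Type*} [Fintype S] [MeasurableSpace S]
    [DiscreteMeasurableSpace S] (M : EvolvingModel S) {t τ w : ℝ} {p : ℝ≥0∞} (hp : p ≠ 0)
    (hw : M.v t p = w) (hτ : τ ∈ Icc 0 t) {f : S → ℝ} (hf : f ≠ 0) :
    ∫ s in (0 : ℝ)..τ, M.V s τ f ≤ w * (M.normLp p τ f).toReal ^ 2 := by
  have h : (((∫ s in (0 : ℝ)..τ, M.V s τ f) / (M.normLp p τ f).toReal ^ 2 : ℝ) : EReal) ≤
      M.v t p :=
    le_iSup₂_of_le (f := fun τ _ => ⨆ (f : S → ℝ) (_ : f ≠ 0),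
      (((∫ s in (0 : ℝ)..τ, M.V s τ f) / (M.normLp p τ f).toReal ^ 2 : ℝ) : EReal)) τ hτ
      (le_iSup₂_of_le (f := fun (f : S → ℝ) (_ : f ≠ 0) =>
      (((∫ s in (0 : ℝ)..τ, M.V s τ f) / (M.normLp p τ f).toReal ^ 2 : ℝ) : EReal)) f hf le_rfl)
  rw [hw, EReal.coe_le_coe_iff] at h
  have hpos : 0 < (M.normLp p τ f).toReal :=
    ENNReal.toReal_pos (fun h0 => hf (M.normLp_eq_zero hτ.1 hp h0)) (M.normLp_ne_top hτ.1 p f)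
  exact (div_le_iff₀ (by positivity)).1 h

end EvolvingModel

end SeqMC

theorem theorem2p4 {S : Type*} [Fintype S] [MeasurableSpace S] [DiscreteMeasurableSpace S]
    (M : SeqMC.EvolvingModel S) {t₀ : ℝ} (ht₀ : 0 < t₀)
    {p q p' : ℝ≥0∞} (hq : 6 < q) (hp : 4 / (1 - 2 / q) < p) (hpq : p < q)
    (hp' : p'⁻¹ = q⁻¹ + (p / 2)⁻¹)
    {δ : ℝ} (hδ : δ = (17 * M.omega t₀)⁻¹)
    {N : ℕ} (hN : 25 * max 2 (max (M.Cbar t₀ p q δ) (M.Cbar t₀ p' q δ)) ≤ (N : ℝ≥0∞))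
    {Ω : Type*} [MeasurableSpace Ω] (ℙ : Measure Ω) [IsProbabilityMeasure ℙ]
    (X : ℝ → Ω → Fin N → S) (hX : M.IsParticleSystem N ℙ X)
    {t : ℝ} (ht : t ∈ Icc 0 t₀) :
    (∀ f : S → ℝ,
      (((N : ℝ≥0∞) * M.mse ℙ X t f : ℝ≥0∞) : EReal) ≤
        ((M.var t f + ∫ s in (0 : ℝ)..t, M.V s t f : ℝ) : EReal) +
          (((1 + 7 * M.Cbar t p q δ * M.eps ℙ X t p) * M.normLp p t f ^ 2 : ℝ≥0∞) : EReal)) ∧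
    ((M.eps ℙ X t p : ℝ≥0∞) : EReal) ≤
      (2 + M.v t p) *
        (((N : ℝ≥0∞)⁻¹ * (1 + 10 * M.Cbar t p q δ * (N : ℝ≥0∞)⁻¹) : ℝ≥0∞) : EReal) := by
  obtain ⟨hp'2, hp'p⟩ := SeqMC.EvolvingModel.exponent_bounds hq hp hp'
  have hp2 : 2 ≤ p := hp'2.trans (hp'p.trans ENNReal.half_le_self)
  have hp0 : p ≠ 0 := (two_pos.trans_le hp2).ne'
  have ht0 : t ∈ Icc 0 t₀ := ht
  have hω : M.omega t₀ * δ ≤ 1 / 17 := hδ ▸ M.omega_mul_inv_le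
  have hδ0 : 0 ≤ δ := by
    have := M.omega_nonneg (ht.1.trans ht.2)
    rw [hδ]; positivity
  have hbound : ∀ {x : ℝ≥0∞}, x ≤ max 2 (max (M.Cbar t₀ p q δ) (M.Cbar t₀ p' q δ)) →
      x ≠ ∞ ∧ 25 * x.toReal ≤ N := by
    intro x hx
    have h1 : 25 * x ≤ (N : ℝ≥0∞) := (mul_le_mul' le_rfl hx).trans hN
    have h2 := ENNReal.toReal_mono (ENNReal.natCast_ne_top N) h1
    refine ⟨fun h => ?_, by simpa using h2⟩
    rw [h, ENNReal.mul_top (by norm_num), top_le_iff] at h1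
    exact ENNReal.natCast_ne_top N h1
  have hN50 : (50 : ℝ) ≤ N := by
    have := (hbound (le_max_left _ _)).2
    norm_num at this
    exact_mod_cast this
  obtain ⟨hC, hNC⟩ := hbound ((M.Cbar_mono ht.2).trans
    ((le_max_left _ _).trans (le_max_right _ _)) : M.Cbar t p q δ ≤ _)
  obtain ⟨hC', hNC'⟩ := hbound ((M.Cbar_mono ht.2).trans
    ((le_max_right _ _).trans (le_max_right _ _)) : M.Cbar t p' q δ ≤ _)
  have hNpos : (0 : ℝ) < N := by linarith
  have hN0 : 0 < N := by exact_mod_cast hNpos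
  have heps := M.eps_ne_top hN0 hX ht.1 hp2
  have key := fun {τ : ℝ} (hτ : τ ∈ Icc 0 t) (f : S → ℝ) =>
    M.mixedMoment_sub_le_of_exponents hX hp'2 hp'p hpq.le hδ0 hω ht hC hC' hN50 hNC' hτ f
  refine ⟨fun f => ?_, ?_⟩
  · obtain ⟨hm, hm0⟩ := M.mse_eq hN0 hX ht.1 f
    have hfin : (1 + 7 * M.Cbar t p q δ * M.eps ℙ X t p) * M.normLp p t f ^ 2 ≠ ∞ :=
      ENNReal.mul_ne_top (ENNReal.add_ne_top.2 ⟨ENNReal.one_ne_top, ENNReal.mul_ne_top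
        (ENNReal.mul_ne_top ENNReal.ofNat_ne_top hC) heps⟩)
        (ENNReal.pow_ne_top (M.normLp_ne_top ht.1 p f))
    have hl : (N : ℝ≥0∞) * M.mse ℙ X t f ≠ ∞ :=
      ENNReal.mul_ne_top (ENNReal.natCast_ne_top N) (hm ▸ ENNReal.ofReal_ne_top)
    rw [← EReal.coe_ennreal_toReal hfin, ← EReal.coe_ennreal_toReal hl, ← EReal.coe_add,
      EReal.coe_le_coe_iff, ENNReal.toReal_mul, ENNReal.toReal_mul, ENNReal.toReal_natCast, hm,
      ENNReal.toReal_ofReal hm0, ENNReal.toReal_add ENNReal.one_ne_top (ENNReal.mul_ne_top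
        (ENNReal.mul_ne_top ENNReal.ofNat_ne_top hC) heps)]
    simpa using key ⟨ht.1, le_rfl⟩ f
  · have hNinv : (N : ℝ≥0∞)⁻¹ ≠ ∞ := ENNReal.inv_ne_top.2 (by exact_mod_cast hN0.ne')
    have hNinv0 : (N : ℝ≥0∞)⁻¹ ≠ 0 := ENNReal.inv_ne_zero.2 (ENNReal.natCast_ne_top N)
    have hsum : 1 + 10 * M.Cbar t p q δ * (N : ℝ≥0∞)⁻¹ ≠ ∞ :=
      ENNReal.add_ne_top.2 ⟨ENNReal.one_ne_top, ENNReal.mul_ne_top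
        (ENNReal.mul_ne_top ENNReal.ofNat_ne_top hC) hNinv⟩
    have hv := M.v_nonneg ht.1 p
    -- An infinite v makes the bound trivial, so no proof that v is finite is required.
    induction hv' : M.v t p with
    | bot => rw [hv'] at hv; simp at hv
    | top =>
      have e : (2 : EReal) + ⊤ = ⊤ := EReal.add_top_of_ne_bot (by decide)
      rw [e, EReal.top_mul_of_pos]
      · exact le_top
      · rw [EReal.coe_ennreal_pos]
        exact ENNReal.mul_pos hNinv0 (one_pos.trans_le le_self_add).ne'
    | coe w =>
      rw [hv', EReal.coe_nonneg] at hv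
      set e := (M.eps ℙ X t p).toReal with he
      set c := (M.Cbar t p q δ).toReal with hc
      have he0 : 0 ≤ e := ENNReal.toReal_nonneg
      have hc0 : 0 ≤ c := ENNReal.toReal_nonneg
      -- For ‖f‖_p ≤ 1 the variance is at most 1 and the V integral at most w; with the explicit 1
      -- of the first bound this gives 2 + w.
      have h1 : e ≤ (2 + w + 7 * c * e) / N := by
        refine M.toReal_eps_le hN0 hX hp2 (fun τ hτ f hf hf1 => ?_) (by positivity)
        rw [le_div_iff₀ hNpos, mul_comm]
        have k1 := key hτ f
        have k2 := M.integral_V_le_of_v_eq hp0 hv' hτ hf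
        have k3 := M.pairing_sq_le hτ.1 hp2 f
        have hn : (M.normLp p τ f).toReal ^ 2 ≤ 1 := pow_le_one₀ ENNReal.toReal_nonneg hf1
        have k4 := mul_le_mul_of_nonneg_left hn (by positivity : 0 ≤ 2 + w + 7 * c * e)
        rw [SeqMC.EvolvingModel.var] at k1
        nlinarith [sq_nonneg (SeqMC.pairing f (M.μ τ))]
      rw [le_div_iff₀ hNpos, mul_comm] at h1
      have h2 := SeqMC.EvolvingModel.le_of_self_consistent he0 hc0 hNpos hNC h1
      have h3 : (2 : EReal) = ((2 : ℝ) : EReal) := rfl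
      rw [← EReal.coe_ennreal_toReal heps, ← EReal.coe_ennreal_toReal
        (ENNReal.mul_ne_top hNinv hsum), h3, ← EReal.coe_add, ← EReal.coe_mul,
        EReal.coe_le_coe_iff, ENNReal.toReal_mul, ENNReal.toReal_add ENNReal.one_ne_top
        (ENNReal.mul_ne_top (ENNReal.mul_ne_top ENNReal.ofNat_ne_top hC) hNinv)]
      simpa using h2
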